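/- Theorem 3. Let $(M,g_M)$ and $(N,g_N)$ be smooth Riemannian manifolds (Hausdorff, second countable, without boundary) with $\dim M=m>n=\dim N\ge 1$, and let $N$ be oriented with volume form $\mathrm{vol}_N$. Let $F:[0,\infty)\to[0,\infty)$ be continuous and strictly increasing with $F(0)=0$, of class $C^2$ on $(0,\infty)$ with $F'(t)>0$ for all $t>0$. Let $u:M\to N$ be a smooth submersion with horizontal distribution $\mathcal H_x=(\ker du_x)^{\perp}$, and suppose that $u$ is horizontally conformal with dilation $\lambda$: $\lambda:M\to(0,\infty)$ is smooth and $g_N(du_x X,du_x Y)=\lambda(x)^2g_M(X,Y)$ for all $x\in M$ and $X,Y\in\mathcal H_x$. Suppose that $u$ is $F$-harmonic, i.e. a critical point of $\int F\big(\tfrac12|du|^2\big)\,dv_{g_M}$ with respect to all smooth variations of $u$ that are constant outside a compact set. Suppose that the mean curvature vector of $\mathcal H$, that is $\frac1n\sum_{i=1}^n(\nabla_{e_i}e_i)^{\perp}$ for local orthonormal frames $e_1,\dots,e_n$ of $\mathcal H$ (with $\nabla$ the Levi-Civita connection of $M$ and $\perp$ the projection onto $\mathcal H^{\perp}$), equals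 $\frac{\operatorname{grad}(\lambda^2)}{2\lambda^2}$, and that the zeros of $t\mapsto (n-2)F'(t)-2tF''(t)$ in $(0,\infty)$ are isolated. Then the $n$-form $u^*\mathrm{vol}_N$ is harmonic, i.e. $(d\delta+\delta d)(u^*\mathrm{vol}_N)=0$, if and only if $\mathcal H$ is completely integrable, i.e. through every point of $M$ passes an $n$-dimensional integral manifold of $\mathcal H$. Likewise, $u^*\mathrm{vol}_N$ is closed and co-closed if and only if $\mathcal H$ is completely integrable. -/

import Mathlib

open Set Filter MeasureTheory Bundle
open scoped Manifold ContDiff Topology ENNReal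

noncomputable section

namespace FHarmonic

/-- Tangent spaces of an `m`-dimensional manifold are finite-dimensional. -/
instance instFiniteDimensionalTangentSpace {m : ℕ} {M : Type*} [TopologicalSpace M]
    [ChartedSpace (EuclideanSpace ℝ (Fin m)) M] (x : M) :
    FiniteDimensional ℝ (TangentSpace (𝓡 m) x) :=
  inferInstanceAs (FiniteDimensional ℝ (EuclideanSpace ℝ (Fin m)))

section OneManifold

variable {m : ℕ} {M : Type*} [TopologicalSpace M] [ChartedSpace (EuclideanSpace ℝ (Fin m)) M]

/-! ### Vector fields, distributions and differential forms -/

/-- (Not necessarily continuous) vector fields on `M`. -/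
abbrev VField (m : ℕ) (M : Type*) [TopologicalSpace M]
    [ChartedSpace (EuclideanSpace ℝ (Fin m)) M] : Type _ :=
  ∀ x : M, TangentSpace (𝓡 m) x

/-- (Not necessarily continuous) tangent distributions on `M`. -/
abbrev Distribution (m : ℕ) (M : Type*) [TopologicalSpace M]
    [ChartedSpace (EuclideanSpace ℝ (Fin m)) M] : Type _ :=
  ∀ x : M, Submodule ℝ (TangentSpace (𝓡 m) x)

/-- (Not necessarily continuous) differential `p`-forms on `M`. -/
abbrev DForm (m : ℕ) (M : Type*) [TopologicalSpace M]
    [ChartedSpace (EuclideanSpace ℝ (Fin m)) M] (p : ℕ) : Type _ :=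
  ∀ x : M, TangentSpace (𝓡 m) x [⋀^Fin p]→L[ℝ] ℝ

/-- The vector field `X` is smooth near the point `x`. -/
def SmoothFieldAt [IsManifold (𝓡 m) ∞ M] (X : VField m M) (x : M) : Prop :=
  ContMDiffAt (𝓡 m) (𝓡 m).tangent ∞ (fun y => (⟨y, X y⟩ : TangentBundle (𝓡 m) M)) x

/-- The form `α` read in the preferred chart at `x`, that is, its pullback under the inverse
chart. -/
def formInChart {p : ℕ} (α : DForm m M p) (x : M) (y : EuclideanSpace ℝ (Fin m)) :
    EuclideanSpace ℝ (Fin m) [⋀^Fin p]→L[ℝ] ℝ :=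
  (α ((extChartAt (𝓡 m) x).symm y)).compContinuousLinearMap
    (mfderiv (𝓡 m) (𝓡 m) (extChartAt (𝓡 m) x).symm y :
      EuclideanSpace ℝ (Fin m) →L[ℝ] TangentSpace (𝓡 m) ((extChartAt (𝓡 m) x).symm y))

/-- Smooth differential forms: all local representations in charts are smooth. -/
def IsSmoothForm {p : ℕ} (α : DForm m M p) : Prop :=
  ∀ x : M, ContDiffOn ℝ ∞ (formInChart α x) (extChartAt (𝓡 m) x).target

/-- The exterior derivative, computed at `x` in the preferred chart at `x`. -/
def extD {p : ℕ} (α : DForm m M p) : DForm m M (p + 1) := fun x =>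
  (extDeriv (formInChart α x) (extChartAt (𝓡 m) x x)).compContinuousLinearMap
    (mfderiv (𝓡 m) (𝓡 m) (extChartAt (𝓡 m) x) x :
      TangentSpace (𝓡 m) x →L[ℝ] EuclideanSpace ℝ (Fin m))

/-- A distribution is completely integrable (of rank `r`) if through every point passes an
integral manifold, here given by a local parametrization: a smooth map from an open neighbourhood
of `0` in `ℝ^r` whose differential at every point `t` is injective with image the distribution. -/
def IsCompletelyIntegrable (r : ℕ) (D : Distribution m M) : Prop :=
  ∀ x : M, ∃ (U : Set (EuclideanSpace ℝ (Fin r))) (j : EuclideanSpace ℝ (Fin r) → M),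
    IsOpen U ∧ 0 ∈ U ∧ j 0 = x ∧ ContMDiffOn (𝓡 r) (𝓡 m) ∞ j U ∧
    ∀ t ∈ U, Function.Injective (mfderiv (𝓡 r) (𝓡 m) j t) ∧
      LinearMap.range (mfderiv (𝓡 r) (𝓡 m) j t).toLinearMap = D (j t)

variable [RiemannianBundle (fun x : M => TangentSpace (𝓡 m) x)]

/-! ### Riemannian notions -/

/-- The Riemannian gradient of a function. -/
def grad (f : M → ℝ) : VField m M := fun x =>
  ∑ i, mvfderiv (𝓡 m) f x (stdOrthonormalBasis ℝ (TangentSpace (𝓡 m) x) i) •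
    stdOrthonormalBasis ℝ (TangentSpace (𝓡 m) x) i

/-- The Riemannian density `√(det (g_ij))` in the preferred chart at `x`. -/
def chartDensity (x : M) (y : EuclideanSpace ℝ (Fin m)) : ℝ :=
  √(Matrix.det (Matrix.of fun i j : Fin m =>
    inner ℝ
      (mfderiv (𝓡 m) (𝓡 m) (extChartAt (𝓡 m) x).symm y (EuclideanSpace.single i (1 : ℝ)) :
        TangentSpace (𝓡 m) ((extChartAt (𝓡 m) x).symm y))
      (mfderiv (𝓡 m) (𝓡 m) (extChartAt (𝓡 m) x).symm y (EuclideanSpace.single j (1 : ℝ)))))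

/-- The Riemannian volume measure of the domain of the preferred chart at `x`, as a measure
on `M`. -/
def chartVolume [MeasurableSpace M] (x : M) : Measure M :=
  (((volume : Measure (EuclideanSpace ℝ (Fin m))).restrict
    (extChartAt (𝓡 m) x).target).withDensity
      (fun y => ENNReal.ofReal (chartDensity x y))).map (extChartAt (𝓡 m) x).symm

variable (m M) in
/-- The Riemannian volume measure of `M`. The measures `chartVolume x` agree on overlaps of
charts; their supremum is the measure obtained by gluing them. -/
def riemannianVolume [MeasurableSpace M] : Measure M := ⨆ x : M, chartVolume (m := m) x

/-- The right-hand side of the Koszul formula, which equals `⟪∇_X Y, Z⟫`. -/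
def koszul (X Y Z : VField m M) (x : M) : ℝ :=
  (1 / 2 : ℝ) *
    (mvfderiv (𝓡 m) (fun y => inner ℝ (Y y) (Z y)) x (X x)
      + mvfderiv (𝓡 m) (fun y => inner ℝ (X y) (Z y)) x (Y x)
      - mvfderiv (𝓡 m) (fun y => inner ℝ (X y) (Y y)) x (Z x)
      + inner ℝ (VectorField.mlieBracket (𝓡 m) X Y x) (Z x)
      - inner ℝ (VectorField.mlieBracket (𝓡 m) X Z x) (Y x)
      - inner ℝ (VectorField.mlieBracket (𝓡 m) Y Z x) (X x))

/-- The Levi-Civita connection `∇_X Y`, defined by the Koszul formula. -/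
def leviCivita [IsManifold (𝓡 m) ∞ M] (X Y : VField m M) : VField m M := fun x =>
  ∑ i, koszul X Y
      (FiberBundle.extend (EuclideanSpace ℝ (Fin m))
        (stdOrthonormalBasis ℝ (TangentSpace (𝓡 m) x) i)) x •
    stdOrthonormalBasis ℝ (TangentSpace (𝓡 m) x) i

/-- `(∇_X α)(W_1, …, W_p)`, the covariant derivative of a `p`-form. -/
def covDerivForm [IsManifold (𝓡 m) ∞ M] {p : ℕ} (α : DForm m M p) (X : VField m M)
    (W : Fin p → VField m M) (x : M) : ℝ :=
  mvfderiv (𝓡 m) (fun y => α y (fun j => W j y)) x (X x)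
    - ∑ j, α x (Function.update (fun i => W i x) j (leviCivita X (W j) x))

/-- `β` is the codifferential `δα` of the smooth `(p+1)`-form `α`:
`(δα)(W_1, …, W_p) = - ∑ᵢ (∇_{Eᵢ} α)(Eᵢ, W_1, …, W_p)` at every point `x`, for all vector fields
`Wⱼ`, `Eᵢ` smooth near `x` such that the `Eᵢ` form an orthonormal basis at `x`. -/
def IsCodifferential [IsManifold (𝓡 m) ∞ M] {p : ℕ} (α : DForm m M (p + 1)) (β : DForm m M p) :
    Prop :=
  ∀ (x : M) (b : OrthonormalBasis (Fin m) ℝ (TangentSpace (𝓡 m) x)) (E : Fin m → VField m M)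
    (W : Fin p → VField m M),
    (∀ i, SmoothFieldAt (E i) x) → (∀ i, E i x = b i) → (∀ j, SmoothFieldAt (W j) x) →
    β x (fun j => W j x) = - ∑ i, covDerivForm α (E i) (Matrix.vecCons (E i) W) x

/-- `δα = 0` (automatic for functions). -/
def IsCoclosed [IsManifold (𝓡 m) ∞ M] : {p : ℕ} → DForm m M p → Prop
  | 0, _ => True
  | _ + 1, α => IsCodifferential α 0

/-- Harmonic forms: smooth forms with vanishing Hodge Laplacian, `dδα + δdα = 0`.
In the case of positive degree, `β = δα` and `γ = δdα`. -/
def IsHarmonicForm [IsManifold (𝓡 m) ∞ M] : {p : ℕ} → DForm m M p → Prop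
  | 0, α => IsSmoothForm α ∧ IsCodifferential (extD α) 0
  | p + 1, α => IsSmoothForm α ∧ ∃ (β : DForm m M p) (γ : DForm m M (p + 1)),
      IsSmoothForm β ∧ IsCodifferential α β ∧ IsCodifferential (extD α) γ ∧
        ∀ x, extD β x + γ x = 0

/-- `vol` is the volume form of the `m`-dimensional Riemannian manifold `M` with respect to an
orientation of `M`: a smooth `m`-form equal to `1` or `-1` on each orthonormal basis of each
tangent space (the bases with value `1` being the positively oriented ones). -/
def IsVolumeForm (vol : DForm m M m) : Prop :=
  IsSmoothForm vol ∧
    ∀ (x : M) (b : OrthonormalBasis (Fin m) ℝ (TangentSpace (𝓡 m) x)), |vol x (fun i => b i)| = 1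

/-- The vector field `H` is the mean curvature vector of the distribution `D` of rank `r`: it is
normal to `D` and `H = (1/r) ∑ᵢ (∇_{Eᵢ} Eᵢ)^⊥` at every point `x`, where `E_1, …, E_r` are
any vector fields smooth near `x` and tangent to `D` which form an orthonormal basis of `D x` at
`x`. -/
def IsMeanCurvatureVector [IsManifold (𝓡 m) ∞ M] (r : ℕ) (D : Distribution m M)
    (H : VField m M) : Prop :=
  ∀ x : M, H x ∈ (D x)ᗮ ∧
    ∀ (b : OrthonormalBasis (Fin r) ℝ (D x)) (E : Fin r → VField m M),
      (∀ i, SmoothFieldAt (E i) x) → (∀ i, ∀ᶠ y in 𝓝 x, E i y ∈ D y) →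
      (∀ i, E i x = (b i : TangentSpace (𝓡 m) x)) →
      ∀ V ∈ (D x)ᗮ, inner ℝ (H x) V =
        (1 / (r : ℝ)) * ∑ i, inner ℝ (leviCivita (E i) (E i) x) V

end OneManifold

/-! ### Maps between Riemannian manifolds -/

section TwoManifolds

variable {m n : ℕ}
  {M : Type*} [TopologicalSpace M] [ChartedSpace (EuclideanSpace ℝ (Fin m)) M]
  {N : Type*} [TopologicalSpace N] [ChartedSpace (EuclideanSpace ℝ (Fin n)) N]

/-- The pullback `u^* α` of a differential form. -/
def pullbackForm {p : ℕ} (u : M → N) (α : DForm n N p) : DForm m M p := fun x =>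
  (α (u x)).compContinuousLinearMap (mfderiv (𝓡 m) (𝓡 n) u x)

variable [RiemannianBundle (fun x : M => TangentSpace (𝓡 m) x)]

/-- The horizontal distribution of `u`: the orthogonal complement of the kernel of `du`. -/
def horizontal (m n : ℕ)
    {M : Type*} [TopologicalSpace M] [ChartedSpace (EuclideanSpace ℝ (Fin m)) M]
    {N : Type*} [TopologicalSpace N] [ChartedSpace (EuclideanSpace ℝ (Fin n)) N]
    [RiemannianBundle (fun x : M => TangentSpace (𝓡 m) x)] (u : M → N) : Distribution m M :=
  fun x => (LinearMap.ker (mfderiv (𝓡 m) (𝓡 n) u x).toLinearMap)ᗮ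

variable [RiemannianBundle (fun y : N => TangentSpace (𝓡 n) y)]

/-- The smooth map `u` is a horizontally conformal submersion with dilation `lam`. -/
structure IsHorizontallyConformalSubmersion (u : M → N) (lam : M → ℝ) : Prop where
  smooth : ContMDiff (𝓡 m) (𝓡 n) ∞ u
  surjective : ∀ x, Function.Surjective (mfderiv (𝓡 m) (𝓡 n) u x)
  smooth_dilation : ContMDiff (𝓡 m) 𝓘(ℝ, ℝ) ∞ lam
  dilation_pos : ∀ x, 0 < lam x
  conformal : ∀ x, ∀ X ∈ horizontal m n u x, ∀ Y ∈ horizontal m n u x,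
    inner ℝ (mfderiv (𝓡 m) (𝓡 n) u x X) (mfderiv (𝓡 m) (𝓡 n) u x Y) = lam x ^ 2 * inner ℝ X Y

/-- The energy density `e_u = |du|² / 2`, with the Hilbert-Schmidt norm of `du`. -/
def energyDensity (m n : ℕ)
    {M : Type*} [TopologicalSpace M] [ChartedSpace (EuclideanSpace ℝ (Fin m)) M]
    {N : Type*} [TopologicalSpace N] [ChartedSpace (EuclideanSpace ℝ (Fin n)) N]
    [RiemannianBundle (fun x : M => TangentSpace (𝓡 m) x)]
    [RiemannianBundle (fun y : N => TangentSpace (𝓡 n) y)] (u : M → N) (x : M) : ℝ :=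
  (1 / 2 : ℝ) *
    ∑ i, ‖mfderiv (𝓡 m) (𝓡 n) u x (stdOrthonormalBasis ℝ (TangentSpace (𝓡 m) x) i)‖ ^ 2

/-- `u` is `F`-harmonic: it is smooth and a critical point of the `F`-energy
`∫ F (|du|² / 2) dv` with respect to smooth variations `U t = U (t, ·)` of `u = U 0` that are
constant outside a compact set `K`. -/
def IsFHarmonic [MeasurableSpace M] (F : ℝ → ℝ) (u : M → N) : Prop :=
  ContMDiff (𝓡 m) (𝓡 n) ∞ u ∧
    ∀ (U : ℝ × M → N) (K : Set M), ContMDiff (𝓘(ℝ, ℝ).prod (𝓡 m)) (𝓡 n) ∞ U →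
      (∀ x, U (0, x) = u x) → IsCompact K → (∀ t, ∀ x ∉ K, U (t, x) = u x) →
      HasDerivAt
        (fun t => ∫ x in K, F (energyDensity m n (fun z => U (t, z)) x) ∂(riemannianVolume m M))
        0 0

end TwoManifolds

/-- The functions `F : [0, ∞) → [0, ∞)` admitted in the `F`-energy: `F 0 = 0`, `F` continuous
and strictly increasing, and `C²` with `F' > 0` on `(0, ∞)`. Only values of `F` on `[0, ∞)`
matter. -/
structure IsEnergyFunction (F : ℝ → ℝ) : Prop where
  map_zero : F 0 = 0
  continuousOn : ContinuousOn F (Ici 0)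
  strictMonoOn : StrictMonoOn F (Ici 0)
  contDiffOn : ContDiffOn ℝ 2 F (Ioi 0)
  deriv_pos : ∀ t, 0 < t → 0 < deriv F t

end FHarmonic

end

/-!
Let `ω` be the pulled back volume form, `λ` the dilation and `ℋ` the horizontal distribution. The
form `ω` is closed, being the pullback of a form of top degree (`extD_pullbackForm`), so it is
harmonic if and only if `δω` is closed.

The mean curvature vector of `ℋ` is vertical by definition, so the hypothesis on it gives that
`grad (λ ^ 2)` is vertical (`mvfderiv_eq_zero_of_horizontal`). This has two consequences, both
expressed with the bilinear map `B = D²u - Du ∘ Γ`, where `Γ` denotes the Christoffel symbols of the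
domain.

* On horizontal vectors, `B` is minus the pullback of the Christoffel symbols of the target
  (`ConformalJet.h_B_LL`): the map `u` behaves like a Riemannian submersion in horizontal directions.
* An `F`-harmonic map of this kind has minimal fibres, i.e. the vertical trace of `B` vanishes
  (`hasMinimalFibres_of_isFHarmonic`). Indeed the energy density is `n * λ ^ 2 / 2`, so the factor
  `F'(n * λ ^ 2 / 2)` in the first variation is positive and has no derivative in horizontal
  directions. After an integration by parts it factors out of the Euler–Lagrange equation, whose
  horizontal part is an identity (`ConformalJet.sum_B_eq_zero_of_trace`). Only variations supported
  in a chart and parallel to a constant vector of a chart of the target are needed.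

In the divergence of `ω`, the horizontal part vanishes since the volume form of the target is
parallel, the vertical part since the fibres are minimal. What is left is the mixed part of `B`
(`ConformalJet.sum_covPullback`), and the skew-symmetric part of the bilinear form `h(B(L r, A), s)`
in `r, s`, for a vertical vector `A`, is `λ ^ 2 / 2` times the inner product of `A` with the
integrability tensor `[L r, L s]` of `ℋ` (`ConformalJet.h_B_vert`). As `ω` is alternating, only this
skew-symmetric part matters. Hence `δω = 0` if the integrability tensor vanishes
(`ConformalJet.mixed_eq_zero`). Conversely, `d(δω)` evaluated on the horizontal lift of an
orthonormal frame is, up to a nonzero factor, the sum of the squared norms of the integrability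
tensor on pairs of vectors of the frame, so the tensor vanishes if `δω` is closed
(`ConformalJet.bracket_eq_zero_of_closed`).

Finally, the integrability tensor vanishes if and only if `ℋ` is completely integrable. One direction
is the symmetry of the second derivative of an integral manifold
(`ConformalModel.bracket_eq_zero_of_integral`). For the other, integral manifolds are the solutions
`f` of the total differential equation `Df = L ∘ f`, whose compatibility condition is the vanishing of
the tensor; they are obtained by solving an ordinary differential equation along each ray
(`exists_solution_total_ode`).

The computations take place in charts: a `ConformalModel` is a horizontally conformal submersion
between open subsets of vector spaces with Riemannian metrics, and a `ConformalJet` consists of its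
first order data at a point, to which the pointwise identities reduce.
-/

namespace FHarmonic

local notation "ℰ" m:max => EuclideanSpace ℝ (Fin m)

/-! ### First order jets of horizontally conformal submersions -/

section Frames

variable {E V : Type*} [NormedAddCommGroup E] [NormedSpace ℝ E] [AddCommGroup V] [Module ℝ V]
  {ι κ : Type*} [Fintype ι] [Fintype κ]

/-- A finite family `e` is a Parseval frame of the bilinear form `G` if `v = ∑ G(v, eᵢ) eᵢ` for all
`v`. Orthonormal bases are Parseval frames; so is the union of an orthonormal basis of a subspace
and of the projection of an orthonormal basis to the orthogonal complement. -/
def IsParseval (G : E →L[ℝ] E →L[ℝ] ℝ) (e : ι → E) : Prop :=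
  ∀ v, ∑ i, G v (e i) • e i = v

/-- The trace of a bilinear map does not depend on the Parseval frame. -/
theorem IsParseval.sum_eq {G : E →L[ℝ] E →L[ℝ] ℝ} (hG : ∀ v w, G v w = G w v) {e : ι → E}
    {c : κ → E} (he : IsParseval G e) (hc : IsParseval G c) (T : E →ₗ[ℝ] E →ₗ[ℝ] V) :
    ∑ i, T (e i) (e i) = ∑ j, T (c j) (c j) := by
  have h1 : ∀ i, T (e i) (e i) = ∑ j, G (e i) (c j) • T (e i) (c j) := fun i => by
    conv_lhs => enter [2]; rw [← hc (e i)]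
    simp
  have h2 : ∀ j, T (c j) (c j) = ∑ i, G (e i) (c j) • T (e i) (c j) := fun j => by
    conv_lhs => enter [1]; rw [← he (c j)]
    simp [hG (c j)]
  rw [Finset.sum_congr rfl fun i _ => h1 i, Finset.sum_comm]
  exact Finset.sum_congr rfl fun j _ => (h2 j).symm

end Frames

/-- The first order data, at a point of a chart, of a horizontally conformal submersion `u` with
dilation `λ` whose gradient is vertical: the metrics `G`, `h` of the domain and of the target with
their derivatives `DG`, `Dh`, the first two derivatives `Du`, `D2u` of `u`, the horizontal lift `L`
of tangent vectors of the target with its derivative `DL`, the square `a = λ ^ 2` with its derivative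
`da`, and the Christoffel symbols `Γ` of `G`. The relations are `Du ∘ L = id` and the fact that
`a • L` is the adjoint of `Du`, with their derivatives. -/
structure ConformalJet (E F : Type*) [NormedAddCommGroup E] [NormedSpace ℝ E]
    [NormedAddCommGroup F] [NormedSpace ℝ F] where
  G : E →L[ℝ] E →L[ℝ] ℝ
  DG : E →L[ℝ] E →L[ℝ] E →L[ℝ] ℝ
  h : F →L[ℝ] F →L[ℝ] ℝ
  Dh : F →L[ℝ] F →L[ℝ] F →L[ℝ] ℝ
  Du : E →L[ℝ] F
  D2u : E →L[ℝ] E →L[ℝ] F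
  L : F →L[ℝ] E
  DL : E →L[ℝ] F →L[ℝ] E
  a : ℝ
  da : E →L[ℝ] ℝ
  Γ : E →L[ℝ] E →L[ℝ] E
  G_symm : ∀ v w, G v w = G w v
  DG_symm : ∀ X v w, DG X v w = DG X w v
  h_symm : ∀ v w, h v w = h w v
  Dh_symm : ∀ X v w, Dh X v w = Dh X w v
  D2u_symm : ∀ v w, D2u v w = D2u w v
  G_pos : ∀ v, v ≠ 0 → 0 < G v v
  h_pos : ∀ v, v ≠ 0 → 0 < h v v
  a_pos : 0 < a
  Γ_spec : ∀ X Y Z, 2 * G (Γ X Y) Z = DG X Y Z + DG Y X Z - DG Z X Y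
  lift : ∀ r, Du (L r) = r
  adj : ∀ r v, a * G (L r) v = h r (Du v)
  d_lift : ∀ X r, D2u X (L r) + Du (DL X r) = 0
  d_adj : ∀ X r v, da X * G (L r) v + a * (DG X (L r) v + G (DL X r) v) =
    Dh (Du X) r (Du v) + h r (D2u X v)
  da_horiz : ∀ r, da (L r) = 0

namespace ConformalJet

variable {E F : Type*} [NormedAddCommGroup E] [NormedSpace ℝ E]
    [NormedAddCommGroup F] [NormedSpace ℝ F] (J : ConformalJet E F)

/-- The vertical projection. -/
noncomputable def P : E →L[ℝ] E := ContinuousLinearMap.id ℝ E - J.L ∘L J.Du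

theorem P_apply (v : E) : J.P v = v - J.L (J.Du v) := rfl

theorem Du_P (v : E) : J.Du (J.P v) = 0 := by simp [P_apply, J.lift]

theorem P_L (r : F) : J.P (J.L r) = 0 := by simp [P_apply, J.lift]

theorem eq_add_P (v : E) : v = J.L (J.Du v) + J.P v := by simp [P_apply]

theorem G_L_vert {A : E} (hA : J.Du A = 0) (r : F) : J.G (J.L r) A = 0 := by
  have := J.adj r A
  rw [hA, map_zero] at this
  exact (mul_eq_zero.1 this).resolve_left J.a_pos.ne'

theorem h_ext {r s : F} (H : ∀ w, J.h r w = J.h s w) : r = s := by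
  by_contra hne
  have := J.h_pos (r - s) (sub_ne_zero.2 hne)
  simp [H] at this

/-- The part `D²u(X, Y) - Du(Γ(X, Y))` of the second fundamental form of `u` that comes from the
domain. -/
noncomputable def B : E →L[ℝ] E →L[ℝ] F :=
  J.D2u - (ContinuousLinearMap.compL ℝ E E F J.Du) ∘L J.Γ

theorem B_apply (X Y : E) : J.B X Y = J.D2u X Y - J.Du (J.Γ X Y) := rfl

/-- The adjunction between `Du` and `λ ^ 2 L` moves the Christoffel term to the domain. -/
theorem h_B (X Y : E) (w : F) :
    J.h w (J.B X Y) = J.h w (J.D2u X Y) - J.a * J.G (J.L w) (J.Γ X Y) := by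
  rw [B_apply, map_sub, J.adj]

/-- The bracket of the horizontal lifts of two constant vector fields. -/
noncomputable def bracket (r s : F) : E := J.DL (J.L r) s - J.DL (J.L s) r

theorem Du_bracket (r s : F) : J.Du (J.bracket r s) = 0 := by
  have h1 := J.d_lift (J.L r) s
  have h2 := J.d_lift (J.L s) r
  rw [J.D2u_symm] at h2
  have : J.Du (J.DL (J.L r) s) = J.Du (J.DL (J.L s) r) := add_left_cancel (h1.trans h2.symm)
  simp [bracket, this]

theorem G_DL_symm (r s w : F) :
    J.G (J.L w) (J.DL (J.L r) s) = J.G (J.L w) (J.DL (J.L s) r) := by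
  have := J.G_L_vert (J.Du_bracket r s) w
  rw [bracket, map_sub] at this
  linarith

/-- The derivative of the relation `λ ^ 2 G(L r, L w) = h(r, w)`. -/
theorem DG_LL (X : E) (r w : F) :
    J.a * (J.DG X (J.L r) (J.L w) + J.G (J.L w) (J.DL X r) + J.G (J.L r) (J.DL X w)) =
      J.Dh (J.Du X) r w - J.da X * J.G (J.L r) (J.L w) := by
  have h1 := J.d_adj X r (J.L w)
  have h2 := J.adj r (J.DL X w)
  have h3 := congrArg (J.h r) (J.d_lift X w)
  rw [map_add, map_zero] at h3
  rw [J.lift] at h1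
  have h4 := J.G_symm (J.DL X r) (J.L w)
  rw [h4] at h1
  linarith

/-- On horizontal vectors, `B` is minus the pullback of the Christoffel symbols of the target: this
is where the vanishing of the horizontal derivative of the dilation enters. -/
theorem h_B_LL (r s w : F) :
    2 * J.h w (J.B (J.L r) (J.L s)) = -(J.Dh r s w + J.Dh s r w - J.Dh w r s) := by
  have h0 := J.h_B (J.L r) (J.L s) w
  have h1 := J.d_lift (J.L r) s
  have h2 := congrArg (J.h w) h1
  rw [map_add, map_zero] at h2
  have h3 := J.adj w (J.DL (J.L r) s)
  have h4 := J.Γ_spec (J.L r) (J.L s) (J.L w)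
  rw [J.G_symm] at h4
  have e1 := J.DG_LL (J.L r) s w
  have e2 := J.DG_LL (J.L s) r w
  have e3 := J.DG_LL (J.L w) r s
  rw [J.da_horiz, J.lift] at e1 e2 e3
  have q1 := J.G_DL_symm r s w
  have q2 := J.G_DL_symm r w s
  have q3 := J.G_DL_symm s w r
  have d1 := J.DG_symm
  linear_combination 2 * h0 + 2 * h2 + 2 * h3 - J.a * h4 - e1 - e2 + e3 - J.a * q1 + J.a * q2
    + J.a * q3

/-- The mixed part of `B` determines the integrability tensor of the horizontal distribution. -/
theorem h_B_vert {A : E} (hA : J.Du A = 0) (r s : F) :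
    J.h s (J.B (J.L r) A) - J.h r (J.B (J.L s) A) = J.a * J.G A (J.bracket r s) := by
  have h1 := J.h_B (J.L r) A s
  have h2 := J.h_B (J.L s) A r
  have g1 := J.Γ_spec (J.L r) A (J.L s)
  have g2 := J.Γ_spec (J.L s) A (J.L r)
  have d1 := J.d_adj (J.L r) s A
  have d2 := J.d_adj (J.L s) r A
  rw [J.G_L_vert hA, hA, map_zero] at d1 d2
  rw [J.G_symm] at g1 g2
  have s1 := J.DG_symm (J.L r) A (J.L s)
  have s2 := J.DG_symm (J.L s) A (J.L r)
  have s3 := J.DG_symm A (J.L s) (J.L r)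
  rw [bracket, map_sub, J.G_symm A, J.G_symm A]
  linear_combination h1 - h2 - J.a / 2 * g1 + J.a / 2 * g2 - d1 + d2 + J.a / 2 * (s2 - s1)
     + J.a / 2 * s3

/-- The second fundamental form of the fibres, in terms of the Lie derivative of the metric along
a horizontal lift. -/
theorem h_B_vert_vert {A : E} (hA : J.Du A = 0) (w : F) :
    2 * J.h w (J.B A A) = J.a * (2 * J.G A (J.DL A w) + J.DG (J.L w) A A) := by
  have h1 := J.h_B A A w
  have g1 := J.Γ_spec A A (J.L w)
  have d1 := J.d_adj A w A
  rw [J.G_L_vert hA, hA, map_zero] at d1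
  rw [J.G_symm] at g1
  have s1 := J.DG_symm A A (J.L w)
  have s2 := J.G_symm A (J.DL A w)
  linear_combination 2 * h1 - J.a * g1 - 2 * d1 - 2 * J.a * s1 - 2 * J.a * s2

end ConformalJet

/-! ### The codifferential of the pulled back volume form -/

section Alternating

variable {E F : Type*} [NormedAddCommGroup E] [NormedSpace ℝ E]
    [NormedAddCommGroup F] [NormedSpace ℝ F] {k : ℕ}

theorem fderivComp_apply {p : ℕ} (α : F [⋀^Fin p]→L[ℝ] ℝ) (g dg : E →L[ℝ] F) (w : Fin p → E) :
    α.fderivCompContinuousLinearMap g dg w =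
      ∑ j, α (Function.update (fun i => g (w i)) j (dg (w j))) := by
  rw [ContinuousAlternatingMap.fderivCompContinuousLinearMap_apply]
  refine Finset.sum_congr rfl fun j _ => congrArg α (funext fun l => ?_)
  by_cases h : l = j
  · subst h; simp
  · simp [h]

theorem alternating_ext_of_basis {ι : Type*} [Fintype ι] [DecidableEq ι]
    (f : Module.Basis ι ℝ F) {α β : F [⋀^ι]→L[ℝ] ℝ} (h : α f = β f) : α = β := by
  apply ContinuousAlternatingMap.toAlternatingMap_injective
  rw [α.toAlternatingMap.eq_smul_basis_det f, β.toAlternatingMap.eq_smul_basis_det f]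
  exact congrArg (· • f.det) h

/-- In degree equal to the dimension, replacing each argument in turn by its image under an
endomorphism amounts to multiplication by the trace. -/
theorem sum_update_basis {ι : Type*} [Fintype ι] [DecidableEq ι] (f : Module.Basis ι ℝ F)
    (α : F [⋀^ι]→L[ℝ] ℝ) (T : F → F) :
    ∑ j, α (Function.update f j (T (f j))) = (∑ j, f.repr (T (f j)) j) * α f := by
  rw [Finset.sum_mul]
  refine Finset.sum_congr rfl fun j _ => ?_
  conv_lhs => rw [← f.sum_repr (T (f j))]
  have := α.toMultilinearMap.map_update_sum Finset.univ j (fun i => f.repr (T (f j)) i • f i) f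
  refine this.trans ?_
  rw [Finset.sum_eq_single j]
  · have := α.toMultilinearMap.map_update_smul f j (f.repr (T (f j)) j) (f j)
    refine this.trans ?_
    simp
  · intro b _ hb
    have := α.toMultilinearMap.map_update_smul f j (f.repr (T (f j)) b) (f b)
    refine this.trans ?_
    have h0 : α (Function.update f j (f b)) = 0 :=
      α.map_eq_zero_of_eq _ (i := j) (j := b) (by simp [hb]) hb.symm
    change _ • α (Function.update f j (f b)) = 0
    rw [h0, smul_zero]
  · simp

/-- Expansion of an alternating form on `(f_a, f_0, …, f̂_i, …, f_b, …)`: only the two ways of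
restoring the missing pair of arguments contribute. -/
theorem sum_cons_update_succAbove (α : F [⋀^Fin (k + 1)]→L[ℝ] ℝ) (f : Fin (k + 1) → F)
    (c : Fin (k + 1) → Fin (k + 1) → ℝ) (i : Fin (k + 1)) (j : Fin k) :
    (-1 : ℝ) ^ (i : ℕ) * ∑ a, ∑ b, c a b * α (Matrix.vecCons (f a)
      (Function.update (fun l => f (i.succAbove l)) j (f b))) =
    α f * (c i (i.succAbove j) - c (i.succAbove j) i) := by
  set j' := i.succAbove j with hj'
  have hne : j' ≠ i := Fin.succAbove_ne i j
  have key : ∀ a b, a ≠ b → (a ≠ i → a ≠ j' → False) → (b ≠ i → b ≠ j' → False) →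
      (a = i ∧ b = j') ∨ (a = j' ∧ b = i) := by
    intro a b hab ha hb; grind
  have hself : (-1 : ℝ) ^ (i : ℕ) * α (Matrix.vecCons (f i)
      (Function.update (fun l => f (i.succAbove l)) j (f j'))) = α f := by
    have h1 : Function.update (fun l => f (i.succAbove l)) j (f j') = i.removeNth f := by
      rw [hj', Function.update_eq_self_iff.2 rfl]; rfl
    rw [h1, ← α.neg_one_pow_smul_map_insertNth i]
    rcases Nat.even_or_odd (i : ℕ) with h | h <;> simp [h.neg_one_pow]
  have hswap : (-1 : ℝ) ^ (i : ℕ) * α (Matrix.vecCons (f j')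
      (Function.update (fun l => f (i.succAbove l)) j (f i))) = -α f := by
    rw [← hself, ← mul_neg]
    congr 1
    refine Eq.trans (congrArg α ?_) (α.map_swap _ (i := 0) (j := j.succ) (Fin.succ_ne_zero j).symm)
    funext l
    refine Fin.cases ?_ (fun l => ?_) l
    · simp
    · by_cases hl : l = j
      · subst hl; simp
      · have : Equiv.swap (0 : Fin (k + 1)) j.succ l.succ = l.succ :=
          Equiv.swap_apply_of_ne_of_ne (Fin.succ_ne_zero l) (by simpa using hl)
        simp [this, hl]
  have hzero : ∀ a b, ¬(a = i ∧ b = j') → ¬(a = j' ∧ b = i) → α (Matrix.vecCons (f a)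
      (Function.update (fun l => f (i.succAbove l)) j (f b))) = 0 := by
    intro a b h1 h2
    by_cases hab : a = b
    · exact α.map_eq_zero_of_eq _ (i := 0) (j := j.succ) (by simp [hab]) (Fin.succ_ne_zero j).symm
    by_cases ha : a ≠ i ∧ a ≠ j'
    · obtain ⟨l, hl⟩ := Fin.exists_succAbove_eq ha.1
      have hlj : l ≠ j := fun h => ha.2 (by rw [← hl, h])
      exact α.map_eq_zero_of_eq _ (i := 0) (j := l.succ) (by simp [hlj, hl])
        (Fin.succ_ne_zero l).symm
    by_cases hb : b ≠ i ∧ b ≠ j'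
    · obtain ⟨l, hl⟩ := Fin.exists_succAbove_eq hb.1
      have hlj : l ≠ j := fun h => hb.2 (by rw [← hl, h])
      exact α.map_eq_zero_of_eq _ (i := j.succ) (j := l.succ) (by simp [hlj, hl])
        (fun h => hlj (Fin.succ_injective _ h).symm)
    exact absurd (key a b hab (fun x y => ha ⟨x, y⟩) (fun x y => hb ⟨x, y⟩)) (by tauto)
  rw [Finset.sum_eq_add i j' hne.symm, Finset.sum_eq_single j', Finset.sum_eq_single i]
  · linear_combination c i j' * hself + c j' i * hswap
  · intro b _ hb; rw [hzero j' b (fun h => hne h.1) (fun h => hb h.2), mul_zero]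
  · simp
  · intro b _ hb; rw [hzero i b (fun h => hb h.2) (fun h => hne h.1.symm), mul_zero]
  · simp
  · intro a _ ha
    exact Finset.sum_eq_zero fun b _ => by
      rw [hzero a b (fun h => ha.1 h.1) (fun h => ha.2 h.1), mul_zero]
  · simp
  · simp

end Alternating

namespace ConformalJet

variable {E F : Type*} [NormedAddCommGroup E] [NormedSpace ℝ E]
    [NormedAddCommGroup F] [NormedSpace ℝ F] (J : ConformalJet E F) {k : ℕ}
    (vol : F [⋀^Fin (k + 1)]→L[ℝ] ℝ) (Dvol : F →L[ℝ] F [⋀^Fin (k + 1)]→L[ℝ] ℝ)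

/-- The covariant derivative of the pullback of the form `vol` with derivative `Dvol`. -/
noncomputable def covPullback : E →ₗ[ℝ] E [⋀^Fin (k + 1)]→L[ℝ] ℝ where
  toFun X := (Dvol (J.Du X)).compContinuousLinearMap J.Du +
    vol.fderivCompContinuousLinearMap J.Du (J.B X)
  map_add' X Y := by
    ext w; simp; ring
  map_smul' c X := by
    ext w; simp

theorem covPullback_apply (X : E) (w : Fin (k + 1) → E) :
    J.covPullback vol Dvol X w = Dvol (J.Du X) (fun i => J.Du (w i)) +
      ∑ j, vol (Function.update (fun i => J.Du (w i)) j (J.B X (w j))) := by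
  rw [← fderivComp_apply]; rfl

/-- A frame of the target which is orthonormal for `h`. -/
def IsOrthonormalFrame {ι : Type*} [DecidableEq ι] (f : Module.Basis ι ℝ F) : Prop :=
  ∀ i j, J.h (f i) (f j) = if i = j then 1 else 0

variable {J}

theorem IsOrthonormalFrame.repr_apply {ι : Type*} [Fintype ι] [DecidableEq ι]
    {f : Module.Basis ι ℝ F} (hf : J.IsOrthonormalFrame f) (v : F) (i : ι) :
    f.repr v i = J.h (f i) v := by
  conv_rhs => rw [← f.sum_repr v]
  simp only [map_sum, map_smul, hf i, smul_eq_mul, mul_ite, mul_one, mul_zero,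
    Finset.sum_ite_eq, Finset.mem_univ, if_true]

theorem IsOrthonormalFrame.isParseval {ι : Type*} [Fintype ι] [DecidableEq ι]
    {f : Module.Basis ι ℝ F} (hf : J.IsOrthonormalFrame f) : IsParseval J.h f := fun v => by
  conv_rhs => rw [← f.sum_repr v]
  exact Finset.sum_congr rfl fun i _ => by rw [hf.repr_apply, J.h_symm]

/-- The volume form of the target is parallel, provided that the derivative of its square on an
orthonormal frame is the derivative of the Gram determinant. -/
theorem parallel_of_gram {f : Module.Basis (Fin (k + 1)) ℝ F} (hf : J.IsOrthonormalFrame f)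
    (hgram : ∀ r, 2 * Dvol r f = (∑ i, J.Dh r (f i) (f i)) * vol f) (r : F)
    (w : Fin (k + 1) → F) :
    Dvol r w + ∑ j, vol (Function.update w j (J.B (J.L r) (J.L (w j)))) = 0 := by
  have key : Dvol r + vol.fderivCompContinuousLinearMap (ContinuousLinearMap.id ℝ F)
      ((J.B (J.L r)) ∘L J.L) = 0 := by
    apply alternating_ext_of_basis f
    have h1 := sum_update_basis f vol (fun v => J.B (J.L r) (J.L v))
    have h2 : ∑ j, f.repr (J.B (J.L r) (J.L (f j))) j = -(1 / 2) * ∑ i, J.Dh r (f i) (f i) := by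
      rw [Finset.mul_sum]
      refine Finset.sum_congr rfl fun i _ => ?_
      rw [hf.repr_apply]
      have := J.h_B_LL r (f i) (f i)
      have h3 := J.Dh_symm (f i) r (f i)
      linarith
    rw [h2] at h1
    have h4 := hgram r
    change Dvol r f + vol.fderivCompContinuousLinearMap (ContinuousLinearMap.id ℝ F)
      ((J.B (J.L r)) ∘L J.L) f = 0
    rw [fderivComp_apply]
    simp only [ContinuousLinearMap.id_apply, ContinuousLinearMap.comp_apply]
    change Dvol r f + ∑ j, vol (Function.update f j (J.B (J.L r) (J.L (f j)))) = 0
    linarith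
  have := DFunLike.congr_fun key w
  change Dvol r w + vol.fderivCompContinuousLinearMap (ContinuousLinearMap.id ℝ F)
      ((J.B (J.L r)) ∘L J.L) w = 0 at this
  rw [fderivComp_apply] at this
  exact this

/-- The horizontal lifts of an orthonormal frame, rescaled by the dilation, together with the
vertical projection of a Parseval frame form a Parseval frame. -/
theorem isParseval_adapted {ι κ : Type*} [Fintype ι] [Fintype κ] [DecidableEq κ]
    {e : ι → E} (he : IsParseval J.G e)
    {f : Module.Basis κ ℝ F} (hf : J.IsOrthonormalFrame f) :
    IsParseval J.G (Sum.elim (fun i => Real.sqrt J.a • J.L (f i)) (fun i => J.P (e i))) := by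
  intro v
  simp only [Fintype.sum_sum_type, Sum.elim_inl, Sum.elim_inr]
  have h1 : ∑ i, J.G v (Real.sqrt J.a • J.L (f i)) • Real.sqrt J.a • J.L (f i) =
      J.L (J.Du v) := by
    conv_rhs => rw [← hf.isParseval (J.Du v)]
    rw [map_sum]
    refine Finset.sum_congr rfl fun i _ => ?_
    rw [map_smul, map_smul, smul_smul, J.h_symm, ← J.adj, J.G_symm v]
    congr 1
    rw [smul_eq_mul]
    linear_combination (J.G (J.L (f i)) v) * Real.mul_self_sqrt J.a_pos.le
  have h2 : ∑ i, J.G v (J.P (e i)) • J.P (e i) = J.P v := by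
    have h3 : ∀ w, J.G v (J.P w) = J.G (J.P v) w := fun w => by
      have e1 := J.G_L_vert (J.Du_P w) (J.Du v)
      have e2 := J.G_L_vert (J.Du_P v) (J.Du w)
      have e3 := congrArg (J.G (J.P v)) (J.eq_add_P w)
      have e4 := congrArg (fun z => J.G z (J.P w)) (J.eq_add_P v)
      simp only [map_add, add_apply] at e3 e4
      have e5 := J.G_symm (J.P v) (J.L (J.Du w))
      linarith
    simp_rw [h3]
    rw [← map_smul_sum' J.P, he]
    simp [P_apply, J.lift]
  rw [h1, h2, ← J.eq_add_P]
where
  map_smul_sum' {ι : Type _} [Fintype ι] {c : ι → ℝ} {e : ι → E} (T : E →L[ℝ] E) :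
    T (∑ i, c i • e i) = ∑ i, c i • T (e i) := by simp

/-- The codifferential of the pullback of a parallel volume form under a horizontally conformal
submersion with minimal fibres and vertical gradient of the dilation: only the mixed part of `B`
contributes. -/
theorem sum_covPullback {ι : Type*} [Fintype ι] {e : ι → E} (he : IsParseval J.G e)
    {f : Module.Basis (Fin (k + 1)) ℝ F} (hf : J.IsOrthonormalFrame f)
    (hpar : ∀ (r : F) (w : Fin (k + 1) → F),
      Dvol r w + ∑ j, vol (Function.update w j (J.B (J.L r) (J.L (w j)))) = 0)
    (hmin : ∑ i, J.B (J.P (e i)) (J.P (e i)) = 0) (W : Fin k → E) :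
    ∑ i, J.covPullback vol Dvol (e i) (Matrix.vecCons (e i) W) =
      J.a * ∑ i, ∑ j, vol (Matrix.vecCons (f i)
        (Function.update (fun l => J.Du (W l)) j (J.B (J.L (f i)) (J.P (W j))))) := by
  let T : E →ₗ[ℝ] E →ₗ[ℝ] ℝ := LinearMap.mk₂ ℝ
    (fun X Y => J.covPullback vol Dvol X (Matrix.vecCons Y W))
    (by intros; simp) (by intros; simp)
    (by intros; exact ContinuousMultilinearMap.cons_add _ _ _ _)
    (by intros; exact ContinuousMultilinearMap.cons_smul _ _ _ _)
  have hT : ∀ X Y, T X Y = J.covPullback vol Dvol X (Matrix.vecCons Y W) := fun _ _ => rfl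
  have hcomp : ∀ Y, (fun i => J.Du (Matrix.vecCons Y W i)) =
      Matrix.vecCons (J.Du Y) (fun l => J.Du (W l)) := fun Y => by
    funext i; refine Fin.cases ?_ (fun l => ?_) i <;> simp
  have hhor : ∀ r, T (J.L r) (J.L r) = ∑ j, vol (Matrix.vecCons r
        (Function.update (fun l => J.Du (W l)) j (J.B (J.L r) (J.P (W j))))) := by
    intro r
    rw [hT, covPullback_apply, hcomp, J.lift]
    have h1 := hpar r (Matrix.vecCons r (fun l => J.Du (W l)))
    rw [eq_neg_of_add_eq_zero_left h1, neg_add_eq_sub, ← Finset.sum_sub_distrib, Fin.sum_univ_succ]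
    have h2 : ∀ j : Fin k, vol (Function.update (Matrix.vecCons r (fun l => J.Du (W l))) j.succ
          (J.B (J.L r) (Matrix.vecCons (J.L r) W j.succ))) -
        vol (Function.update (Matrix.vecCons r (fun l => J.Du (W l))) j.succ
          (J.B (J.L r) (J.L (Matrix.vecCons r (fun l => J.Du (W l)) j.succ)))) =
        vol (Matrix.vecCons r
          (Function.update (fun l => J.Du (W l)) j (J.B (J.L r) (J.P (W j))))) := by
      intro j
      have h3 : Matrix.vecCons r (Function.update (fun l => J.Du (W l)) j
          (J.B (J.L r) (J.P (W j)))) = Function.update (Matrix.vecCons r (fun l => J.Du (W l)))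
          j.succ (J.B (J.L r) (J.P (W j))) := (Fin.cons_update _ _ _ _)
      rw [h3, J.P_apply, map_sub]
      exact (vol.toMultilinearMap.map_update_sub _ _ _ _).symm
    rw [Finset.sum_congr rfl fun j _ => h2 j]
    simp
  have hver : ∀ v, J.Du v = 0 → T v v = vol (Matrix.vecCons (J.B v v) (fun l => J.Du (W l))) := by
    intro v hv
    rw [hT, covPullback_apply, hcomp, hv, map_zero, Fin.sum_univ_succ]
    rw [Finset.sum_eq_zero (fun j _ => vol.map_coord_zero 0 (by
      rw [Function.update_of_ne (Fin.succ_ne_zero j).symm]; rfl)), add_zero]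
    refine (zero_add _).trans (congrArg vol ?_)
    funext l; refine Fin.cases ?_ (fun l => ?_) l <;> simp
  have := he.sum_eq J.G_symm (isParseval_adapted he hf) T
  simp only [Fintype.sum_sum_type, Sum.elim_inl, Sum.elim_inr] at this
  refine this.trans ?_
  have hv : ∑ i, T (J.P (e i)) (J.P (e i)) = 0 := by
    rw [Finset.sum_congr rfl fun i _ => hver _ (J.Du_P (e i))]
    let C : F →ₗ[ℝ] ℝ :=
      { toFun := fun Y => vol (Matrix.vecCons Y (fun l => J.Du (W l)))
        map_add' := fun _ _ => ContinuousMultilinearMap.cons_add _ _ _ _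
        map_smul' := fun _ _ => ContinuousMultilinearMap.cons_smul _ _ _ _ }
    have h5 := map_sum C (fun i => J.B (J.P (e i)) (J.P (e i))) Finset.univ
    rw [hmin, map_zero] at h5
    exact h5.symm
  rw [hv, add_zero, Finset.mul_sum]
  refine Finset.sum_congr rfl fun i _ => ?_
  rw [← hhor (f i)]
  simp only [map_smul, LinearMap.smul_apply, smul_eq_mul, ← mul_assoc]
  rw [Real.mul_self_sqrt J.a_pos.le]

end ConformalJet

namespace ConformalJet

variable {E F : Type*} [NormedAddCommGroup E] [NormedSpace ℝ E]
    [NormedAddCommGroup F] [NormedSpace ℝ F] {J : ConformalJet E F} {k : ℕ}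
    (vol : F [⋀^Fin (k + 1)]→L[ℝ] ℝ)

/-- Expansion of the argument of `vol` at the position `j.succ` in an orthonormal frame. -/
theorem vol_cons_update_expand (f : Module.Basis (Fin (k + 1)) ℝ F) (hf : J.IsOrthonormalFrame f)
    (r x : F) (w : Fin k → F) (j : Fin k) :
    vol (Matrix.vecCons r (Function.update w j x)) =
      ∑ b, J.h (f b) x * vol (Matrix.vecCons r (Function.update w j (f b))) := by
  let C : F →ₗ[ℝ] ℝ :=
    { toFun := fun Y => vol (Matrix.vecCons r (Function.update w j Y))
      map_add' := fun x y => by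
        have h3 : ∀ z, Matrix.vecCons r (Function.update w j z) =
          Function.update (Matrix.vecCons r w) j.succ z := fun z => Fin.cons_update _ _ _ _
        simp_rw [h3]
        exact vol.toMultilinearMap.map_update_add _ _ _ _
      map_smul' := fun c x => by
        have h3 : ∀ z, Matrix.vecCons r (Function.update w j z) =
          Function.update (Matrix.vecCons r w) j.succ z := fun z => Fin.cons_update _ _ _ _
        simp_rw [h3]
        exact vol.toMultilinearMap.map_update_smul _ _ _ _ }
  have : C x = ∑ b, J.h (f b) x • C (f b) := by
    conv_lhs => rw [← f.sum_repr x]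
    rw [map_sum]
    exact Finset.sum_congr rfl fun b _ => by rw [map_smul, hf.repr_apply]
  exact this

/-- If the horizontal distribution is involutive, the mixed part of `B` is symmetric and its
contribution to the codifferential of the pulled back volume form cancels. -/
theorem mixed_eq_zero (hJ : ∀ r s, J.bracket r s = 0) {f : Module.Basis (Fin (k + 1)) ℝ F}
    (hf : J.IsOrthonormalFrame f) (W : Fin k → E) :
    ∑ i, ∑ j, vol (Matrix.vecCons (f i)
        (Function.update (fun l => J.Du (W l)) j (J.B (J.L (f i)) (J.P (W j))))) = 0 := by
  rw [Finset.sum_comm]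
  refine Finset.sum_eq_zero fun j _ => ?_
  simp_rw [vol_cons_update_expand vol f hf (f _) (J.B _ _)]
  have hs : ∀ i b, J.h (f b) (J.B (J.L (f i)) (J.P (W j))) =
      J.h (f i) (J.B (J.L (f b)) (J.P (W j))) := fun i b => by
    have := J.h_B_vert (J.Du_P (W j)) (f i) (f b)
    rw [hJ, map_zero, mul_zero] at this
    linarith
  have ha : ∀ i b, vol (Matrix.vecCons (f i) (Function.update (fun l => J.Du (W l)) j (f b))) =
      - vol (Matrix.vecCons (f b) (Function.update (fun l => J.Du (W l)) j (f i))) := fun i b => by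
    refine Eq.trans (congrArg vol ?_)
      (vol.map_swap _ (i := 0) (j := j.succ) (Fin.succ_ne_zero j).symm)
    funext l
    refine Fin.cases ?_ (fun l => ?_) l
    · simp
    · by_cases hl : l = j
      · subst hl; simp
      · have : Equiv.swap (0 : Fin (k + 1)) j.succ l.succ = l.succ :=
          Equiv.swap_apply_of_ne_of_ne (Fin.succ_ne_zero l) (by simpa using hl)
        simp [this, hl]
  set S := ∑ i, ∑ b, J.h (f b) (J.B (J.L (f i)) (J.P (W j))) *
    vol (Matrix.vecCons (f i) (Function.update (fun l => J.Du (W l)) j (f b))) with hS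
  have : S = -S := by
    conv_lhs => rw [hS, Finset.sum_comm]
    rw [hS, ← Finset.sum_neg_distrib]
    refine Finset.sum_congr rfl fun i _ => ?_
    rw [← Finset.sum_neg_distrib]
    refine Finset.sum_congr rfl fun b _ => ?_
    rw [hs b i, ha b i, mul_neg]
  linarith

theorem G_bracket_nonneg (r s : F) : 0 ≤ J.G (J.bracket r s) (J.bracket r s) := by
  by_cases h : J.bracket r s = 0
  · simp [h]
  · exact (J.G_pos _ h).le

/-- The exterior derivative of the codifferential `β` of the pulled back volume form, evaluated on
the horizontal lift of an orthonormal frame, is a multiple of the squared norm of the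
integrability tensor. Hence the latter vanishes if `β` is closed. -/
theorem bracket_eq_zero_of_closed {f : Module.Basis (Fin (k + 1)) ℝ F}
    (hf : J.IsOrthonormalFrame f) (hvol : vol f ≠ 0) (β : E [⋀^Fin k]→L[ℝ] ℝ)
    (Dβ : E →L[ℝ] E [⋀^Fin k]→L[ℝ] ℝ)
    (hβ : ∀ W : Fin k → E, β W = -(J.a * ∑ i, ∑ j, vol (Matrix.vecCons (f i)
        (Function.update (fun l => J.Du (W l)) j (J.B (J.L (f i)) (J.P (W j)))))))
    (hDβ : ∀ (X : E) (r : Fin k → F), Dβ X (fun l => J.L (r l)) +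
      ∑ j, β (Function.update (fun l => J.L (r l)) j (J.DL X (r j))) = 0)
    (hclosed : ∑ i : Fin (k + 1), (-1 : ℝ) ^ (i : ℕ) *
      Dβ (J.L (f i)) (fun l => J.L (f (i.succAbove l))) = 0) (r s : F) :
    J.bracket r s = 0 := by
  have hβ1 : ∀ (w : Fin k → F) (j : Fin k) (A : E),
      β (Function.update (fun l => J.L (w l)) j A) = -(J.a * ∑ i, vol (Matrix.vecCons (f i)
        (Function.update w j (J.B (J.L (f i)) (J.P A))))) := by
    intro w j A
    rw [hβ]
    congr 2
    refine Finset.sum_congr rfl fun i _ => ?_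
    rw [Finset.sum_eq_single j]
    · congr 2
      funext l
      by_cases hl : l = j
      · subst hl; simp
      · simp [hl, J.lift]
    · intro l _ hl
      refine vol.map_coord_zero l.succ ?_
      simp [hl, J.P_L]
    · simp
  have hterm : ∀ i : Fin (k + 1), (-1 : ℝ) ^ (i : ℕ) *
      Dβ (J.L (f i)) (fun l => J.L (f (i.succAbove l))) =
      ∑ j : Fin (k + 1), J.a ^ 2 * vol f * J.G (J.DL (J.L (f i)) (f j)) (J.bracket (f i) (f j)) := by
    intro i
    rw [Fin.sum_univ_succAbove _ i]
    have h0 : J.bracket (f i) (f i) = 0 := by simp [bracket]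
    rw [h0, map_zero, mul_zero, zero_add, eq_neg_of_add_eq_zero_left (hDβ _ _), mul_neg,
      Finset.mul_sum, ← Finset.sum_neg_distrib]
    refine Finset.sum_congr rfl fun j _ => ?_
    rw [hβ1]
    simp_rw [vol_cons_update_expand vol f hf (f _) (J.B _ _)]
    set A := J.DL (J.L (f i)) (f (i.succAbove j))
    have h1 := sum_cons_update_succAbove vol f
      (fun a b => J.h (f b) (J.B (J.L (f a)) (J.P A))) i j
    have h2 := J.h_B_vert (J.Du_P A) (f i) (f (i.succAbove j))
    have h3 : J.G (J.P A) (J.bracket (f i) (f (i.succAbove j))) =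
        J.G A (J.bracket (f i) (f (i.succAbove j))) := by
      rw [P_apply, map_sub, sub_apply, J.G_L_vert (J.Du_bracket _ _), sub_zero]
    rw [h3] at h2
    rw [h2] at h1
    linear_combination J.a * h1
  have hsum : ∑ i, ∑ j, J.G (J.bracket (f i) (f j)) (J.bracket (f i) (f j)) = 0 := by
    rw [Finset.sum_congr rfl fun i _ => hterm i] at hclosed
    simp_rw [← Finset.mul_sum] at hclosed
    have h1 := (mul_eq_zero.1 hclosed).resolve_left
      (mul_ne_zero (pow_ne_zero 2 J.a_pos.ne') hvol)
    have hanti : ∀ x y, J.bracket x y = -J.bracket y x := fun x y => by simp [bracket]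
    have h2 : ∑ i, ∑ j, J.G (J.DL (J.L (f j)) (f i)) (J.bracket (f i) (f j)) = 0 := by
      rw [Finset.sum_comm, ← neg_eq_zero, ← Finset.sum_neg_distrib, ← h1]
      refine Finset.sum_congr rfl fun i _ => ?_
      rw [← Finset.sum_neg_distrib]
      refine Finset.sum_congr rfl fun j _ => ?_
      rw [hanti (f j), map_neg, neg_neg]
    have h3 : ∀ i j, J.G (J.bracket (f i) (f j)) (J.bracket (f i) (f j)) =
        J.G (J.DL (J.L (f i)) (f j)) (J.bracket (f i) (f j)) -
        J.G (J.DL (J.L (f j)) (f i)) (J.bracket (f i) (f j)) := fun i j => by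
      conv_lhs => enter [1, 2]; rw [bracket]
      rw [map_sub, sub_apply]
    simp_rw [h3, Finset.sum_sub_distrib, h1, h2, sub_zero]
  have hij : ∀ i j, J.bracket (f i) (f j) = 0 := by
    intro i j
    by_contra hne
    have h1 := (Finset.sum_eq_zero_iff_of_nonneg fun i _ =>
      Finset.sum_nonneg fun j _ => J.G_bracket_nonneg (f i) (f j)).1 hsum i (Finset.mem_univ _)
    have h2 := (Finset.sum_eq_zero_iff_of_nonneg fun j _ => J.G_bracket_nonneg (f i) (f j)).1 h1 j
      (Finset.mem_univ _)
    exact (J.G_pos _ hne).ne' h2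
  let T : F →ₗ[ℝ] F →ₗ[ℝ] E := LinearMap.mk₂ ℝ (fun r s => J.bracket r s)
    (by intros; simp [bracket]; abel) (by intros; simp [bracket, smul_sub])
    (by intros; simp [bracket]; abel) (by intros; simp [bracket, smul_sub])
  have hT : T = 0 := f.ext fun i => f.ext fun j => hij i j
  exact LinearMap.congr_fun (LinearMap.congr_fun hT r) s

end ConformalJet

/-! ### Total differential equations -/

section TotalODE

open scoped NNReal

variable {E F : Type*} [NormedAddCommGroup E] [NormedSpace ℝ E] [NormedAddCommGroup F]
  [NormedSpace ℝ F]

theorem norm_taylor_le {G : Type*} [NormedAddCommGroup G] [NormedSpace ℝ G] {f : E → G}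
    (hf : Differentiable ℝ f) {K : ℝ≥0} (hK : LipschitzWith K (fderiv ℝ f)) (x k : E) :
    ‖f (x + k) - f x - fderiv ℝ f x k‖ ≤ K * ‖k‖ ^ 2 := by
  have := (convex_closedBall x ‖k‖).norm_image_sub_le_of_norm_hasFDerivWithin_le'
    (f := f) (f' := fderiv ℝ f) (φ := fderiv ℝ f x) (C := K * ‖k‖) (x := x) (y := x + k)
    (fun z _ => (hf z).hasFDerivAt.hasFDerivWithinAt) (fun z hz => by
      refine (hK.norm_sub_le z x).trans ?_
      gcongr
      exact mem_closedBall_iff_norm.1 hz) (by simp) (by simp)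
  rw [add_sub_cancel_left] at this
  refine this.trans (le_of_eq (by ring))

theorem exists_taylor_bound {G : Type*} [NormedAddCommGroup G] [NormedSpace ℝ G] {f : E → G}
    (hf : ContDiff ℝ 2 f) (hsupp : HasCompactSupport f) :
    ∃ K : ℝ≥0, ∀ x k, ‖f (x + k) - f x - fderiv ℝ f x k‖ ≤ K * ‖k‖ ^ 2 := by
  have hDL : ContDiff ℝ 1 (fderiv ℝ f) := hf.fderiv_right (by norm_num)
  obtain ⟨K, hK⟩ := ContDiff.lipschitzWith_of_hasCompactSupport (hsupp.fderiv ℝ) hDL one_ne_zero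
  exact ⟨K, norm_taylor_le (hf.differentiable two_ne_zero) hK⟩

variable [FiniteDimensional ℝ E]

/-- Rays of the solution of the total differential equation `Df = L ∘ f`. -/
theorem exists_ray {L : E → F →L[ℝ] E} {C K : ℝ≥0} (hC : ∀ y, ‖L y‖ ≤ C) (hK : LipschitzWith K L)
    (y₀ : E) (t : F) :
    ∃ γ : ℝ → E, γ 0 = y₀ ∧ ∀ s ∈ Icc (0 : ℝ) 1, HasDerivWithinAt γ (L (γ s) t) (Icc 0 1) s := by
  have : IsPicardLindelof (fun _ y => L y t) (tmin := 0) (tmax := 1) ⟨0, by simp⟩ y₀ (C * ‖t‖₊) 0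
      (C * ‖t‖₊) (K * ‖t‖₊) := by
    refine IsPicardLindelof.of_time_independent (fun y _ => ?_) ?_ (by simp)
    · exact ((L y).le_opNorm t).trans (by push_cast; gcongr; exact hC y)
    · refine (LipschitzWith.of_dist_le_mul fun y z => ?_).lipschitzOnWith
      rw [dist_eq_norm, ← sub_apply]
      refine ((L y - L z).le_opNorm t).trans ?_
      have := hK.dist_le_mul y z
      rw [dist_eq_norm] at this
      push_cast
      nlinarith [norm_nonneg t]
  obtain ⟨γ, h0, hγ⟩ := this.exists_eq_forall_mem_Icc_hasDerivWithinAt₀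
  exact ⟨γ, h0, hγ⟩

/-- Frobenius' theorem for a globally defined right-hand side of compact support which is flat
near the initial point. The solution is defined along rays; its differentiability follows from
Grönwall's inequality, comparing the ray in the direction `t + h` with the perturbation
`γ_t(s) + s L(γ_t(s)) h` of the ray in the direction `t`, which by flatness is a solution up to an
error of order `‖h‖ ^ 2`. -/
theorem exists_solution_of_compactSupport {L : E → F →L[ℝ] E} (hL : ContDiff ℝ ∞ L)
    (hsupp : HasCompactSupport L) (y₀ : E) {ρ : ℝ} (hρ : 0 < ρ)
    (hflat : ∀ y ∈ Metric.ball y₀ ρ, ∀ r s, fderiv ℝ L y (L y r) s = fderiv ℝ L y (L y s) r) :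
    ∃ δ > 0, ∃ f : F → E, f 0 = y₀ ∧ ∀ t ∈ Metric.ball (0 : F) δ,
      f t ∈ Metric.ball y₀ ρ ∧ HasFDerivAt f (L (f t)) t := by
  obtain ⟨C', hC'⟩ := hsupp.exists_bound_of_continuous hL.continuous
  set C : ℝ≥0 := ⟨max C' 0, le_max_right _ _⟩ + 1
  have hC : ∀ y, ‖L y‖ ≤ C := fun y =>
    (hC' y).trans ((le_max_left C' 0).trans (le_add_of_nonneg_right zero_le_one))
  have hCpos : (0 : ℝ) < C := lt_of_lt_of_le zero_lt_one
    (le_add_of_nonneg_left (le_max_right C' 0))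
  obtain ⟨K, hK⟩ := hL.lipschitzWith_of_hasCompactSupport hsupp (by simp)
  obtain ⟨K₂, hK₂⟩ := exists_taylor_bound (contDiff_infty.1 hL 2) hsupp
  have hdiff : Differentiable ℝ L := hL.differentiable (by simp)
  have hDK : ∀ y, ‖fderiv ℝ L y‖ ≤ K := fun y => norm_fderiv_le_of_lipschitz ℝ hK
  choose γ hγ0 hγ using exists_ray hC hK y₀
  have hdist : ∀ t, ∀ s ∈ Icc (0 : ℝ) 1, ‖γ t s - y₀‖ ≤ C * ‖t‖ := by
    intro t s hs
    have := norm_image_sub_le_of_norm_deriv_le_segment' (hγ t) (C := C * ‖t‖) (fun s _ =>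
      ((L (γ t s)).le_opNorm t).trans (by gcongr; exact hC _)) s hs
    rw [hγ0, sub_zero] at this
    exact this.trans (mul_le_of_le_one_right (by positivity) hs.2)
  have hball : ∀ t ∈ Metric.ball (0 : F) (ρ / C), ∀ s ∈ Icc (0 : ℝ) 1,
      γ t s ∈ Metric.ball y₀ ρ := by
    intro t ht s hs
    rw [mem_ball_iff_norm]
    refine (hdist t s hs).trans_lt ?_
    rw [mem_ball_zero_iff, lt_div_iff₀ hCpos] at ht
    linarith
  have hIci : ∀ t, ∀ s ∈ Ico (0 : ℝ) 1, HasDerivWithinAt (γ t) (L (γ t s) t) (Ici s) s :=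
    fun t s hs => (hγ t s (Ico_subset_Icc_self hs)).mono_of_mem_nhdsWithin
      (Icc_mem_nhdsGE_of_mem hs)
  refine ⟨ρ / C, by positivity, fun t => γ t 1, ?_, fun t ht =>
    ⟨hball t ht 1 (by simp), ?_⟩⟩
  · have := hdist 0 1 (by simp)
    rw [norm_zero, mul_zero] at this
    exact sub_eq_zero.1 (norm_le_zero_iff.1 this)
  -- the comparison estimate
  set K₁ : ℝ≥0 := K * (‖t‖₊ + 1) + 1
  set A : ℝ := K₂ * C ^ 2 * (‖t‖ + 1) + K * C
  have hest : ∀ h : F, ‖h‖ ≤ 1 → ‖γ (t + h) 1 - γ t 1 - L (γ t 1) h‖ ≤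
      (A * ((Real.exp K₁ - 1) / K₁)) * ‖h‖ ^ 2 := by
    intro h hh
    set φ : ℝ → E := fun s => γ t s + s • L (γ t s) h
    set φ' : ℝ → E := fun s => L (γ t s) t + (s • fderiv ℝ L (γ t s) (L (γ t s) t) h +
      (1 : ℝ) • L (γ t s) h)
    have hth : ‖t + h‖ ≤ ‖t‖ + 1 := (norm_add_le _ _).trans (by gcongr)
    have hφ : ∀ (s : ℝ) (S : Set ℝ), HasDerivWithinAt (γ t) (L (γ t s) t) S s →
        HasDerivWithinAt φ (φ' s) S s := by
      intro s S hs
      have h1 : HasDerivWithinAt (fun s => L (γ t s) h)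
          (fderiv ℝ L (γ t s) (L (γ t s) t) h) S s := by
        have := (hdiff (γ t s)).hasFDerivAt.comp_hasDerivWithinAt s hs
        have h2 := ((ContinuousLinearMap.apply ℝ E h).hasFDerivAt).comp_hasDerivWithinAt s this
        exact h2
      exact hs.add ((hasDerivWithinAt_id s S).smul h1)
    have hlip : ∀ s ∈ Ico (0 : ℝ) 1, LipschitzOnWith K₁ (fun y => L y (t + h)) univ := by
      intro s _
      refine (LipschitzWith.of_dist_le_mul fun y z => ?_).lipschitzOnWith
      rw [dist_eq_norm, ← sub_apply]
      refine ((L y - L z).le_opNorm _).trans ?_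
      have h1 := hK.dist_le_mul y z
      rw [dist_eq_norm] at h1
      calc ‖L y - L z‖ * ‖t + h‖ ≤ (K * dist y z) * (‖t‖ + 1) := by gcongr
        _ ≤ K₁ * dist y z := by
          have : (K₁ : ℝ) = K * (‖t‖ + 1) + 1 := by simp [K₁]
          rw [this]; nlinarith [dist_nonneg (x := y) (y := z)]
    have := dist_le_of_approx_trajectories_ODE_of_mem (v := fun _ y => L y (t + h))
      (s := fun _ => univ) (K := K₁) (f := γ (t + h)) (f' := fun s => L (γ (t + h) s) (t + h))
      (g := φ) (g' := φ') (a := 0) (b := 1) (εf := 0) (εg := A * ‖h‖ ^ 2) (δ := 0) hlip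
      (fun s hs => (hγ (t + h) s hs).continuousWithinAt) (hIci (t + h))
      (fun s _ => by simp) (fun _ _ => mem_univ _)
      (fun s hs => (hφ s _ (hγ t s hs)).continuousWithinAt) (fun s hs => hφ s _ (hIci t s hs))
      (fun s hs => ?_) (fun _ _ => mem_univ _) (by simp [φ, hγ0]) 1 (by simp)
    · have hK1 : (K₁ : ℝ) ≠ 0 := by positivity
      rw [dist_eq_norm, gronwallBound_of_K_ne_0 hK1] at this
      have e1 : γ (t + h) 1 - φ 1 = γ (t + h) 1 - γ t 1 - L (γ t 1) h := by simp [φ]; abel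
      rw [e1] at this
      refine this.trans (le_of_eq ?_)
      simp; ring
    · have hs' := Ico_subset_Icc_self hs
      set y := γ t s
      set k : E := s • L y h
      have hk : ‖k‖ ≤ C * ‖h‖ := by
        rw [norm_smul, Real.norm_of_nonneg hs.1]
        calc s * ‖L y h‖ ≤ 1 * (C * ‖h‖) := by
              gcongr
              · exact hs.2.le
              · exact ((L y).le_opNorm h).trans (by gcongr; exact hC y)
          _ = _ := one_mul _
      have hfl := hflat y (hball t ht s hs') t h
      have e1 : φ' s - L (φ s) (t + h) = -((L (y + k) - L y - fderiv ℝ L y k) (t + h)) -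
          fderiv ℝ L y k h := by
        have e2 : fderiv ℝ L y k = s • fderiv ℝ L y (L y h) := by simp [k]
        simp only [φ', φ, e2, one_smul, map_add, sub_apply, smul_apply]
        rw [hfl]
        change _ + (_ + _) - (L (y + k) t + L (y + k) h) = _
        abel
      rw [dist_eq_norm, e1]
      have e3 := hK₂ y k
      calc _ ≤ ‖(L (y + k) - L y - fderiv ℝ L y k) (t + h)‖ + ‖fderiv ℝ L y k h‖ := by
            refine (norm_sub_le _ _).trans (by rw [norm_neg])
        _ ≤ (K₂ * ‖k‖ ^ 2) * (‖t‖ + 1) + (K * ‖k‖) * ‖h‖ := by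
            gcongr
            · exact (ContinuousLinearMap.le_opNorm _ _).trans (by gcongr)
            · refine (ContinuousLinearMap.le_opNorm _ _).trans ?_
              gcongr
              exact (ContinuousLinearMap.le_opNorm _ _).trans (by gcongr; exact hDK y)
        _ ≤ (K₂ * (C * ‖h‖) ^ 2) * (‖t‖ + 1) + (K * (C * ‖h‖)) * ‖h‖ := by gcongr
        _ = A * ‖h‖ ^ 2 := by simp only [A]; ring
  have hO : (fun x => γ x 1 - γ t 1 - L (γ t 1) (x - t)) =O[𝓝 t] fun x => ‖x - t‖ ^ 2 := by
    refine Asymptotics.IsBigO.of_bound (A * ((Real.exp K₁ - 1) / K₁)) ?_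
    filter_upwards [Metric.ball_mem_nhds t zero_lt_one] with x hx
    have := hest (x - t) (mem_ball_iff_norm.1 hx).le
    rw [add_sub_cancel] at this
    simpa using this
  have h0 := hO.hasFDerivAt (𝕜 := ℝ) one_lt_two
  have h1 : HasFDerivAt (fun x => L (γ t 1) (x - t)) (L (γ t 1)) t :=
    (L (γ t 1)).hasFDerivAt.comp t ((hasFDerivAt_id t).sub_const t)
  have h2 := (h0.add h1).add_const (γ t 1)
  rw [zero_add] at h2
  refine h2.congr_of_eventuallyEq (Eventually.of_forall fun x => ?_)
  simp

/-- **Frobenius' theorem** for the total differential equation `Df = L ∘ f`. -/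
theorem exists_solution_total_ode {L : E → F →L[ℝ] E} {Ω : Set E} (hΩ : IsOpen Ω)
    (hL : ContDiffOn ℝ ∞ L Ω) {y₀ : E} (hy₀ : y₀ ∈ Ω)
    (hflat : ∀ y ∈ Ω, ∀ r s, fderiv ℝ L y (L y r) s = fderiv ℝ L y (L y s) r) :
    ∃ (U : Set F) (f : F → E), IsOpen U ∧ 0 ∈ U ∧ f 0 = y₀ ∧ ContDiffOn ℝ ∞ f U ∧
      ∀ t ∈ U, f t ∈ Ω ∧ HasFDerivAt f (L (f t)) t := by
  obtain ⟨R, hR, hRΩ⟩ := Metric.isOpen_iff.1 hΩ y₀ hy₀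
  let χ : ContDiffBump y₀ := ⟨R / 3, R / 2, by positivity, by linarith⟩
  have hχsupp : tsupport (χ : E → ℝ) ⊆ Ω := by
    rw [χ.tsupport_eq]
    exact (Metric.closedBall_subset_ball (by change R / 2 < R; linarith)).trans hRΩ
  have hsm : ContDiff ℝ ∞ (fun y => χ y • L y) := by
    refine contDiff_iff_contDiffAt.2 fun y => ?_
    by_cases hy : y ∈ tsupport (χ : E → ℝ)
    · exact χ.contDiff.contDiffAt.smul (hL.contDiffAt (hΩ.mem_nhds (hχsupp hy)))
    · refine (contDiffAt_const (c := (0 : F →L[ℝ] E))).congr_of_eventuallyEq ?_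
      filter_upwards [(isClosed_tsupport _).isOpen_compl.mem_nhds hy] with z hz
      rw [image_eq_zero_of_notMem_tsupport hz, zero_smul]
  have heq : ∀ y ∈ Metric.ball y₀ (R / 3), (fun y => χ y • L y) =ᶠ[𝓝 y] L := by
    intro y hy
    filter_upwards [Metric.isOpen_ball.mem_nhds hy] with z hz
    rw [χ.one_of_mem_closedBall (Metric.ball_subset_closedBall hz), one_smul]
  obtain ⟨δ, hδ, f, hf0, hf⟩ := exists_solution_of_compactSupport hsm
    (χ.hasCompactSupport.smul_right) y₀ (ρ := R / 3) (by positivity) (fun y hy r s => by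
      rw [(heq y hy).fderiv_eq, (heq y hy).eq_of_nhds]
      exact hflat y (hRΩ (Metric.ball_subset_ball (by linarith) hy)) r s)
  have hf' : ∀ t ∈ Metric.ball (0 : F) δ, f t ∈ Ω ∧ HasFDerivAt f (L (f t)) t := by
    intro t ht
    obtain ⟨h1, h2⟩ := hf t ht
    rw [(heq _ h1).eq_of_nhds] at h2
    exact ⟨hRΩ (Metric.ball_subset_ball (by linarith) h1), h2⟩
  refine ⟨Metric.ball 0 δ, f, Metric.isOpen_ball, by simpa using hδ, hf0, ?_, hf'⟩
  refine contDiffOn_infty.2 fun n => ?_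
  induction n with
  | zero =>
    exact contDiffOn_zero.2 fun t ht => (hf' t ht).2.continuousAt.continuousWithinAt
  | succ n ih =>
    rw [show ((n + 1 : ℕ) : WithTop ℕ∞) = (n : WithTop ℕ∞) + 1 by norm_cast,
      contDiffOn_succ_iff_fderiv_of_isOpen Metric.isOpen_ball]
    refine ⟨fun t ht => (hf' t ht).2.differentiableAt.differentiableWithinAt, by simp, ?_⟩
    refine ((hL.of_le (by exact_mod_cast le_top)).comp ih fun t ht => (hf' t ht).1).congr
      fun t ht => (hf' t ht).2.fderiv

end TotalODE

/-! ### Instances on spaces of bilinear forms -/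

section Instances

variable (E V : Type*) [NormedAddCommGroup E] [NormedSpace ℝ E] [NormedAddCommGroup V]
  [NormedSpace ℝ V]

/-! The instances below are the standard ones; naming them spares the unifier a long search on
iterated spaces of continuous linear maps. -/

noncomputable instance instNormedAddCommGroupCLM : NormedAddCommGroup (E →L[ℝ] V) :=
  ContinuousLinearMap.toNormedAddCommGroup

noncomputable instance instAddCommGroupCLM : AddCommGroup (E →L[ℝ] V) :=
  NormedAddCommGroup.toAddCommGroup

noncomputable instance instNormedSpaceCLM : NormedSpace ℝ (E →L[ℝ] V) :=
  ContinuousLinearMap.toNormedSpace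

noncomputable instance instNormedAddCommGroupDual : NormedAddCommGroup (E →L[ℝ] ℝ) :=
  ContinuousLinearMap.toNormedAddCommGroup

noncomputable instance instAddCommGroupDual : AddCommGroup (E →L[ℝ] ℝ) :=
  NormedAddCommGroup.toAddCommGroup

noncomputable instance instNormedAddCommGroupBilin :
    NormedAddCommGroup (E →L[ℝ] E →L[ℝ] ℝ) :=
  ContinuousLinearMap.toNormedAddCommGroup

noncomputable instance instAddCommGroupBilin : AddCommGroup (E →L[ℝ] E →L[ℝ] ℝ) :=
  NormedAddCommGroup.toAddCommGroup

end Instances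

/-! ### Christoffel symbols of a metric on a vector space -/

section Christoffel

variable {E : Type*} [NormedAddCommGroup E] [NormedSpace ℝ E]

/-- The inverse of a positive definite bilinear form, as a map from the dual space. -/
noncomputable def sharp (G : E →L[ℝ] E →L[ℝ] ℝ) : (E →L[ℝ] ℝ) →L[ℝ] E :=
  ContinuousLinearMap.inverse G

theorem isInvertible_of_pos [FiniteDimensional ℝ E] {G : E →L[ℝ] E →L[ℝ] ℝ}
    (hG : ∀ v, v ≠ 0 → 0 < G v v) : G.IsInvertible := by
  have hinj : Function.Injective (G : E →ₗ[ℝ] (E →L[ℝ] ℝ)) := by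
    rw [← LinearMap.ker_eq_bot, LinearMap.ker_eq_bot']
    intro v hv
    by_contra hne
    have := hG v hne
    rw [show G v = 0 from hv] at this
    simp at this
  have hdim : Module.finrank ℝ E = Module.finrank ℝ (E →L[ℝ] ℝ) := by
    rw [← (LinearMap.toContinuousLinearMap (𝕜 := ℝ) (E := E) (F' := ℝ)).finrank_eq]
    exact (Subspace.dual_finrank_eq (K := ℝ) (V := E)).symm
  refine ⟨(LinearEquiv.ofInjectiveOfFinrankEq (G : E →ₗ[ℝ] (E →L[ℝ] ℝ)) hinj
    hdim).toContinuousLinearEquiv, ?_⟩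
  ext v w
  rfl

theorem G_sharp [FiniteDimensional ℝ E] {G : E →L[ℝ] E →L[ℝ] ℝ}
    (hG : ∀ v, v ≠ 0 → 0 < G v v) (ξ : E →L[ℝ] ℝ) (w : E) : G (sharp G ξ) w = ξ w := by
  obtain ⟨e, he⟩ := isInvertible_of_pos hG
  rw [sharp, ← he, ContinuousLinearMap.inverse_equiv]
  exact congrArg (fun η : E →L[ℝ] ℝ => η w) (e.apply_symm_apply ξ)

/-- The inverse metric depends smoothly on the point. -/
theorem contDiffAt_sharp [FiniteDimensional ℝ E] {n : WithTop ℕ∞}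
    {V : Type*} [NormedAddCommGroup V] [NormedSpace ℝ V] {G : V → E →L[ℝ] E →L[ℝ] ℝ} {y : V}
    (hpos : ∀ v, v ≠ 0 → 0 < G y v v) (hG : ContDiffAt ℝ n G y) :
    ContDiffAt ℝ n (fun z => sharp (G z)) y := by
  have : CompleteSpace E := FiniteDimensional.complete ℝ E
  obtain ⟨e, he⟩ := isInvertible_of_pos hpos
  have h1 := contDiffAt_map_inverse (𝕜 := ℝ) (n := n) e
  rw [he] at h1
  exact h1.comp y hG

/-- The Christoffel symbols of the first kind, `G(Γ(X, Y), ·)`, for a metric with derivative `D`. -/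
noncomputable def christoffelLower (D : E →L[ℝ] E →L[ℝ] E →L[ℝ] ℝ) (X Y : E) : E →L[ℝ] ℝ :=
  (1 / 2 : ℝ) • (D X Y + D Y X - (D.flip X).flip Y)

theorem christoffelLower_apply (D : E →L[ℝ] E →L[ℝ] E →L[ℝ] ℝ) (X Y Z : E) :
    christoffelLower D X Y Z = 1 / 2 * (D X Y Z + D Y X Z - D Z X Y) := rfl

theorem christoffelLower_ext {D : E →L[ℝ] E →L[ℝ] E →L[ℝ] ℝ} {X Y : E} {ξ : E →L[ℝ] ℝ}
    (h : ∀ Z, 1 / 2 * (D X Y Z + D Y X Z - D Z X Y) = ξ Z) : christoffelLower D X Y = ξ :=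
  ContinuousLinearMap.ext h

/-- The Christoffel symbols of a metric with value `A` and derivative `D`, as a bilinear map. -/
noncomputable def christoffelOf [FiniteDimensional ℝ E] (A : E →L[ℝ] E →L[ℝ] ℝ)
    (D : E →L[ℝ] E →L[ℝ] E →L[ℝ] ℝ) : E →L[ℝ] E →L[ℝ] E :=
  LinearMap.toContinuousBilinearMap (LinearMap.mk₂ ℝ
    (fun X Y => sharp A (christoffelLower D X Y))
    (fun X X' Y => by
      rw [← map_add]; congr 1; refine christoffelLower_ext fun Z => ?_
      rw [D.map_add, (D Y).map_add, (D Z).map_add]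
      simp only [add_apply, christoffelLower_apply]; ring)
    (fun c X Y => by
      rw [← map_smul]; congr 1; refine christoffelLower_ext fun Z => ?_
      rw [D.map_smul, (D Y).map_smul, (D Z).map_smul]
      simp only [christoffelLower_apply, smul_apply, smul_eq_mul]; ring)
    (fun X Y Y' => by
      rw [← map_add]; congr 1; refine christoffelLower_ext fun Z => ?_
      rw [D.map_add, (D X).map_add, (D Z X).map_add]
      simp only [add_apply, christoffelLower_apply]; ring)
    (fun c X Y => by
      rw [← map_smul]; congr 1; refine christoffelLower_ext fun Z => ?_
      rw [D.map_smul, (D X).map_smul, (D Z X).map_smul]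
      simp only [christoffelLower_apply, smul_apply, smul_eq_mul]; ring))

/-- The coordinate form of the Koszul formula. -/
theorem christoffelOf_spec [FiniteDimensional ℝ E] {A : E →L[ℝ] E →L[ℝ] ℝ}
    {D : E →L[ℝ] E →L[ℝ] E →L[ℝ] ℝ} (hA : ∀ v, v ≠ 0 → 0 < A v v) (X Y Z : E) :
    2 * A (christoffelOf A D X Y) Z = D X Y Z + D Y X Z - D Z X Y := by
  change 2 * A (sharp A (christoffelLower D X Y)) Z = _
  rw [G_sharp hA, christoffelLower_apply]
  ring

/-- The Christoffel symbols of the metric `G` at `y`, as a bilinear map. -/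
noncomputable def christoffel [FiniteDimensional ℝ E] (G : E → E →L[ℝ] E →L[ℝ] ℝ) (y : E) :
    E →L[ℝ] E →L[ℝ] E :=
  have D : E →L[ℝ] E →L[ℝ] E →L[ℝ] ℝ := fderiv ℝ G y
  christoffelOf (G y) D

theorem christoffel_spec [FiniteDimensional ℝ E] {G : E → E →L[ℝ] E →L[ℝ] ℝ} {y : E}
    (hG : ∀ v, v ≠ 0 → 0 < G y v v) (X Y Z : E) :
    2 * G y (christoffel G y X Y) Z = fderiv ℝ G y X Y Z + fderiv ℝ G y Y X Z -
      fderiv ℝ G y Z X Y := by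
  exact christoffelOf_spec hG X Y Z

/-- The covariant derivative of a form on a vector space with metric `G`. -/
noncomputable def nablaForm [FiniteDimensional ℝ E] {p : ℕ} (G : E → E →L[ℝ] E →L[ℝ] ℝ) (α : E → E [⋀^Fin p]→L[ℝ] ℝ)
    (y X : E) (w : Fin p → E) : ℝ :=
  fderiv ℝ α y X w - ∑ j, α y (Function.update w j (christoffel G y X (w j)))

end Christoffel

/-! ### Riemannian geometry in a chart -/

section Chart

variable {m : ℕ} {M : Type*} [TopologicalSpace M] [ChartedSpace (EuclideanSpace ℝ (Fin m)) M]

/-- The differential of the inverse of the preferred chart at `x₀`. -/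
noncomputable def chartD (x₀ : M) (y : ℰ m) :
    ℰ m →L[ℝ] TangentSpace (𝓡 m) ((extChartAt (𝓡 m) x₀).symm y) :=
  mfderiv (𝓡 m) (𝓡 m) (extChartAt (𝓡 m) x₀).symm y

/-- The representation of a vector field in the preferred chart at `x₀`. -/
noncomputable def fieldInChart (X : VField m M) (x₀ : M) (y : ℰ m) : ℰ m :=
  VectorField.mpullback (𝓡 m) (𝓡 m) (extChartAt (𝓡 m) x₀).symm X y

theorem formInChart_apply {p : ℕ} (α : DForm m M p) (x₀ : M) (y : ℰ m) (w : Fin p → ℰ m) :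
    formInChart α x₀ y w = α ((extChartAt (𝓡 m) x₀).symm y) (fun i => chartD x₀ y (w i)) := rfl

variable [IsManifold (𝓡 m) ∞ M] {x₀ : M} {y : ℰ m}

theorem contMDiffAt_symm (hy : y ∈ (extChartAt (𝓡 m) x₀).target) :
    ContMDiffAt (𝓡 m) (𝓡 m) ∞ (extChartAt (𝓡 m) x₀).symm y :=
  (contMDiffOn_extChartAt_symm x₀).contMDiffAt ((isOpen_extChartAt_target x₀).mem_nhds hy)

theorem chartD_eq_within (y : ℰ m) :
    chartD x₀ y = mfderivWithin (𝓡 m) (𝓡 m) (extChartAt (𝓡 m) x₀).symm (range (𝓡 m)) y := by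
  have : range (𝓡 m) = univ := (𝓡 m).range_eq_univ
  rw [this, mfderivWithin_univ]; rfl

theorem mfderiv_chartD (hy : y ∈ (extChartAt (𝓡 m) x₀).target) (v : ℰ m) :
    mfderiv (𝓡 m) (𝓡 m) (extChartAt (𝓡 m) x₀) ((extChartAt (𝓡 m) x₀).symm y)
      (chartD x₀ y v) = v := by
  have : IsManifold (𝓡 m) 1 M := IsManifold.of_le (n := ∞) (by norm_num)
  rw [chartD_eq_within]
  exact congrArg (fun T : ℰ m →L[ℝ] ℰ m => T v)
    (mfderiv_extChartAt_comp_mfderivWithin_extChartAt_symm (I := 𝓡 m) hy)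

theorem chartD_mfderiv (hy : y ∈ (extChartAt (𝓡 m) x₀).target)
    (v : TangentSpace (𝓡 m) ((extChartAt (𝓡 m) x₀).symm y)) :
    chartD x₀ y (mfderiv (𝓡 m) (𝓡 m) (extChartAt (𝓡 m) x₀) ((extChartAt (𝓡 m) x₀).symm y) v)
      = v := by
  have : IsManifold (𝓡 m) 1 M := IsManifold.of_le (n := ∞) (by norm_num)
  rw [chartD_eq_within]
  exact DFunLike.congr_fun (mfderivWithin_extChartAt_symm_comp_mfderiv_extChartAt (I := 𝓡 m) hy) v

theorem isInvertible_chartD (hy : y ∈ (extChartAt (𝓡 m) x₀).target) :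
    (mfderiv (𝓡 m) (𝓡 m) (extChartAt (𝓡 m) x₀).symm y).IsInvertible := by
  have : IsManifold (𝓡 m) 1 M := IsManifold.of_le (n := ∞) (by norm_num)
  have h := isInvertible_mfderivWithin_extChartAt_symm (I := 𝓡 m) hy
  rwa [(𝓡 m).range_eq_univ, mfderivWithin_univ] at h

theorem chartD_injective (hy : y ∈ (extChartAt (𝓡 m) x₀).target) :
    Function.Injective (chartD x₀ y) := fun v w h => by
  rw [← mfderiv_chartD hy v, h, mfderiv_chartD hy]

theorem chartD_fieldInChart (X : VField m M) (hy : y ∈ (extChartAt (𝓡 m) x₀).target) :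
    chartD x₀ y (fieldInChart X x₀ y) = X ((extChartAt (𝓡 m) x₀).symm y) :=
  (isInvertible_chartD hy).self_apply_inverse _

theorem contDiffAt_fieldInChart {X : VField m M} (hy : y ∈ (extChartAt (𝓡 m) x₀).target)
    (hX : SmoothFieldAt X ((extChartAt (𝓡 m) x₀).symm y)) :
    ContDiffAt ℝ ∞ (fieldInChart X x₀) y := by
  have : IsManifold (𝓡 m) 1 M := IsManifold.of_le (n := ∞) (by norm_num)
  have h : ContMDiffAt (𝓡 m) (𝓡 m).tangent ∞ (fun z =>
      (⟨z, fieldInChart X x₀ z⟩ : TangentBundle (𝓡 m) (ℰ m))) y :=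
    ContMDiffAt.mpullback_vectorField_preimage hX
      (contMDiffAt_symm hy) (isInvertible_chartD hy) le_rfl
  exact contMDiffAt_vectorSpace_iff_contDiffAt.1 h

/-- The Lie bracket of vector fields in a chart. -/
theorem mlieBracket_eq_chartD {X Y : VField m M} (hy : y ∈ (extChartAt (𝓡 m) x₀).target)
    (hX : SmoothFieldAt X ((extChartAt (𝓡 m) x₀).symm y))
    (hY : SmoothFieldAt Y ((extChartAt (𝓡 m) x₀).symm y)) :
    VectorField.mlieBracket (𝓡 m) X Y ((extChartAt (𝓡 m) x₀).symm y) =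
      chartD x₀ y (fderiv ℝ (fieldInChart Y x₀) y (fieldInChart X x₀ y) -
        fderiv ℝ (fieldInChart X x₀) y (fieldInChart Y x₀ y)) := by
  have h3 : minSmoothness ℝ 3 ≤ (∞ : WithTop ℕ∞) := by
    rw [minSmoothness_of_isRCLikeNormedField]; exact WithTop.coe_le_coe.2 le_top
  have h4 : minSmoothness ℝ 2 ≤ (∞ : WithTop ℕ∞) := by
    rw [minSmoothness_of_isRCLikeNormedField]; exact WithTop.coe_le_coe.2 le_top
  have : IsManifold (𝓡 m) (minSmoothness ℝ 3) M := IsManifold.of_le (n := ∞) h3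
  have h := VectorField.mpullback_mlieBracket (I := 𝓡 m) (I' := 𝓡 m) (n := ∞)
    (f := (extChartAt (𝓡 m) x₀).symm) (x₀ := y) (hX.mdifferentiableAt (by simp))
    (hY.mdifferentiableAt (by simp)) (contMDiffAt_symm hy)
    h4
  have h2 := chartD_fieldInChart (VectorField.mlieBracket (𝓡 m) X Y) hy
  rw [← h2]
  congr 1
  refine h.trans ?_
  rw [← VectorField.mlieBracketWithin_univ, VectorField.mlieBracketWithin_eq_lieBracketWithin]
  exact congrFun (VectorField.lieBracketWithin_univ (𝕜 := ℝ) (V := fieldInChart X x₀)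
    (W := fieldInChart Y x₀)) y

/-- The differential of a function on `M`, computed in a chart. -/
theorem mvfderiv_eq_fderiv {f : M → ℝ} {g : ℰ m → ℝ} (hy : y ∈ (extChartAt (𝓡 m) x₀).target)
    (hg : DifferentiableAt ℝ g y)
    (hfg : ∀ z ∈ (extChartAt (𝓡 m) x₀).target, f ((extChartAt (𝓡 m) x₀).symm z) = g z) (v : ℰ m) :
    mvfderiv (𝓡 m) f ((extChartAt (𝓡 m) x₀).symm y) (chartD x₀ y v) = fderiv ℝ g y v := by
  have : IsManifold (𝓡 m) 1 M := IsManifold.of_le (n := ∞) (by norm_num)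
  set x := (extChartAt (𝓡 m) x₀).symm y with hx
  have hxs : x ∈ (extChartAt (𝓡 m) x₀).source := (extChartAt (𝓡 m) x₀).map_target hy
  have hyx : extChartAt (𝓡 m) x₀ x = y := (extChartAt (𝓡 m) x₀).right_inv hy
  have hφ : MDifferentiableAt (𝓡 m) (𝓡 m) (extChartAt (𝓡 m) x₀) x :=
    mdifferentiableAt_extChartAt (by rwa [extChartAt_source] at hxs)
  have heq : f =ᶠ[𝓝 x] g ∘ (extChartAt (𝓡 m) x₀) := by
    filter_upwards [(isOpen_extChartAt_source (I := 𝓡 m) x₀).mem_nhds hxs] with z hz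
    rw [Function.comp_apply, ← hfg _ ((extChartAt (𝓡 m) x₀).map_source hz),
      (extChartAt (𝓡 m) x₀).left_inv hz]
  have hgm : HasMFDerivAt (𝓡 m) 𝓘(ℝ, ℝ) g (extChartAt (𝓡 m) x₀ x) (fderiv ℝ g y) := by
    rw [hyx]; exact hg.hasFDerivAt.hasMFDerivAt
  have h := (hgm.comp x hφ.hasMFDerivAt).congr_of_eventuallyEq heq
  have h2 : mfderiv (𝓡 m) 𝓘(ℝ, ℝ) f x (chartD x₀ y v) =
      fderiv ℝ g y (mfderiv (𝓡 m) (𝓡 m) (extChartAt (𝓡 m) x₀) x (chartD x₀ y v)) := by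
    rw [h.mfderiv]; rfl
  have h3 := mfderiv_chartD hy v
  exact h2.trans (congrArg (fderiv ℝ g y) h3)

variable [RiemannianBundle (fun x : M => TangentSpace (𝓡 m) x)]

/-- The Riemannian metric in the preferred chart at `x₀`. -/
noncomputable def metricInChart (x₀ : M) (y : ℰ m) : ℰ m →L[ℝ] ℰ m →L[ℝ] ℝ :=
  LinearMap.toContinuousBilinearMap (LinearMap.mk₂ ℝ
    (fun v w => inner ℝ (chartD x₀ y v) (chartD x₀ y w))
    (fun _ _ _ => by rw [map_add, inner_add_left])
    (fun _ _ _ => by rw [map_smul, real_inner_smul_left]; rfl)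
    (fun _ _ _ => by rw [map_add, inner_add_right])
    (fun _ _ _ => by rw [map_smul, real_inner_smul_right]; rfl))

theorem metricInChart_apply (v w : ℰ m) :
    metricInChart x₀ y v w = inner ℝ (chartD x₀ y v) (chartD x₀ y w) := rfl

theorem metricInChart_symm (v w : ℰ m) : metricInChart x₀ y v w = metricInChart x₀ y w v := by
  rw [metricInChart_apply, metricInChart_apply, real_inner_comm]

theorem metricInChart_pos (hy : y ∈ (extChartAt (𝓡 m) x₀).target) (v : ℰ m) (hv : v ≠ 0) :
    0 < metricInChart x₀ y v v := by
  rw [metricInChart_apply]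
  refine real_inner_self_pos.2 fun h => hv ?_
  exact chartD_injective hy (by rw [h, map_zero])

end Chart

section Chart

variable {m : ℕ} {M : Type*} [TopologicalSpace M] [ChartedSpace (EuclideanSpace ℝ (Fin m)) M]
  [IsManifold (𝓡 m) ∞ M] {x₀ : M} {y : ℰ m}

theorem mfderiv_extChartAt_comp_symm (hy : y ∈ (extChartAt (𝓡 m) x₀).target) :
    (mfderiv (𝓡 m) (𝓡 m) (extChartAt (𝓡 m) x₀) ((extChartAt (𝓡 m) x₀).symm y)).IsInvertible := by
  have : IsManifold (𝓡 m) 1 M := IsManifold.of_le (n := ∞) (by norm_num)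
  exact isInvertible_mfderiv_extChartAt ((extChartAt (𝓡 m) x₀).map_target hy)

/-- The vector field on the domain of the chart at `x₀` with constant coordinates `v`. -/
noncomputable def coordField (x₀ : M) (v : ℰ m) : VField m M :=
  VectorField.mpullback (𝓡 m) (𝓡 m) (extChartAt (𝓡 m) x₀) (fun _ => v)

theorem coordField_apply (hy : y ∈ (extChartAt (𝓡 m) x₀).target) (v : ℰ m) :
    coordField x₀ v ((extChartAt (𝓡 m) x₀).symm y) = chartD x₀ y v := by
  have h := (mfderiv_extChartAt_comp_symm hy).self_apply_inverse v
  rw [← chartD_mfderiv hy (coordField x₀ v ((extChartAt (𝓡 m) x₀).symm y))]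
  exact congrArg (chartD x₀ y) h

theorem smoothFieldAt_coordField (hy : y ∈ (extChartAt (𝓡 m) x₀).target) (v : ℰ m) :
    SmoothFieldAt (coordField x₀ v) ((extChartAt (𝓡 m) x₀).symm y) := by
  have : IsManifold (𝓡 m) 1 M := IsManifold.of_le (n := ∞) (by norm_num)
  have hx := (extChartAt (𝓡 m) x₀).map_target hy
  refine ContMDiffAt.mpullback_vectorField_preimage (n := ∞)
    (f := extChartAt (𝓡 m) x₀) (V := fun _ => v) ?_ ?_
    (mfderiv_extChartAt_comp_symm hy) le_rfl
  · exact contMDiffAt_vectorSpace_iff_contDiffAt.2 contDiffAt_const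
  · exact contMDiffAt_extChartAt' (by rwa [extChartAt_source] at hx)

theorem fieldInChart_extend (hy : y ∈ (extChartAt (𝓡 m) x₀).target)
    (v : TangentSpace (𝓡 m) ((extChartAt (𝓡 m) x₀).symm y)) :
    chartD x₀ y (fieldInChart (FiberBundle.extend (EuclideanSpace ℝ (Fin m)) v) x₀ y) = v := by
  rw [chartD_fieldInChart _ hy, FiberBundle.extend_apply_self]

theorem smoothFieldAt_extend {x : M} (v : TangentSpace (𝓡 m) x) :
    SmoothFieldAt (FiberBundle.extend (EuclideanSpace ℝ (Fin m)) v) x :=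
  FiberBundle.contMDiffAt_extend (𝓡 m) _ v

variable [RiemannianBundle (fun x : M => TangentSpace (𝓡 m) x)]

theorem isParseval_orthonormalBasis (hy : y ∈ (extChartAt (𝓡 m) x₀).target) {ι : Type*} [Fintype ι]
    (b : OrthonormalBasis ι ℝ (TangentSpace (𝓡 m) ((extChartAt (𝓡 m) x₀).symm y)))
    {e : ι → ℰ m} (he : ∀ i, chartD x₀ y (e i) = b i) : IsParseval (metricInChart x₀ y) e := by
  intro v
  apply chartD_injective hy
  rw [map_sum]
  conv_rhs => rw [← b.sum_repr' (chartD x₀ y v)]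
  refine Finset.sum_congr rfl fun i _ => ?_
  rw [map_smul, he, metricInChart_apply, he, real_inner_comm]

variable [IsContMDiffRiemannianBundle (𝓡 m) ∞ (EuclideanSpace ℝ (Fin m))
      (fun x : M => TangentSpace (𝓡 m) x)]

theorem contDiffOn_metricInChart (x₀ : M) :
    ContDiffOn ℝ ∞ (metricInChart x₀) (extChartAt (𝓡 m) x₀).target := by
  have h : ∀ v w : ℰ m, ContDiffOn ℝ ∞ (fun y => metricInChart x₀ y v w)
      (extChartAt (𝓡 m) x₀).target := by
    intro v w y hy
    have h1 := (smoothFieldAt_coordField hy v).inner_bundle (smoothFieldAt_coordField hy w)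
    have h2 := (h1.comp y (contMDiffAt_symm hy)).contDiffAt
    refine (h2.congr_of_eventuallyEq ?_).contDiffWithinAt
    filter_upwards [(isOpen_extChartAt_target (I := 𝓡 m) x₀).mem_nhds hy] with z hz
    rw [metricInChart_apply, Function.comp_apply, coordField_apply hz, coordField_apply hz]
  exact contDiffOn_clm_apply.2 fun v => contDiffOn_clm_apply.2 fun w => h v w

theorem contDiffAt_metricInChart (hy : y ∈ (extChartAt (𝓡 m) x₀).target) :
    ContDiffAt ℝ ∞ (metricInChart x₀) y :=
  (contDiffOn_metricInChart x₀).contDiffAt ((isOpen_extChartAt_target (I := 𝓡 m) x₀).mem_nhds hy)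

theorem hasFDerivAt_bilin_apply {E : Type*} [NormedAddCommGroup E] [NormedSpace ℝ E]
    {G : E → E →L[ℝ] E →L[ℝ] ℝ} {V W : E → E} {y : E} (hG : DifferentiableAt ℝ G y)
    (hV : DifferentiableAt ℝ V y) (hW : DifferentiableAt ℝ W y) :
    DifferentiableAt ℝ (fun z => G z (V z) (W z)) y ∧
    ∀ v, fderiv ℝ (fun z => G z (V z) (W z)) y v =
      fderiv ℝ G y v (V y) (W y) + G y (fderiv ℝ V y v) (W y) + G y (V y) (fderiv ℝ W y v) := by
  have h := (hG.hasFDerivAt.clm_apply hV.hasFDerivAt).clm_apply hW.hasFDerivAt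
  refine ⟨h.differentiableAt, fun v => ?_⟩
  rw [h.fderiv]
  simp
  ring

theorem mvfderiv_inner {Y Z : VField m M} (hy : y ∈ (extChartAt (𝓡 m) x₀).target)
    (hY : SmoothFieldAt Y ((extChartAt (𝓡 m) x₀).symm y))
    (hZ : SmoothFieldAt Z ((extChartAt (𝓡 m) x₀).symm y)) (v : ℰ m) :
    mvfderiv (𝓡 m) (fun x => inner ℝ (Y x) (Z x)) ((extChartAt (𝓡 m) x₀).symm y) (chartD x₀ y v) =
      fderiv ℝ (metricInChart x₀) y v (fieldInChart Y x₀ y) (fieldInChart Z x₀ y) +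
      metricInChart x₀ y (fderiv ℝ (fieldInChart Y x₀) y v) (fieldInChart Z x₀ y) +
      metricInChart x₀ y (fieldInChart Y x₀ y) (fderiv ℝ (fieldInChart Z x₀) y v) := by
  have hGd := (contDiffAt_metricInChart hy).differentiableAt (by simp)
  have hYd := (contDiffAt_fieldInChart hy hY).differentiableAt (by simp)
  have hZd := (contDiffAt_fieldInChart hy hZ).differentiableAt (by simp)
  obtain ⟨h1, h2⟩ := hasFDerivAt_bilin_apply hGd hYd hZd
  rw [← h2]
  refine mvfderiv_eq_fderiv hy h1 (fun z hz => ?_) v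
  rw [metricInChart_apply, chartD_fieldInChart _ hz, chartD_fieldInChart _ hz]

/-- The Koszul formula in a chart: the brackets and the derivatives of the metric combine into the
Christoffel symbols. -/
theorem koszul_eq {X Y Z : VField m M} (hy : y ∈ (extChartAt (𝓡 m) x₀).target)
    (hX : SmoothFieldAt X ((extChartAt (𝓡 m) x₀).symm y))
    (hY : SmoothFieldAt Y ((extChartAt (𝓡 m) x₀).symm y))
    (hZ : SmoothFieldAt Z ((extChartAt (𝓡 m) x₀).symm y)) :
    koszul X Y Z ((extChartAt (𝓡 m) x₀).symm y) =
      metricInChart x₀ y (fderiv ℝ (fieldInChart Y x₀) y (fieldInChart X x₀ y) +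
        christoffel (metricInChart x₀) y (fieldInChart X x₀ y) (fieldInChart Y x₀ y))
        (fieldInChart Z x₀ y) := by
  have e1 := mvfderiv_inner hy hY hZ (fieldInChart X x₀ y)
  have e2 := mvfderiv_inner hy hX hZ (fieldInChart Y x₀ y)
  have e3 := mvfderiv_inner hy hX hY (fieldInChart Z x₀ y)
  rw [chartD_fieldInChart _ hy] at e1 e2 e3
  have key := christoffel_spec (metricInChart_pos hy) (fieldInChart X x₀ y) (fieldInChart Y x₀ y)
    (fieldInChart Z x₀ y)
  have f1 : ∀ A B W : VField m M, SmoothFieldAt A ((extChartAt (𝓡 m) x₀).symm y) →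
      SmoothFieldAt B ((extChartAt (𝓡 m) x₀).symm y) →
      inner ℝ (VectorField.mlieBracket (𝓡 m) A B ((extChartAt (𝓡 m) x₀).symm y))
        (W ((extChartAt (𝓡 m) x₀).symm y)) =
      metricInChart x₀ y (fderiv ℝ (fieldInChart B x₀) y (fieldInChart A x₀ y)) (fieldInChart W x₀ y)
      - metricInChart x₀ y (fderiv ℝ (fieldInChart A x₀) y (fieldInChart B x₀ y))
        (fieldInChart W x₀ y) := by
    intro A B W hA hB
    rw [mlieBracket_eq_chartD hy hA hB, ← chartD_fieldInChart W hy, ← metricInChart_apply,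
      map_sub, sub_apply]
  rw [koszul, e1, e2, e3, f1 X Y Z hX hY, f1 X Z Y hX hZ, f1 Y Z X hY hZ, map_add, add_apply]
  have s1 := metricInChart_symm (x₀ := x₀) (y := y) (fieldInChart Y x₀ y)
    (fderiv ℝ (fieldInChart Z x₀) y (fieldInChart X x₀ y))
  have s2 := metricInChart_symm (x₀ := x₀) (y := y) (fieldInChart X x₀ y)
    (fderiv ℝ (fieldInChart Z x₀) y (fieldInChart Y x₀ y))
  have s3 := metricInChart_symm (x₀ := x₀) (y := y) (fieldInChart X x₀ y)
    (fderiv ℝ (fieldInChart Y x₀) y (fieldInChart Z x₀ y))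
  linarith

/-- The Levi-Civita connection in a chart. -/
theorem leviCivita_eq {X Y : VField m M} (hy : y ∈ (extChartAt (𝓡 m) x₀).target)
    (hX : SmoothFieldAt X ((extChartAt (𝓡 m) x₀).symm y))
    (hY : SmoothFieldAt Y ((extChartAt (𝓡 m) x₀).symm y)) :
    leviCivita X Y ((extChartAt (𝓡 m) x₀).symm y) =
      chartD x₀ y (fderiv ℝ (fieldInChart Y x₀) y (fieldInChart X x₀ y) +
        christoffel (metricInChart x₀) y (fieldInChart X x₀ y) (fieldInChart Y x₀ y)) := by
  rw [leviCivita]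
  conv_rhs => rw [← (stdOrthonormalBasis ℝ
    (TangentSpace (𝓡 m) ((extChartAt (𝓡 m) x₀).symm y))).sum_repr' (chartD x₀ y _)]
  refine Finset.sum_congr rfl fun i _ => ?_
  rw [koszul_eq hy hX hY (smoothFieldAt_extend _), metricInChart_apply, fieldInChart_extend hy,
    real_inner_comm]

theorem hasFDerivAt_alternating_apply {E : Type*} [NormedAddCommGroup E] [NormedSpace ℝ E] {p : ℕ}
    {α : E → E [⋀^Fin p]→L[ℝ] ℝ} {W : Fin p → E → E} {y : E} (hα : DifferentiableAt ℝ α y)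
    (hW : ∀ j, DifferentiableAt ℝ (W j) y) :
    DifferentiableAt ℝ (fun z => α z (fun j => W j z)) y ∧
    ∀ v, fderiv ℝ (fun z => α z (fun j => W j z)) y v = fderiv ℝ α y v (fun j => W j y) +
      ∑ j, α y (Function.update (fun j => W j y) j (fderiv ℝ (W j) y v)) := by
  have h := hα.hasFDerivAt.continuousAlternatingMap_apply (fun j => (hW j).hasFDerivAt)
  refine ⟨h.differentiableAt, fun v => ?_⟩
  rw [h.fderiv]
  simp

/-- The covariant derivative of a form in a chart. -/
theorem covDerivForm_eq {p : ℕ} {α : DForm m M p} {X : VField m M} {W : Fin p → VField m M}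
    (hα : IsSmoothForm α) (hy : y ∈ (extChartAt (𝓡 m) x₀).target)
    (hX : SmoothFieldAt X ((extChartAt (𝓡 m) x₀).symm y))
    (hW : ∀ j, SmoothFieldAt (W j) ((extChartAt (𝓡 m) x₀).symm y)) :
    covDerivForm α X W ((extChartAt (𝓡 m) x₀).symm y) =
      nablaForm (metricInChart x₀) (formInChart α x₀) y (fieldInChart X x₀ y)
        (fun j => fieldInChart (W j) x₀ y) := by
  have hαd : DifferentiableAt ℝ (formInChart α x₀) y :=
    ((hα x₀).contDiffAt ((isOpen_extChartAt_target (I := 𝓡 m) x₀).mem_nhds hy)).differentiableAt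
      (by simp)
  obtain ⟨h1, h2⟩ := hasFDerivAt_alternating_apply hαd fun j =>
    (contDiffAt_fieldInChart hy (hW j)).differentiableAt (by simp)
  have h3 := mvfderiv_eq_fderiv (f := fun x => α x (fun j => W j x)) hy h1 (fun z hz => by
    rw [formInChart_apply]; simp only [chartD_fieldInChart _ hz]) (fieldInChart X x₀ y)
  rw [chartD_fieldInChart _ hy, h2] at h3
  rw [covDerivForm, h3, nablaForm, add_sub_assoc, ← Finset.sum_sub_distrib, sub_eq_add_neg _
    (∑ j, formInChart α x₀ y _), ← Finset.sum_neg_distrib]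
  congr 1
  refine Finset.sum_congr rfl fun j _ => ?_
  have h4 : α ((extChartAt (𝓡 m) x₀).symm y) (Function.update
      (fun i => W i ((extChartAt (𝓡 m) x₀).symm y)) j
      (leviCivita X (W j) ((extChartAt (𝓡 m) x₀).symm y))) =
      formInChart α x₀ y (Function.update (fun j => fieldInChart (W j) x₀ y) j
        (fderiv ℝ (fieldInChart (W j) x₀) y (fieldInChart X x₀ y) +
        christoffel (metricInChart x₀) y (fieldInChart X x₀ y) (fieldInChart (W j) x₀ y))) := by
    rw [formInChart_apply, leviCivita_eq hy hX (hW j)]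
    congr 1
    funext i
    rcases eq_or_ne i j with rfl | hij
    · simp
    · rw [Function.update_of_ne hij, Function.update_of_ne hij, chartD_fieldInChart _ hy]
  rw [h4, (formInChart α x₀ y).map_update_add]
  ring

/-- The codifferential of a form in a chart, computed with some Parseval frame. -/
theorem IsCodifferential.formInChart_eq {p : ℕ} {α : DForm m M (p + 1)} {β : DForm m M p}
    (hα : IsSmoothForm α) (hβ : IsCodifferential α β) (hy : y ∈ (extChartAt (𝓡 m) x₀).target) :
    ∃ e : Fin m → ℰ m, IsParseval (metricInChart x₀ y) e ∧ ∀ w : Fin p → ℰ m,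
      formInChart β x₀ y w = -∑ i, nablaForm (metricInChart x₀) (formInChart α x₀) y (e i)
        (Matrix.vecCons (e i) w) := by
  set x := (extChartAt (𝓡 m) x₀).symm y with hx
  have hdim : Module.finrank ℝ (TangentSpace (𝓡 m) x) = m :=
    finrank_euclideanSpace_fin (𝕜 := ℝ) (n := m)
  let b := (stdOrthonormalBasis ℝ (TangentSpace (𝓡 m) x)).reindex (finCongr hdim)
  let X : ∀ v : TangentSpace (𝓡 m) x, VField m M :=
    fun v => FiberBundle.extend (EuclideanSpace ℝ (Fin m)) v
  refine ⟨fun i => fieldInChart (X (b i)) x₀ y,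
    isParseval_orthonormalBasis hy b fun i => fieldInChart_extend hy _, fun w => ?_⟩
  have key := hβ x b (fun i => X (b i)) (fun j => X (chartD x₀ y (w j)))
    (fun i => smoothFieldAt_extend _) (fun i => FiberBundle.extend_apply_self _ _)
    (fun j => smoothFieldAt_extend _)
  have h1 : ∀ j, X (chartD x₀ y (w j)) x = chartD x₀ y (w j) :=
    fun j => FiberBundle.extend_apply_self _ _
  simp only [h1] at key
  rw [formInChart_apply, ← hx, key]
  congr 1
  refine Finset.sum_congr rfl fun i _ => ?_
  refine (covDerivForm_eq hα hy (smoothFieldAt_extend _) fun j => ?_).trans ?_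
  · refine Fin.cases ?_ (fun k => ?_) j <;> exact smoothFieldAt_extend _
  · congr 1
    funext j
    refine Fin.cases rfl (fun k => ?_) j
    exact chartD_injective hy (fieldInChart_extend hy _)

/-- Co-closedness of a form can be checked at the centres of the charts. The divergence has to vanish
for all Parseval frames there, since the definition quantifies over all orthonormal bases. -/
theorem isCodifferential_zero_of_chart {p : ℕ} {α : DForm m M (p + 1)} (hα : IsSmoothForm α)
    (h : ∀ (x₀ : M) (e : Fin m → ℰ m),
      IsParseval (metricInChart x₀ (extChartAt (𝓡 m) x₀ x₀)) e → ∀ w : Fin p → ℰ m,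
      ∑ i, nablaForm (metricInChart x₀) (formInChart α x₀) (extChartAt (𝓡 m) x₀ x₀) (e i)
        (Matrix.vecCons (e i) w) = 0) : IsCodifferential α 0 := by
  intro x₀ b E W hE hEb hW
  have hy := mem_extChartAt_target (I := 𝓡 m) x₀
  have hx : (extChartAt (𝓡 m) x₀).symm (extChartAt (𝓡 m) x₀ x₀) = x₀ := extChartAt_to_inv x₀
  have key : ∀ x, x = (extChartAt (𝓡 m) x₀).symm (extChartAt (𝓡 m) x₀ x₀) →
      ∀ (b : OrthonormalBasis (Fin m) ℝ (TangentSpace (𝓡 m) x)),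
      (∀ i, SmoothFieldAt (E i) x) → (∀ i, E i x = b i) → (∀ j, SmoothFieldAt (W j) x) →
      ∑ i, covDerivForm α (E i) (Matrix.vecCons (E i) W) x = 0 := by
    rintro x rfl b hE hEb hW
    rw [← h x₀ (fun i => fieldInChart (E i) x₀ (extChartAt (𝓡 m) x₀ x₀))
      (isParseval_orthonormalBasis hy b fun i => by rw [chartD_fieldInChart _ hy, hEb])
      (fun j => fieldInChart (W j) x₀ (extChartAt (𝓡 m) x₀ x₀))]
    refine Finset.sum_congr rfl fun i _ => ?_
    rw [covDerivForm_eq hα hy (hE i)]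
    · congr 1
      funext j
      refine Fin.cases rfl (fun k => rfl) j
    · intro j
      refine Fin.cases (hE i) (fun k => hW k) j
  rw [key x₀ hx.symm b hE hEb hW, neg_zero]
  rfl

end Chart

/-! ### Derivatives of determinants -/

section Det

variable {V : Type*} [NormedAddCommGroup V] [NormedSpace ℝ V] {ι : Type*} [Fintype ι]
  [DecidableEq ι]

/-- The determinant as a continuous alternating map in the rows. -/
noncomputable def detRows (ι : Type*) [Fintype ι] [DecidableEq ι] : (ι → ℝ) [⋀^ι]→L[ℝ] ℝ where
  toMultilinearMap := Matrix.detRowAlternating.toMultilinearMap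
  cont := Continuous.matrix_det continuous_id
  map_eq_zero_of_eq' := Matrix.detRowAlternating.map_eq_zero_of_eq'

/-- The derivative of the determinant at the identity is the trace. -/
theorem hasFDerivAt_det_of_eq_one {A : V → Matrix ι ι ℝ} {A' : ι → ι → V →L[ℝ] ℝ} {y : V}
    (hA : ∀ i j, HasFDerivAt (fun z => A z i j) (A' i j) y) (h1 : A y = 1) :
    HasFDerivAt (fun z => (A z).det) (∑ i, A' i i) y := by
  have hrow : ∀ i, HasFDerivAt (fun z => A z i) (ContinuousLinearMap.pi (A' i)) y :=
    fun i => hasFDerivAt_pi.2 (hA i)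
  have h := (hasFDerivAt_const (detRows ι) y).continuousAlternatingMap_apply hrow
  refine h.congr_fderiv ?_
  ext v
  have h2 : ∀ i, detRows ι (Function.update (fun i => A y i) i (fun j => A' i j v)) = A' i i v := by
    intro i
    have h3 := Matrix.cramer_transpose_apply (1 : Matrix ι ι ℝ) (fun j => A' i j v) i
    rw [Matrix.transpose_one, Matrix.cramer_one] at h3
    rw [h1]
    exact h3.symm
  simp only [add_apply, ContinuousLinearMap.comp_apply, zero_apply, map_zero, zero_add,
    sum_apply]
  exact Finset.sum_congr rfl fun i _ => h2 i

end Det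

/-! ### Horizontally conformal submersions between open subsets of vector spaces -/

section Symm

variable {E : Type*} [NormedAddCommGroup E] [NormedSpace ℝ E] {V : Type*} [NormedAddCommGroup V]
  [NormedSpace ℝ V]

theorem fderiv_bilin_apply {G : E → V →L[ℝ] V →L[ℝ] ℝ} {y : E} (hG : DifferentiableAt ℝ G y)
    (v w : V) : HasFDerivAt (fun z => G z v w)
      (((ContinuousLinearMap.apply ℝ ℝ w) ∘L (ContinuousLinearMap.apply ℝ (V →L[ℝ] ℝ) v)) ∘L
        fderiv ℝ G y) y :=
  ((ContinuousLinearMap.apply ℝ ℝ w) ∘L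
    (ContinuousLinearMap.apply ℝ (V →L[ℝ] ℝ) v)).hasFDerivAt.comp y hG.hasFDerivAt

theorem fderiv_bilin_symm {G : E → V →L[ℝ] V →L[ℝ] ℝ} {y : E} (hG : DifferentiableAt ℝ G y)
    (hs : ∀ᶠ z in 𝓝 y, ∀ v w, G z v w = G z w v) (X : E) (v w : V) :
    fderiv ℝ G y X v w = fderiv ℝ G y X w v := by
  have h1 := fderiv_bilin_apply hG v w
  have h2 := fderiv_bilin_apply hG w v
  have h3 := h2.congr_of_eventuallyEq (f₁ := fun z => G z v w) (hs.mono fun z hz => hz v w)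
  exact congrArg (fun T : E →L[ℝ] ℝ => T X) (h1.unique h3)

end Symm

section LocalModel

/-- The horizontal lift `F → E` of a map with differential `T` which is horizontally conformal, with
squared dilation `a`, for the inner products `A` on `E` and `H` on `F`. -/
noncomputable def horizontalLift {E F : Type*} [NormedAddCommGroup E] [NormedSpace ℝ E]
    [NormedAddCommGroup F] [NormedSpace ℝ F] (A : E →L[ℝ] E →L[ℝ] ℝ) (H : F →L[ℝ] F →L[ℝ] ℝ)
    (T : E →L[ℝ] F) (a : ℝ) : F →L[ℝ] E :=
  a⁻¹ • (sharp A ∘L ((ContinuousLinearMap.compL ℝ E F ℝ).flip T) ∘L H)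

theorem horizontalLift_apply {E F : Type*} [NormedAddCommGroup E] [NormedSpace ℝ E]
    [NormedAddCommGroup F] [NormedSpace ℝ F] (A : E →L[ℝ] E →L[ℝ] ℝ) (H : F →L[ℝ] F →L[ℝ] ℝ)
    (T : E →L[ℝ] F) (a : ℝ) (r : F) :
    horizontalLift A H T a r = a⁻¹ • sharp A ((H r) ∘L T) := rfl

/-- A horizontally conformal submersion `u : Ω → Ω'`, with squared dilation `a` whose gradient is
vertical, between open subsets of vector spaces equipped with Riemannian metrics `G` and `h`. The
functions are defined everywhere and only their restrictions to `Ω` and `Ω'` matter. Horizontal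
conformality is `lift`: the map `a⁻¹ • Duᵀ`, with the transpose taken for `G` and `h`, is a right
inverse of `Du`, which gives surjectivity at the same time. The field `da_horiz` says that the
derivative of `a` vanishes on the range of this map, the horizontal space. -/
structure ConformalModel (E F : Type*) [NormedAddCommGroup E] [NormedSpace ℝ E]
    [NormedAddCommGroup F] [NormedSpace ℝ F] where
  Ω : Set E
  Ω' : Set F
  G : E → E →L[ℝ] E →L[ℝ] ℝ
  h : F → F →L[ℝ] F →L[ℝ] ℝ
  u : E → F
  a : E → ℝ
  isOpen : IsOpen Ω
  isOpen' : IsOpen Ω'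
  mapsTo : MapsTo u Ω Ω'
  G_smooth : ContDiffOn ℝ ∞ G Ω
  h_smooth : ContDiffOn ℝ ∞ h Ω'
  u_smooth : ContDiffOn ℝ ∞ u Ω
  a_smooth : ContDiffOn ℝ ∞ a Ω
  G_symm : ∀ y ∈ Ω, ∀ v w, G y v w = G y w v
  h_symm : ∀ z ∈ Ω', ∀ v w, h z v w = h z w v
  G_pos : ∀ y ∈ Ω, ∀ v, v ≠ 0 → 0 < G y v v
  h_pos : ∀ z ∈ Ω', ∀ v, v ≠ 0 → 0 < h z v v
  a_pos : ∀ y ∈ Ω, 0 < a y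
  lift : ∀ y ∈ Ω, ∀ r, fderiv ℝ u y (horizontalLift (G y) (h (u y)) (fderiv ℝ u y) (a y) r) = r
  da_horiz : ∀ y ∈ Ω, ∀ r,
    fderiv ℝ a y (horizontalLift (G y) (h (u y)) (fderiv ℝ u y) (a y) r) = 0

namespace ConformalModel

variable {E F : Type*} [NormedAddCommGroup E] [NormedSpace ℝ E] [FiniteDimensional ℝ E]
  [NormedAddCommGroup F] [NormedSpace ℝ F] [FiniteDimensional ℝ F] (S : ConformalModel E F)

/-- The horizontal lift of tangent vectors of the target. -/
noncomputable def L (y : E) : F →L[ℝ] E :=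
  horizontalLift (S.G y) (S.h (S.u y)) (fderiv ℝ S.u y) (S.a y)

variable {S} {y : E}

theorem contDiffAt_G (hy : y ∈ S.Ω) : ContDiffAt ℝ ∞ S.G y :=
  S.G_smooth.contDiffAt (S.isOpen.mem_nhds hy)

theorem contDiffAt_u (hy : y ∈ S.Ω) : ContDiffAt ℝ ∞ S.u y :=
  S.u_smooth.contDiffAt (S.isOpen.mem_nhds hy)

theorem contDiffAt_a (hy : y ∈ S.Ω) : ContDiffAt ℝ ∞ S.a y :=
  S.a_smooth.contDiffAt (S.isOpen.mem_nhds hy)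

theorem contDiffAt_h (hy : y ∈ S.Ω) : ContDiffAt ℝ ∞ S.h (S.u y) :=
  S.h_smooth.contDiffAt (S.isOpen'.mem_nhds (S.mapsTo hy))

theorem contDiffAt_fderiv_u (hy : y ∈ S.Ω) : ContDiffAt ℝ ∞ (fderiv ℝ S.u) y :=
  (contDiffAt_u hy).fderiv_right le_rfl

theorem contDiffOn_L : ContDiffOn ℝ ∞ S.L S.Ω := by
  refine contDiffOn_clm_apply.2 fun r y hy => ContDiffAt.contDiffWithinAt ?_
  have h1 := contDiffAt_sharp (S.G_pos y hy) (contDiffAt_G hy)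
  have h2 : ContDiffAt ℝ ∞ (fun z => S.h (S.u z) r) y :=
    ((contDiffAt_h hy).comp y (contDiffAt_u hy)).clm_apply contDiffAt_const
  have h3 : ContDiffAt ℝ ∞ (fun z => (S.h (S.u z) r) ∘L fderiv ℝ S.u z) y :=
    h2.clm_comp (contDiffAt_fderiv_u hy)
  have h4 : ContDiffAt ℝ ∞ (fun z => (S.a z)⁻¹) y := (contDiffAt_a hy).inv (S.a_pos y hy).ne'
  exact h4.smul (h1.clm_apply h3)

theorem contDiffAt_L (hy : y ∈ S.Ω) : ContDiffAt ℝ ∞ S.L y :=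
  contDiffOn_L.contDiffAt (S.isOpen.mem_nhds hy)

/-- The map `a • L` is the adjoint of `Du`. -/
theorem adj (hy : y ∈ S.Ω) (r : F) (v : E) :
    S.a y * S.G y (S.L y r) v = S.h (S.u y) r (fderiv ℝ S.u y v) := by
  rw [L, horizontalLift_apply, map_smul, smul_apply, G_sharp (S.G_pos y hy), smul_eq_mul,
    ← mul_assoc, mul_inv_cancel₀ (S.a_pos y hy).ne', one_mul]
  rfl

theorem fderiv_u_L (hy : y ∈ S.Ω) (r : F) : fderiv ℝ S.u y (S.L y r) = r := S.lift y hy r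

theorem fderiv_a_L (hy : y ∈ S.Ω) (r : F) : fderiv ℝ S.a y (S.L y r) = 0 := S.da_horiz y hy r

/-- The derivative of `Du ∘ L = id`. -/
theorem d_lift (hy : y ∈ S.Ω) (X : E) (r : F) :
    fderiv ℝ (fderiv ℝ S.u) y X (S.L y r) + fderiv ℝ S.u y (fderiv ℝ S.L y X r) = 0 := by
  have hu := ((contDiffAt_fderiv_u hy).differentiableAt (by simp)).hasFDerivAt
  have hL := ((contDiffAt_L hy).differentiableAt (by simp)).hasFDerivAt
  have h1 := hu.clm_apply (hL.clm_apply (hasFDerivAt_const r y))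
  have h2 : (fun _ : E => r) =ᶠ[𝓝 y] fun z => fderiv ℝ S.u z (S.L z r) := by
    filter_upwards [S.isOpen.mem_nhds hy] with z hz using (fderiv_u_L hz r).symm
  have h3 := h1.congr_of_eventuallyEq h2
  have h4 := congrArg (fun T : E →L[ℝ] F => T X) (h3.unique (hasFDerivAt_const r y))
  simp at h4
  rw [← h4, add_comm]

/-- The derivative of the relation saying that `a • L` is the adjoint of `Du`. -/
theorem d_adj (hy : y ∈ S.Ω) (X : E) (r : F) (v : E) :
    fderiv ℝ S.a y X * S.G y (S.L y r) v +
      S.a y * (fderiv ℝ S.G y X (S.L y r) v + S.G y (fderiv ℝ S.L y X r) v) =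
    fderiv ℝ S.h (S.u y) (fderiv ℝ S.u y X) r (fderiv ℝ S.u y v) +
      S.h (S.u y) r (fderiv ℝ (fderiv ℝ S.u) y X v) := by
  have hu' := ((contDiffAt_u hy).differentiableAt (by simp)).hasFDerivAt
  have hu := ((contDiffAt_fderiv_u hy).differentiableAt (by simp)).hasFDerivAt
  have hL := ((contDiffAt_L hy).differentiableAt (by simp)).hasFDerivAt
  have hG := ((contDiffAt_G hy).differentiableAt (by simp)).hasFDerivAt
  have hh := ((contDiffAt_h hy).differentiableAt (by simp)).hasFDerivAt
  have ha := ((contDiffAt_a hy).differentiableAt (by simp)).hasFDerivAt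
  have h1 := ha.mul ((hG.clm_apply (hL.clm_apply (hasFDerivAt_const r y))).clm_apply
    (hasFDerivAt_const v y))
  have h1' := ((hh.comp y hu').clm_apply (hasFDerivAt_const r y)).clm_apply
    (hu.clm_apply (hasFDerivAt_const v y))
  have h2 : (fun z => S.a z * S.G z (S.L z r) v) =ᶠ[𝓝 y]
      fun z => S.h (S.u z) r (fderiv ℝ S.u z v) := by
    filter_upwards [S.isOpen.mem_nhds hy] with z hz using adj hz r v
  have h3 := h1'.congr_of_eventuallyEq h2
  have h4 := congrArg (fun T : E →L[ℝ] ℝ => T X) (h1.unique h3)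
  simp at h4
  linarith

/-- The first order data of a horizontally conformal submersion at a point. -/
noncomputable def jet (S : ConformalModel E F) (y : E) (hy : y ∈ S.Ω) : ConformalJet E F where
  G := S.G y
  DG := fderiv ℝ S.G y
  h := S.h (S.u y)
  Dh := fderiv ℝ S.h (S.u y)
  Du := fderiv ℝ S.u y
  D2u := fderiv ℝ (fderiv ℝ S.u) y
  L := S.L y
  DL := fderiv ℝ S.L y
  a := S.a y
  da := fderiv ℝ S.a y
  Γ := christoffel S.G y
  G_symm := S.G_symm y hy
  DG_symm := fderiv_bilin_symm ((contDiffAt_G hy).differentiableAt (by simp))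
    (by filter_upwards [S.isOpen.mem_nhds hy] with z hz using S.G_symm z hz)
  h_symm := S.h_symm _ (S.mapsTo hy)
  Dh_symm := fderiv_bilin_symm ((contDiffAt_h hy).differentiableAt (by simp))
    (by filter_upwards [S.isOpen'.mem_nhds (S.mapsTo hy)] with z hz using S.h_symm z hz)
  D2u_symm := fun v w => (contDiffAt_u hy).isSymmSndFDerivAt (by
    rw [minSmoothness_of_isRCLikeNormedField]; exact WithTop.coe_le_coe.2 le_top) v w
  G_pos := S.G_pos y hy
  h_pos := S.h_pos _ (S.mapsTo hy)
  a_pos := S.a_pos y hy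
  Γ_spec := christoffel_spec (S.G_pos y hy)
  lift := fderiv_u_L hy
  adj := adj hy
  d_lift := d_lift hy
  d_adj := d_adj hy
  da_horiz := fderiv_a_L hy

end ConformalModel

end LocalModel

/-! ### Smoothness of alternating forms -/

section Smooth

variable {V E F : Type*} [NormedAddCommGroup V] [NormedSpace ℝ V] [NormedAddCommGroup E]
  [NormedSpace ℝ E] [NormedAddCommGroup F] [NormedSpace ℝ F] {p : ℕ} {n : WithTop ℕ∞}

/-- On a finite-dimensional space, a family of alternating forms is smooth if all its values on
constant vectors are. -/
theorem contDiffAt_alternating [FiniteDimensional ℝ E] {α : V → E [⋀^Fin p]→L[ℝ] ℝ} {y : V}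
    (h : ∀ w : Fin p → E, ContDiffAt ℝ n (fun z => α z w) y) : ContDiffAt ℝ n α y := by
  let b := Module.finBasis ℝ E
  let ev : (E [⋀^Fin p]→L[ℝ] ℝ) →ₗ[ℝ] ((Fin p → Fin (Module.finrank ℝ E)) → ℝ) :=
    { toFun := fun β s => β (fun i => b (s i))
      map_add' := fun _ _ => rfl
      map_smul' := fun _ _ => rfl }
  have hinj : Function.Injective ev := fun β γ hβγ => by
    apply ContinuousAlternatingMap.toAlternatingMap_injective
    apply AlternatingMap.coe_multilinearMap_injective
    exact Module.Basis.ext_multilinear (fun _ => b) fun s => congrFun hβγ s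
  obtain ⟨g, hg⟩ := ev.exists_leftInverse_of_injective (LinearMap.ker_eq_bot.2 hinj)
  have h1 : α = fun z => LinearMap.toContinuousLinearMap g (fun s => α z (fun i => b (s i))) := by
    funext z
    exact (DFunLike.congr_fun hg (α z)).symm
  rw [h1]
  exact (LinearMap.toContinuousLinearMap g).contDiff.contDiffAt.comp y
    (contDiffAt_pi.2 fun s => h _)

theorem contDiffAt_alternating_apply {α : V → F [⋀^Fin p]→L[ℝ] ℝ} {W : Fin p → V → F} {y : V}
    (hα : ContDiffAt ℝ n α y) (hW : ∀ i, ContDiffAt ℝ n (W i) y) :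
    ContDiffAt ℝ n (fun z => α z (fun i => W i z)) y := by
  let T : (F [⋀^Fin p]→L[ℝ] ℝ) →L[ℝ] ContinuousMultilinearMap ℝ (fun _ : Fin p => F) ℝ :=
    ContinuousAlternatingMap.toContinuousMultilinearMapCLM ℝ
  have h : ContDiffAt ℝ n (fun q : (F [⋀^Fin p]→L[ℝ] ℝ) × (Fin p → F) => T q.1 q.2)
      (α y, fun i => W i y) := T.cpolynomialAt_uncurry_of_multilinear.contDiffAt
  exact h.comp (f := fun z => (α z, fun i => W i z)) y (hα.prodMk (contDiffAt_pi.2 hW))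

end Smooth

/-! ### The volume form of a metric on a vector space -/

section Gram

variable {F : Type*} [NormedAddCommGroup F] [NormedSpace ℝ F] {ι : Type*} [Fintype ι]
  [DecidableEq ι]

/-- The basis `f` is orthonormal for the bilinear form `H`. -/
def IsOrthonormalFor (H : F →L[ℝ] F →L[ℝ] ℝ) (f : Module.Basis ι ℝ F) : Prop :=
  ∀ i j, H (f i) (f j) = if i = j then 1 else 0

/-- The Gram determinant of `w`, computed from the coordinates in an orthonormal basis. -/
theorem det_gram_eq {H : F →L[ℝ] F →L[ℝ] ℝ} {f : Module.Basis ι ℝ F}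
    (hf : IsOrthonormalFor H f) (w : ι → F) :
    (Matrix.of fun i j => H (w i) (w j)).det = (f.det w) ^ 2 := by
  have h1 : (Matrix.of fun i j => H (w i) (w j)) = (f.toMatrix w).transpose * f.toMatrix w := by
    ext i j
    rw [Matrix.of_apply, Matrix.mul_apply]
    conv_lhs => rw [← f.sum_repr (w i), ← f.sum_repr (w j)]
    simp only [map_sum, map_smul, sum_apply, smul_apply, hf _ _,
      smul_eq_mul, mul_ite, mul_one, mul_zero, Finset.sum_ite_eq',
      Finset.mem_univ, if_true, Matrix.transpose_apply, Module.Basis.toMatrix_apply]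
    exact Finset.sum_congr rfl fun i _ => mul_comm _ _
  rw [h1, Matrix.det_mul, Matrix.det_transpose, f.det_apply, sq]

/-- The square of a volume form is the Gram determinant. The sign of the volume form, hence the
orientation, plays no role here. -/
theorem sq_eq_det_gram {H : F →L[ℝ] F →L[ℝ] ℝ} {f : Module.Basis ι ℝ F}
    (hf : IsOrthonormalFor H f) {vol : F [⋀^ι]→L[ℝ] ℝ} (hvol : |vol f| = 1) (w : ι → F) :
    vol w ^ 2 = (Matrix.of fun i j => H (w i) (w j)).det := by
  have h1 := congrArg (fun α : F [⋀^ι]→ₗ[ℝ] ℝ => α w) (vol.toAlternatingMap.eq_smul_basis_det f)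
  have h2 : vol w = vol f * f.det w := h1
  rw [h2, det_gram_eq hf, mul_pow, ← sq_abs (vol f), hvol, one_pow, one_mul]

/-- The derivative of a volume form on an orthonormal basis. -/
theorem two_mul_fderiv_vol {h : F → F →L[ℝ] F →L[ℝ] ℝ} {vol : F → F [⋀^ι]→L[ℝ] ℝ} {Ω' : Set F}
    (hΩ' : IsOpen Ω') (hh : ContDiffOn ℝ ∞ h Ω') (hvol : ContDiffOn ℝ ∞ vol Ω')
    (hfr : ∀ z ∈ Ω', ∃ f : Module.Basis ι ℝ F, IsOrthonormalFor (h z) f ∧ |vol z f| = 1)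
    {z : F} (hz : z ∈ Ω') {f : Module.Basis ι ℝ F} (hf : IsOrthonormalFor (h z) f) (r : F) :
    2 * fderiv ℝ vol z r f = (∑ i, fderiv ℝ h z r (f i) (f i)) * vol z f := by
  have hhd := (hh.contDiffAt (hΩ'.mem_nhds hz)).differentiableAt (by simp)
  have hvd := (hvol.contDiffAt (hΩ'.mem_nhds hz)).differentiableAt (by simp)
  have h1 := hasFDerivAt_det_of_eq_one (A := fun z' => Matrix.of fun i j => h z' (f i) (f j))
    (fun i j => fderiv_bilin_apply hhd (f i) (f j)) (by
      ext i j; rw [Matrix.of_apply, hf i j, Matrix.one_apply])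
  have h2 := hvd.hasFDerivAt.continuousAlternatingMap_apply_const f
  have h3 := (h2.pow 2).congr_of_eventuallyEq
    (f₁ := fun z' => (Matrix.of fun i j => h z' (f i) (f j)).det) (by
      filter_upwards [hΩ'.mem_nhds hz] with z' hz'
      obtain ⟨f', hf', hv'⟩ := hfr z' hz'
      exact (sq_eq_det_gram hf' hv' f).symm)
  have h4 := congrArg (fun T : F →L[ℝ] ℝ => T r) (h1.unique h3)
  have h5 : vol z f ^ 2 = 1 := by
    obtain ⟨f', hf', hv'⟩ := hfr z hz
    rw [sq_eq_det_gram hf' hv' f, det_gram_eq hf, f.det_self, one_pow]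
  simp at h4
  have h6 : (∑ i, fderiv ℝ h z r (f i) (f i)) = 2 * vol z f * fderiv ℝ vol z r f := h4
  rw [h6]
  linear_combination (-2 * fderiv ℝ vol z r f) * h5

end Gram

namespace ConformalModel

variable {E F : Type*} [NormedAddCommGroup E] [NormedSpace ℝ E] [FiniteDimensional ℝ E]
  [NormedAddCommGroup F] [NormedSpace ℝ F] [FiniteDimensional ℝ F] {S : ConformalModel E F} {y : E}
  {k : ℕ} {vol : F → F [⋀^Fin (k + 1)]→L[ℝ] ℝ}

/-- The pullback of the form `vol`. -/
noncomputable def pullback (S : ConformalModel E F) (vol : F → F [⋀^Fin (k + 1)]→L[ℝ] ℝ) (y : E) :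
    E [⋀^Fin (k + 1)]→L[ℝ] ℝ :=
  (vol (S.u y)).compContinuousLinearMap (fderiv ℝ S.u y)

/-- The covariant derivative of the pulled back form only involves the first order data `jet`. -/
theorem nablaForm_pullback (hvol : ContDiffOn ℝ ∞ vol S.Ω') (hy : y ∈ S.Ω) (X : E)
    (w : Fin (k + 1) → E) :
    nablaForm S.G (S.pullback vol) y X w =
      (S.jet y hy).covPullback (vol (S.u y)) (fderiv ℝ vol (S.u y)) X w := by
  have hu' := ((contDiffAt_u hy).differentiableAt (by simp)).hasFDerivAt
  have hu := ((contDiffAt_fderiv_u hy).differentiableAt (by simp)).hasFDerivAt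
  have hv := ((hvol.contDiffAt (S.isOpen'.mem_nhds (S.mapsTo hy))).differentiableAt
    (by simp)).hasFDerivAt
  have h := (hv.comp y hu').continuousAlternatingMapCompContinuousLinearMap hu
  have h1 : fderiv ℝ (S.pullback vol) y X w = fderiv ℝ vol (S.u y) (fderiv ℝ S.u y X)
      (fun i => fderiv ℝ S.u y (w i)) + (vol (S.u y)).fderivCompContinuousLinearMap
        (fderiv ℝ S.u y) (fderiv ℝ (fderiv ℝ S.u) y X) w := by
    have h2 : fderiv ℝ (S.pullback vol) y = _ := h.fderiv
    rw [h2]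
    rfl
  rw [nablaForm, h1, fderivComp_apply, ConformalJet.covPullback_apply, add_sub_assoc,
    ← Finset.sum_sub_distrib]
  refine congrArg₂ _ rfl (Finset.sum_congr rfl fun j _ => ?_)
  have h3 : S.pullback vol y (Function.update w j (christoffel S.G y X (w j))) =
      vol (S.u y) (Function.update (fun i => fderiv ℝ S.u y (w i)) j
        (fderiv ℝ S.u y (christoffel S.G y X (w j)))) := by
    refine congrArg (vol (S.u y)) (funext fun i => ?_)
    rcases eq_or_ne i j with rfl | hij
    · simp
    · simp [hij]
  rw [h3, ConformalJet.B_apply]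
  exact ((vol (S.u y)).map_update_sub _ _ _ _).symm

variable (S) in
/-- The fibres of the submersion are minimal: the trace of `B` over the vertical space vanishes. -/
def HasMinimalFibres : Prop :=
  ∀ y (hy : y ∈ S.Ω), ∃ (ι : Type) (_ : Fintype ι) (e : ι → E), IsParseval (S.G y) e ∧
    ∑ i, (S.jet y hy).B ((S.jet y hy).P (e i)) ((S.jet y hy).P (e i)) = 0

/-- The vertical trace of `B` can be computed with any Parseval frame. -/
theorem HasMinimalFibres.sum_B_eq_zero (hmin : S.HasMinimalFibres) (hy : y ∈ S.Ω) {ι : Type*}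
    [Fintype ι] {e : ι → E} (he : IsParseval (S.G y) e) :
    ∑ i, (S.jet y hy).B ((S.jet y hy).P (e i)) ((S.jet y hy).P (e i)) = 0 := by
  obtain ⟨κ, _, e', he', h0⟩ := hmin y hy
  rw [← h0]
  generalize S.jet y hy = J
  exact IsParseval.sum_eq (S.G_symm y hy) he he' (LinearMap.mk₂ ℝ
    (fun v w => J.B (J.P v) (J.P w)) (by intros; simp) (by intros; simp) (by intros; simp)
    (by intros; simp))

/-- When the fibres are minimal, minus the codifferential of the pulled back volume form only involves
the mixed part of `B`. -/
theorem sum_nablaForm_pullback (hvol : ContDiffOn ℝ ∞ vol S.Ω')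
    (hfr : ∀ z ∈ S.Ω', ∃ f : Module.Basis (Fin (k + 1)) ℝ F,
      IsOrthonormalFor (S.h z) f ∧ |vol z f| = 1)
    (hmin : S.HasMinimalFibres) (hy : y ∈ S.Ω) {ι : Type*} [Fintype ι] {e : ι → E}
    (he : IsParseval (S.G y) e) {f : Module.Basis (Fin (k + 1)) ℝ F}
    (hf : IsOrthonormalFor (S.h (S.u y)) f) (W : Fin k → E) :
    ∑ i, nablaForm S.G (S.pullback vol) y (e i) (Matrix.vecCons (e i) W) =
      (S.jet y hy).a * ∑ i, ∑ j, vol (S.u y) (Matrix.vecCons (f i)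
        (Function.update (fun l => (S.jet y hy).Du (W l)) j
          ((S.jet y hy).B ((S.jet y hy).L (f i)) ((S.jet y hy).P (W j))))) := by
  rw [Finset.sum_congr rfl fun i _ => nablaForm_pullback hvol hy (e i) (Matrix.vecCons (e i) W)]
  have hmin' := hmin.sum_B_eq_zero hy he
  have hgram : ∀ r, 2 * fderiv ℝ vol (S.u y) r f =
      (∑ i, (S.jet y hy).Dh r (f i) (f i)) * vol (S.u y) f :=
    two_mul_fderiv_vol S.isOpen' S.h_smooth hvol hfr (S.mapsTo hy) hf
  have he' : IsParseval (S.jet y hy).G e := he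
  have hf' : (S.jet y hy).IsOrthonormalFrame f := hf
  generalize S.jet y hy = J at *
  exact ConformalJet.sum_covPullback _ _ he' hf'
    (ConformalJet.parallel_of_gram _ _ hf' hgram) hmin' W

/-- If the horizontal distribution is integrable at `y`, then the pulled back volume form is
co-closed at `y`. -/
theorem sum_nablaForm_pullback_eq_zero (hvol : ContDiffOn ℝ ∞ vol S.Ω')
    (hfr : ∀ z ∈ S.Ω', ∃ f : Module.Basis (Fin (k + 1)) ℝ F,
      IsOrthonormalFor (S.h z) f ∧ |vol z f| = 1)
    (hmin : S.HasMinimalFibres) (hy : y ∈ S.Ω) (hint : ∀ r s, (S.jet y hy).bracket r s = 0)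
    {ι : Type*} [Fintype ι] {e : ι → E} (he : IsParseval (S.G y) e) (W : Fin k → E) :
    ∑ i, nablaForm S.G (S.pullback vol) y (e i) (Matrix.vecCons (e i) W) = 0 := by
  obtain ⟨f, hf, -⟩ := hfr _ (S.mapsTo hy)
  rw [sum_nablaForm_pullback hvol hfr hmin hy he hf,
    ConformalJet.mixed_eq_zero _ hint (show (S.jet y hy).IsOrthonormalFrame f from hf), mul_zero]

/-- If the codifferential of the pulled back volume form is closed, then the horizontal
distribution is integrable. -/
theorem bracket_eq_zero (hvol : ContDiffOn ℝ ∞ vol S.Ω')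
    (hfr : ∀ z ∈ S.Ω', ∃ f : Module.Basis (Fin (k + 1)) ℝ F,
      IsOrthonormalFor (S.h z) f ∧ |vol z f| = 1)
    (hmin : S.HasMinimalFibres) {β : E → E [⋀^Fin k]→L[ℝ] ℝ} (hβ : DifferentiableOn ℝ β S.Ω)
    (hcod : ∀ y ∈ S.Ω, ∃ (ι : Type) (_ : Fintype ι) (e : ι → E), IsParseval (S.G y) e ∧
      ∀ W, β y W = -∑ i, nablaForm S.G (S.pullback vol) y (e i) (Matrix.vecCons (e i) W))
    (hy : y ∈ S.Ω) (hclosed : extDeriv β y = 0) (r s : F) : (S.jet y hy).bracket r s = 0 := by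
  have hform : ∀ z (hz : z ∈ S.Ω) (f : Module.Basis (Fin (k + 1)) ℝ F),
      IsOrthonormalFor (S.h (S.u z)) f → ∀ W, β z W =
      -((S.jet z hz).a * ∑ i, ∑ j, vol (S.u z) (Matrix.vecCons (f i)
        (Function.update (fun l => (S.jet z hz).Du (W l)) j
          ((S.jet z hz).B ((S.jet z hz).L (f i)) ((S.jet z hz).P (W j)))))) := by
    intro z hz f hf W
    obtain ⟨ι, _, e, he, h⟩ := hcod z hz
    rw [h, sum_nablaForm_pullback hvol hfr hmin hz he hf]
  have hhor : ∀ z ∈ S.Ω, ∀ w : Fin k → F, β z (fun l => S.L z (w l)) = 0 := by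
    intro z hz w
    obtain ⟨f, hf, -⟩ := hfr _ (S.mapsTo hz)
    rw [hform z hz f hf, Finset.sum_eq_zero, mul_zero, neg_zero]
    intro i _
    refine Finset.sum_eq_zero fun j _ => (vol (S.u z)).map_coord_zero j.succ ?_
    have hP : (S.jet z hz).P (S.L z (w j)) = 0 := (S.jet z hz).P_L (w j)
    simp [hP]
  have hβy : DifferentiableAt ℝ β y := hβ.differentiableAt (S.isOpen.mem_nhds hy)
  obtain ⟨f, hf, hv⟩ := hfr _ (S.mapsTo hy)
  have hL := ((contDiffAt_L hy).differentiableAt (by simp)).hasFDerivAt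
  refine ConformalJet.bracket_eq_zero_of_closed (J := S.jet y hy) (vol (S.u y)) (f := f) hf
    (fun h => by rw [h, abs_zero] at hv; exact zero_ne_one hv) (β y) (fderiv ℝ β y)
    (hform y hy f hf) (fun X w => ?_) ?_ r s
  · have h1 := hasFDerivAt_alternating_apply (W := fun l z => S.L z (w l)) hβy
      (fun l => (hL.clm_apply (hasFDerivAt_const (w l) y)).differentiableAt)
    have h2 : (fun z => β z (fun l => S.L z (w l))) =ᶠ[𝓝 y] fun _ => 0 := by
      filter_upwards [S.isOpen.mem_nhds hy] with z hz using hhor z hz w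
    have h3 := h1.2 X
    rw [h2.fderiv_eq] at h3
    simp only [fderiv_fun_const, Pi.zero_apply, zero_apply] at h3
    rw [h3]
    refine congrArg₂ _ rfl (Finset.sum_congr rfl fun j _ => ?_)
    rw [(hL.clm_apply (hasFDerivAt_const (w j) y)).fderiv]
    simp
    rfl
  · have h1 := DFunLike.congr_fun hclosed (fun i => S.L y (f i))
    rw [extDeriv_apply hβy] at h1
    refine Eq.trans (Finset.sum_congr rfl fun i _ => ?_) h1
    rw [(hβy.hasFDerivAt.continuousAlternatingMap_apply_const _).fderiv]
    simp
    rfl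

/-- An integral manifold of the horizontal distribution through each point, provided that the
integrability tensor vanishes. -/
theorem exists_integral (hint : ∀ y (hy : y ∈ S.Ω) r s, (S.jet y hy).bracket r s = 0)
    (hy : y ∈ S.Ω) :
    ∃ (U : Set F) (f : F → E), IsOpen U ∧ 0 ∈ U ∧ f 0 = y ∧ ContDiffOn ℝ ∞ f U ∧
      ∀ t ∈ U, f t ∈ S.Ω ∧ HasFDerivAt f (S.L (f t)) t :=
  exists_solution_total_ode S.isOpen contDiffOn_L hy fun y hy r s =>
    sub_eq_zero.1 (hint y hy r s)

/-- The integrability tensor vanishes at a point lying on an integral manifold of the horizontal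
distribution. -/
theorem bracket_eq_zero_of_integral {R : Type*} [NormedAddCommGroup R] [NormedSpace ℝ R]
    {j : R → E} {t₀ : R} (hj : ContDiffAt ℝ ∞ j t₀) (hy : j t₀ ∈ S.Ω)
    (htan : ∀ᶠ t in 𝓝 t₀, ∀ s, ∃ r, fderiv ℝ j t s = S.L (j t) r)
    (hsurj : ∀ r, ∃ s, fderiv ℝ j t₀ s = S.L (j t₀) r) (r s : F) :
    (S.jet (j t₀) hy).bracket r s = 0 := by
  set J := S.jet (j t₀) hy with hJ
  have hj' := (hj.differentiableAt (by simp)).hasFDerivAt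
  have hdj := ((hj.fderiv_right (m := ∞) le_rfl).differentiableAt (by simp)).hasFDerivAt
  have hL := ((contDiffAt_L hy).differentiableAt (by simp)).hasFDerivAt
  have hu := ((contDiffAt_fderiv_u hy).differentiableAt (by simp)).hasFDerivAt
  have hev : ∀ᶠ t in 𝓝 t₀, j t ∈ S.Ω := hj.continuousAt.eventually (S.isOpen.mem_nhds hy)
  -- the derivative of the relation `Dj = L ∘ Du ∘ Dj`, which says that `j` is horizontal
  have key : ∀ v w r₁ r₂, fderiv ℝ j t₀ v = S.L (j t₀) r₁ → fderiv ℝ j t₀ w = S.L (j t₀) r₂ →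
      ∃ c, fderiv ℝ (fderiv ℝ j) t₀ v w = J.DL (J.L r₁) r₂ + J.L c := by
    intro v w r₁ r₂ hv hw
    have h1 := hdj.clm_apply (hasFDerivAt_const w t₀)
    have h2 := (hL.comp t₀ hj').clm_apply ((hu.comp t₀ hj').clm_apply h1)
    have h3 : (fun t => fderiv ℝ j t w) =ᶠ[𝓝 t₀]
        fun t => S.L (j t) (fderiv ℝ S.u (j t) (fderiv ℝ j t w)) := by
      filter_upwards [hev, htan] with t ht ht'
      obtain ⟨r, hr⟩ := ht' w
      rw [hr, fderiv_u_L ht]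
    have h4 := congrArg (fun T : R →L[ℝ] E => T v) (h1.unique (h2.congr_of_eventuallyEq h3))
    simp [hv, hw, fderiv_u_L hy] at h4
    refine ⟨fderiv ℝ S.u (j t₀) (fderiv ℝ (fderiv ℝ j) t₀ v w) +
      fderiv ℝ (fderiv ℝ S.u) (j t₀) (S.L (j t₀) r₁) (S.L (j t₀) r₂), ?_⟩
    refine h4.trans ?_
    rw [map_add, add_comm]
    rfl
  obtain ⟨v, hv⟩ := hsurj r
  obtain ⟨w, hw⟩ := hsurj s
  obtain ⟨c, hc⟩ := key v w r s hv hw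
  obtain ⟨c', hc'⟩ := key w v s r hw hv
  have hsymm : fderiv ℝ (fderiv ℝ j) t₀ v w = fderiv ℝ (fderiv ℝ j) t₀ w v :=
    hj.isSymmSndFDerivAt (by
      rw [minSmoothness_of_isRCLikeNormedField]; exact WithTop.coe_le_coe.2 le_top) v w
  have hb : J.bracket r s = J.L (c' - c) := by
    rw [ConformalJet.bracket, map_sub]
    have h5 : J.DL (J.L r) s + J.L c = J.DL (J.L s) r + J.L c' := hc.symm.trans (hsymm.trans hc')
    rw [sub_eq_sub_iff_add_eq_add, h5, add_comm]
  have h6 := J.Du_bracket r s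
  rw [hb, J.lift] at h6
  rw [hb, h6, map_zero]

end ConformalModel

/-! ### Maps between manifolds in charts -/

section OneChart

variable {n : ℕ} {N : Type*} [TopologicalSpace N] [ChartedSpace (EuclideanSpace ℝ (Fin n)) N]
  [IsManifold (𝓡 n) ∞ N] {z₀ z : N}

/-- The differential of the preferred chart at `z₀`. -/
noncomputable def chartDiff (z₀ z : N) : TangentSpace (𝓡 n) z →L[ℝ] ℰ n :=
  mfderiv (𝓡 n) (𝓡 n) (extChartAt (𝓡 n) z₀) z

theorem chartDiff_chartD {y : ℰ n} (hy : y ∈ (extChartAt (𝓡 n) z₀).target) (v : ℰ n) :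
    chartDiff z₀ ((extChartAt (𝓡 n) z₀).symm y) (chartD z₀ y v) = v := mfderiv_chartD hy v

theorem chartD_chartDiff {y : ℰ n} (hy : y ∈ (extChartAt (𝓡 n) z₀).target)
    (V : TangentSpace (𝓡 n) ((extChartAt (𝓡 n) z₀).symm y)) :
    chartD z₀ y (chartDiff z₀ ((extChartAt (𝓡 n) z₀).symm y) V) = V := chartD_mfderiv hy V

theorem formInChart_mfderiv {p : ℕ} (α : DForm n N p) (hz : z ∈ (extChartAt (𝓡 n) z₀).source)
    (V : Fin p → TangentSpace (𝓡 n) z) :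
    formInChart α z₀ (extChartAt (𝓡 n) z₀ z)
      (fun i => chartDiff z₀ z (V i)) = α z V := by
  obtain ⟨y, hy, rfl⟩ : ∃ y ∈ (extChartAt (𝓡 n) z₀).target, (extChartAt (𝓡 n) z₀).symm y = z :=
    ⟨_, (extChartAt (𝓡 n) z₀).map_source hz, (extChartAt (𝓡 n) z₀).left_inv hz⟩
  rw [(extChartAt (𝓡 n) z₀).right_inv hy, formInChart_apply]
  congr 1
  funext i
  exact chartD_chartDiff hy (V i)

theorem metricInChart_mfderiv [RiemannianBundle (fun y : N => TangentSpace (𝓡 n) y)]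
    (hz : z ∈ (extChartAt (𝓡 n) z₀).source) (V W : TangentSpace (𝓡 n) z) :
    metricInChart z₀ (extChartAt (𝓡 n) z₀ z)
      (chartDiff z₀ z V) (chartDiff z₀ z W) = inner ℝ V W := by
  obtain ⟨y, hy, rfl⟩ : ∃ y ∈ (extChartAt (𝓡 n) z₀).target, (extChartAt (𝓡 n) z₀).symm y = z :=
    ⟨_, (extChartAt (𝓡 n) z₀).map_source hz, (extChartAt (𝓡 n) z₀).left_inv hz⟩
  rw [(extChartAt (𝓡 n) z₀).right_inv hy, metricInChart_apply, chartD_chartDiff hy, chartD_chartDiff hy]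

end OneChart

section Map

variable {m n : ℕ}
  {M : Type*} [TopologicalSpace M] [ChartedSpace (EuclideanSpace ℝ (Fin m)) M]
  {N : Type*} [TopologicalSpace N] [ChartedSpace (EuclideanSpace ℝ (Fin n)) N]

variable (m n) in
/-- The map `u` read in the preferred charts at `x₀` and `z₀`. -/
noncomputable def mapInChart (u : M → N) (x₀ : M) (z₀ : N) (y : ℰ m) : ℰ n :=
  extChartAt (𝓡 n) z₀ (u ((extChartAt (𝓡 m) x₀).symm y))

variable (m n) in
/-- The domain of `mapInChart m n u x₀ z₀`. -/
def chartDomain (u : M → N) (x₀ : M) (z₀ : N) : Set (ℰ m) :=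
  (extChartAt (𝓡 m) x₀).target ∩
    (extChartAt (𝓡 m) x₀).symm ⁻¹' (u ⁻¹' (extChartAt (𝓡 n) z₀).source)

variable {u : M → N} {x₀ : M} {z₀ : N} {y : ℰ m}

theorem mem_chartDomain (u : M → N) (x₀ : M) :
    extChartAt (𝓡 m) x₀ x₀ ∈ chartDomain m n u x₀ (u x₀) := by
  refine ⟨mem_extChartAt_target x₀, ?_⟩
  rw [mem_preimage, extChartAt_to_inv, mem_preimage]
  exact mem_extChartAt_source (u x₀)

variable [IsManifold (𝓡 m) ∞ M] [IsManifold (𝓡 n) ∞ N]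

theorem isOpen_chartDomain (hu : ContMDiff (𝓡 m) (𝓡 n) ∞ u) :
    IsOpen (chartDomain m n u x₀ z₀) :=
  (continuousOn_extChartAt_symm x₀).isOpen_inter_preimage (isOpen_extChartAt_target x₀)
    ((isOpen_extChartAt_source z₀).preimage hu.continuous)

theorem contDiffOn_mapInChart (hu : ContMDiff (𝓡 m) (𝓡 n) ∞ u) :
    ContDiffOn ℝ ∞ (mapInChart m n u x₀ z₀) (chartDomain m n u x₀ z₀) := by
  intro y hy
  have h1 := contMDiffAt_symm hy.1
  have h2 : ContMDiffAt (𝓡 n) (𝓡 n) ∞ (extChartAt (𝓡 n) z₀)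
      (u ((extChartAt (𝓡 m) x₀).symm y)) :=
    contMDiffAt_extChartAt' (by rw [← extChartAt_source (𝓡 n)]; exact hy.2)
  exact ((h2.comp y ((hu _).comp y h1)).contDiffAt).contDiffWithinAt

theorem fderiv_mapInChart (hu : ContMDiff (𝓡 m) (𝓡 n) ∞ u) (hy : y ∈ chartDomain m n u x₀ z₀)
    (v : ℰ m) : fderiv ℝ (mapInChart m n u x₀ z₀) y v =
      chartDiff z₀ (u ((extChartAt (𝓡 m) x₀).symm y))
        (mfderiv (𝓡 m) (𝓡 n) u ((extChartAt (𝓡 m) x₀).symm y) (chartD x₀ y v)) := by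
  have h1 := ((contMDiffAt_symm hy.1).mdifferentiableAt (by simp)).hasMFDerivAt
  have h2 : ContMDiffAt (𝓡 n) (𝓡 n) ∞ (extChartAt (𝓡 n) z₀)
      (u ((extChartAt (𝓡 m) x₀).symm y)) :=
    contMDiffAt_extChartAt' (by rw [← extChartAt_source (𝓡 n)]; exact hy.2)
  have h3 := (h2.mdifferentiableAt (by simp)).hasMFDerivAt.comp y
    (((hu _).mdifferentiableAt (by simp)).hasMFDerivAt.comp y h1)
  have h4 : mfderiv (𝓡 m) (𝓡 n) (mapInChart m n u x₀ z₀) y = _ := h3.mfderiv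
  rw [← mfderiv_eq_fderiv]
  exact congrArg (fun T : ℰ m →L[ℝ] ℰ n => T v) h4

/-- The representation of a pulled back form is the pullback of the representation. -/
theorem formInChart_pullbackForm {p : ℕ} (hu : ContMDiff (𝓡 m) (𝓡 n) ∞ u) (α : DForm n N p)
    (hy : y ∈ chartDomain m n u x₀ z₀) :
    formInChart (pullbackForm (m := m) u α) x₀ y =
      (formInChart α z₀ (mapInChart m n u x₀ z₀ y)).compContinuousLinearMap
        (fderiv ℝ (mapInChart m n u x₀ z₀) y) := by
  ext w
  have h := formInChart_mfderiv α hy.2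
    (fun i => mfderiv (𝓡 m) (𝓡 n) u ((extChartAt (𝓡 m) x₀).symm y) (chartD x₀ y (w i)))
  simp_rw [← fderiv_mapInChart hu hy] at h
  exact h.symm

/-- The exterior derivative vanishes in every chart if it vanishes in the preferred charts. -/
theorem extDeriv_formInChart_eq_zero {p : ℕ} {β : DForm m M p} (hβ : IsSmoothForm β)
    (hd : ∀ x, extD β x = 0) (hy : y ∈ (extChartAt (𝓡 m) x₀).target) :
    extDeriv (formInChart β x₀) y = 0 := by
  set x := (extChartAt (𝓡 m) x₀).symm y with hx
  have hyd : y ∈ chartDomain m m (id : M → M) x₀ x :=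
    ⟨hy, mem_extChartAt_source x⟩
  have hsm : ContMDiff (𝓡 m) (𝓡 m) ∞ (id : M → M) := contMDiff_id
  have hpull : pullbackForm (m := m) (id : M → M) β = β := by
    funext z
    ext w
    rw [pullbackForm, mfderiv_id]
    rfl
  have hty : mapInChart m m (id : M → M) x₀ x y = extChartAt (𝓡 m) x x := rfl
  have h1 : formInChart β x₀ =ᶠ[𝓝 y] fun z =>
      (formInChart β x (mapInChart m m (id : M → M) x₀ x z)).compContinuousLinearMap
        (fderiv ℝ (mapInChart m m (id : M → M) x₀ x) z) := by
    filter_upwards [(isOpen_chartDomain hsm).mem_nhds hyd] with z hz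
    rw [← formInChart_pullbackForm hsm β hz, hpull]
  have h2 : DifferentiableAt ℝ (formInChart β x)
      (mapInChart m m (id : M → M) x₀ x y) := by
    rw [hty]
    exact ((hβ x).contDiffAt ((isOpen_extChartAt_target x).mem_nhds
      (mem_extChartAt_target x))).differentiableAt (by simp)
  rw [h1.extDeriv_eq, extDeriv_pullback (r := ∞) h2 ((contDiffOn_mapInChart hsm).contDiffAt
    ((isOpen_chartDomain hsm).mem_nhds hyd)) (by
      rw [minSmoothness_of_isRCLikeNormedField]; exact WithTop.coe_le_coe.2 le_top), hty]
  have h3 : extDeriv (formInChart β x) (extChartAt (𝓡 m) x x) = 0 := by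
    have h4 := hd x
    have h5 := mem_extChartAt_target (I := 𝓡 m) x
    ext w
    have h6 := DFunLike.congr_fun h4 (fun i => chartD x (extChartAt (𝓡 m) x x) (w i))
    have h7 : ∀ v, mfderiv (𝓡 m) (𝓡 m) (extChartAt (𝓡 m) x) x
        (chartD x (extChartAt (𝓡 m) x x) v) = v := by
      intro v
      have := mfderiv_chartD h5 v
      rwa [extChartAt_to_inv] at this
    refine Eq.trans ?_ h6
    exact congrArg (extDeriv (formInChart β x) (extChartAt (𝓡 m) x x))
      (funext fun i => (h7 (w i)).symm)
  rw [h3]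
  rfl

end Map

/-! ### Horizontally conformal submersions in charts -/

theorem inner_grad {m : ℕ} {M : Type*} [TopologicalSpace M]
    [ChartedSpace (EuclideanSpace ℝ (Fin m)) M]
    [RiemannianBundle (fun x : M => TangentSpace (𝓡 m) x)] (f : M → ℝ) (x : M)
    (X : TangentSpace (𝓡 m) x) : inner ℝ (grad f x) X = mvfderiv (𝓡 m) f x X := by
  conv_rhs => rw [← (stdOrthonormalBasis ℝ (TangentSpace (𝓡 m) x)).sum_repr' X]
  rw [grad, sum_inner, map_sum]
  refine Finset.sum_congr rfl fun i _ => ?_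
  rw [real_inner_smul_left, map_smul, smul_eq_mul, mul_comm]

section Model

variable {m n : ℕ}
  {M : Type*} [TopologicalSpace M] [ChartedSpace (EuclideanSpace ℝ (Fin m)) M]
  {N : Type*} [TopologicalSpace N] [ChartedSpace (EuclideanSpace ℝ (Fin n)) N]
  [RiemannianBundle (fun x : M => TangentSpace (𝓡 m) x)]
  [RiemannianBundle (fun y : N => TangentSpace (𝓡 n) y)]
  {u : M → N} {lam : M → ℝ} {x₀ : M} {z₀ : N} {y : ℰ m}

/-- Each tangent vector of the target has a horizontal lift. -/
theorem exists_horizontal_lift (hu : IsHorizontallyConformalSubmersion (m := m) (n := n) u lam)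
    (x : M) (R : TangentSpace (𝓡 n) (u x)) :
    ∃ X ∈ horizontal m n u x, mfderiv (𝓡 m) (𝓡 n) u x X = R := by
  obtain ⟨V, hV⟩ := hu.surjective x R
  obtain ⟨K, hK, X, hX, hKX⟩ := (LinearMap.ker
    (mfderiv (𝓡 m) (𝓡 n) u x).toLinearMap).exists_add_mem_mem_orthogonal V
  refine ⟨X, hX, ?_⟩
  rw [← hV, hKX, map_add, show mfderiv (𝓡 m) (𝓡 n) u x K = 0 from hK, zero_add]

/-- Horizontal conformality, with only one of the two vectors horizontal. -/
theorem inner_mfderiv_of_horizontal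
    (hu : IsHorizontallyConformalSubmersion (m := m) (n := n) u lam)
    {x : M} {X : TangentSpace (𝓡 m) x} (hX : X ∈ horizontal m n u x) (V : TangentSpace (𝓡 m) x) :
    inner ℝ (mfderiv (𝓡 m) (𝓡 n) u x X) (mfderiv (𝓡 m) (𝓡 n) u x V) =
      lam x ^ 2 * inner ℝ X V := by
  obtain ⟨K, hK, Y, hY, rfl⟩ := (LinearMap.ker
    (mfderiv (𝓡 m) (𝓡 n) u x).toLinearMap).exists_add_mem_mem_orthogonal V
  rw [map_add, show mfderiv (𝓡 m) (𝓡 n) u x K = 0 from hK, zero_add, hu.conformal x X hX Y hY,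
    inner_add_right, Submodule.inner_left_of_mem_orthogonal hK hX, zero_add]

variable [IsManifold (𝓡 m) ∞ M] [IsManifold (𝓡 n) ∞ N]

/-- The squared dilation in the preferred chart at `x₀`. -/
noncomputable def dilationInChart (lam : M → ℝ) (x₀ : M) (y : ℰ m) : ℝ :=
  lam ((extChartAt (𝓡 m) x₀).symm y) ^ 2

/-- The horizontal lift at a point of a chart. -/
noncomputable def liftInChart (u : M → N) (lam : M → ℝ) (x₀ : M) (z₀ : N) (y : ℰ m) : ℰ n →L[ℝ] ℰ m :=
  horizontalLift (metricInChart x₀ y) (metricInChart z₀ (mapInChart m n u x₀ z₀ y))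
    (fderiv ℝ (mapInChart m n u x₀ z₀) y) (dilationInChart lam x₀ y)

theorem metricInChart_fderiv (hs : ContMDiff (𝓡 m) (𝓡 n) ∞ u) (hy : y ∈ chartDomain m n u x₀ z₀)
    (v w : ℰ m) :
    metricInChart z₀ (mapInChart m n u x₀ z₀ y) (fderiv ℝ (mapInChart m n u x₀ z₀) y v)
      (fderiv ℝ (mapInChart m n u x₀ z₀) y w) =
    inner ℝ (mfderiv (𝓡 m) (𝓡 n) u ((extChartAt (𝓡 m) x₀).symm y) (chartD x₀ y v))
      (mfderiv (𝓡 m) (𝓡 n) u ((extChartAt (𝓡 m) x₀).symm y) (chartD x₀ y w)) := by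
  rw [fderiv_mapInChart hs hy, fderiv_mapInChart hs hy]
  exact metricInChart_mfderiv hy.2 _ _

theorem chartDiff_surjective {z : N} (hz : z ∈ (extChartAt (𝓡 n) z₀).source) :
    Function.Surjective (chartDiff (n := n) z₀ z) := by
  obtain ⟨y, hy, rfl⟩ : ∃ y ∈ (extChartAt (𝓡 n) z₀).target, (extChartAt (𝓡 n) z₀).symm y = z :=
    ⟨_, (extChartAt (𝓡 n) z₀).map_source hz, (extChartAt (𝓡 n) z₀).left_inv hz⟩
  exact fun v => ⟨_, chartDiff_chartD hy v⟩

theorem liftInChart_eq (hu : IsHorizontallyConformalSubmersion (m := m) (n := n) u lam)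
    (hy : y ∈ chartDomain m n u x₀ z₀) {v : ℰ m}
    (hv : chartD x₀ y v ∈ horizontal m n u ((extChartAt (𝓡 m) x₀).symm y)) :
    liftInChart u lam x₀ z₀ y (fderiv ℝ (mapInChart m n u x₀ z₀) y v) = v := by
  have hpos : 0 < dilationInChart lam x₀ y := pow_pos (hu.dilation_pos _) 2
  have h1 : ∀ w, metricInChart x₀ y
      (liftInChart u lam x₀ z₀ y (fderiv ℝ (mapInChart m n u x₀ z₀) y v)) w =
      metricInChart x₀ y v w := by
    intro w
    rw [liftInChart, horizontalLift_apply, map_smul, smul_apply,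
      G_sharp (metricInChart_pos hy.1), ContinuousLinearMap.comp_apply,
      metricInChart_fderiv hu.smooth hy, inner_mfderiv_of_horizontal hu hv, metricInChart_apply,
      smul_eq_mul]
    exact inv_mul_cancel_left₀ hpos.ne' _
  by_contra hne
  have h2 := metricInChart_pos hy.1 _ (sub_ne_zero.2 hne)
  rw [(metricInChart x₀ y).map_sub, sub_apply, h1, sub_self] at h2
  exact lt_irrefl _ h2

theorem exists_liftInChart (hu : IsHorizontallyConformalSubmersion (m := m) (n := n) u lam)
    (hy : y ∈ chartDomain m n u x₀ z₀) (r : ℰ n) :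
    fderiv ℝ (mapInChart m n u x₀ z₀) y (liftInChart u lam x₀ z₀ y r) = r ∧
    chartD x₀ y (liftInChart u lam x₀ z₀ y r) ∈
      horizontal m n u ((extChartAt (𝓡 m) x₀).symm y) := by
  obtain ⟨R, hR⟩ := chartDiff_surjective hy.2 r
  obtain ⟨X, hX, hXR⟩ := exists_horizontal_lift hu _ R
  obtain ⟨v, rfl⟩ : ∃ v, chartD x₀ y v = X := ⟨_, chartD_chartDiff hy.1 X⟩
  have h1 : fderiv ℝ (mapInChart m n u x₀ z₀) y v = r := by
    rw [fderiv_mapInChart hu.smooth hy, hXR, hR]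
  have h2 := liftInChart_eq hu hy hX
  rw [h1] at h2
  rw [h2]
  exact ⟨h1, hX⟩

variable [IsContMDiffRiemannianBundle (𝓡 m) ∞ (EuclideanSpace ℝ (Fin m))
      (fun x : M => TangentSpace (𝓡 m) x)]
  [IsContMDiffRiemannianBundle (𝓡 n) ∞ (EuclideanSpace ℝ (Fin n))
      (fun y : N => TangentSpace (𝓡 n) y)]

/-- A horizontally conformal submersion whose dilation is constant along horizontal curves, read
in charts. -/
noncomputable def chartModel (hu : IsHorizontallyConformalSubmersion (m := m) (n := n) u lam)
    (hgrad : ∀ x, ∀ X ∈ horizontal m n u x, mvfderiv (𝓡 m) (fun y => lam y ^ 2) x X = 0)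
    (x₀ : M) (z₀ : N) : ConformalModel (ℰ m) (ℰ n) where
  Ω := chartDomain m n u x₀ z₀
  Ω' := (extChartAt (𝓡 n) z₀).target
  G := metricInChart x₀
  h := metricInChart z₀
  u := mapInChart m n u x₀ z₀
  a := dilationInChart lam x₀
  isOpen := isOpen_chartDomain hu.smooth
  isOpen' := isOpen_extChartAt_target z₀
  mapsTo := fun _ hy => (extChartAt (𝓡 n) z₀).map_source hy.2
  G_smooth := (contDiffOn_metricInChart x₀).mono inter_subset_left
  h_smooth := contDiffOn_metricInChart z₀
  u_smooth := contDiffOn_mapInChart hu.smooth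
  a_smooth := fun y hy => by
    have h1 := (hu.smooth_dilation ((extChartAt (𝓡 m) x₀).symm y)).comp y (contMDiffAt_symm hy.1)
    exact (h1.contDiffAt.pow 2).contDiffWithinAt
  G_symm := fun _ _ => metricInChart_symm
  h_symm := fun _ _ => metricInChart_symm
  G_pos := fun _ hy => metricInChart_pos hy.1
  h_pos := fun _ hz => metricInChart_pos hz
  a_pos := fun _ _ => pow_pos (hu.dilation_pos _) 2
  lift := fun _ hy r => (exists_liftInChart hu hy r).1
  da_horiz := fun y hy r => by
    have h1 := (hu.smooth_dilation ((extChartAt (𝓡 m) x₀).symm y)).comp y (contMDiffAt_symm hy.1)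
    have h2 : DifferentiableAt ℝ (dilationInChart lam x₀) y :=
      (h1.contDiffAt.pow 2).differentiableAt (by simp)
    have h3 := mvfderiv_eq_fderiv (f := fun y => lam y ^ 2) hy.1 h2 (fun z _ => rfl)
      (liftInChart u lam x₀ z₀ y r)
    exact h3.symm.trans (hgrad _ _ (exists_liftInChart hu hy r).2)

variable {hu : IsHorizontallyConformalSubmersion (m := m) (n := n) u lam}
    {hgrad : ∀ x, ∀ X ∈ horizontal m n u x, mvfderiv (𝓡 m) (fun y => lam y ^ 2) x X = 0}

theorem chartModel_L_horizontal (hy : y ∈ chartDomain m n u x₀ z₀) (r : ℰ n) :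
    chartD x₀ y ((chartModel hu hgrad x₀ z₀).L y r) ∈
      horizontal m n u ((extChartAt (𝓡 m) x₀).symm y) := (exists_liftInChart hu hy r).2

theorem exists_chartModel_L (hy : y ∈ chartDomain m n u x₀ z₀) {v : ℰ m}
    (hv : chartD x₀ y v ∈ horizontal m n u ((extChartAt (𝓡 m) x₀).symm y)) :
    ∃ r, v = (chartModel hu hgrad x₀ z₀).L y r := ⟨_, (liftInChart_eq hu hy hv).symm⟩

end Model

section VolumeForm

variable {n : ℕ} {N : Type*} [TopologicalSpace N] [ChartedSpace (EuclideanSpace ℝ (Fin n)) N]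
  [IsManifold (𝓡 n) ∞ N] [RiemannianBundle (fun y : N => TangentSpace (𝓡 n) y)] {z₀ : N}

theorem exists_orthonormal_frame {vol : DForm n N n} (hvol : IsVolumeForm vol) {z : ℰ n}
    (hz : z ∈ (extChartAt (𝓡 n) z₀).target) :
    ∃ f : Module.Basis (Fin n) ℝ (ℰ n), IsOrthonormalFor (metricInChart z₀ z) f ∧
      |formInChart vol z₀ z f| = 1 := by
  have hdim : Module.finrank ℝ (TangentSpace (𝓡 n) ((extChartAt (𝓡 n) z₀).symm z)) = n :=
    finrank_euclideanSpace_fin (𝕜 := ℝ) (n := n)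
  let b := (stdOrthonormalBasis ℝ
    (TangentSpace (𝓡 n) ((extChartAt (𝓡 n) z₀).symm z))).reindex (finCongr hdim)
  let e : TangentSpace (𝓡 n) ((extChartAt (𝓡 n) z₀).symm z) ≃ₗ[ℝ] ℰ n :=
    { toFun := chartDiff z₀ ((extChartAt (𝓡 n) z₀).symm z)
      map_add' := map_add _
      map_smul' := map_smul _
      invFun := chartD z₀ z
      left_inv := chartD_chartDiff hz
      right_inv := chartDiff_chartD hz }
  have hf : ∀ i, chartD z₀ z (b.toBasis.map e i) = b i := fun i => by
    rw [Module.Basis.map_apply, b.coe_toBasis]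
    exact chartD_chartDiff hz (b i)
  refine ⟨b.toBasis.map e, fun i j => ?_, ?_⟩
  · rw [metricInChart_apply, hf, hf, orthonormal_iff_ite.1 b.orthonormal]
  · rw [formInChart_apply, funext hf]
    exact hvol.2 _ b

end VolumeForm

/-! ### Integrability of the horizontal distribution -/

theorem nablaForm_congr {E : Type*} [NormedAddCommGroup E] [NormedSpace ℝ E]
    [FiniteDimensional ℝ E] {p : ℕ} (G : E → E →L[ℝ] E →L[ℝ] ℝ) {α β : E → E [⋀^Fin p]→L[ℝ] ℝ}
    {y : E} (h : α =ᶠ[𝓝 y] β) (X : E) (w : Fin p → E) :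
    nablaForm G α y X w = nablaForm G β y X w := by
  rw [nablaForm, nablaForm, h.fderiv_eq, h.eq_of_nhds]

section Smooth

variable {m n : ℕ}
  {M : Type*} [TopologicalSpace M] [ChartedSpace (EuclideanSpace ℝ (Fin m)) M]
  {N : Type*} [TopologicalSpace N] [ChartedSpace (EuclideanSpace ℝ (Fin n)) N]
  [IsManifold (𝓡 m) ∞ M] [IsManifold (𝓡 n) ∞ N] {u : M → N}

theorem formInChart_pullbackForm_eventuallyEq {p : ℕ} (hu : ContMDiff (𝓡 m) (𝓡 n) ∞ u)
    (α : DForm n N p) {x₀ : M} {z₀ : N} {y : ℰ m} (hy : y ∈ chartDomain m n u x₀ z₀) :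
    formInChart (pullbackForm (m := m) u α) x₀ =ᶠ[𝓝 y] fun z =>
      (formInChart α z₀ (mapInChart m n u x₀ z₀ z)).compContinuousLinearMap
        (fderiv ℝ (mapInChart m n u x₀ z₀) z) := by
  filter_upwards [(isOpen_chartDomain hu).mem_nhds hy] with z hz
  exact formInChart_pullbackForm hu α hz

theorem isSmoothForm_pullbackForm {p : ℕ} (hu : ContMDiff (𝓡 m) (𝓡 n) ∞ u) {α : DForm n N p}
    (hα : IsSmoothForm α) : IsSmoothForm (pullbackForm (m := m) u α) := by
  intro x₀ y hy
  set z₀ := u ((extChartAt (𝓡 m) x₀).symm y) with hz₀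
  have hyd : y ∈ chartDomain m n u x₀ z₀ := ⟨hy, mem_extChartAt_source z₀⟩
  have hû := (contDiffOn_mapInChart hu).contDiffAt ((isOpen_chartDomain hu).mem_nhds hyd)
  have h1 : ContDiffAt ℝ ∞ (formInChart α z₀) (mapInChart m n u x₀ z₀ y) :=
    (hα z₀).contDiffAt ((isOpen_extChartAt_target z₀).mem_nhds
      ((extChartAt (𝓡 n) z₀).map_source hyd.2))
  refine ContDiffAt.contDiffWithinAt ?_
  refine ContDiffAt.congr_of_eventuallyEq ?_ (formInChart_pullbackForm_eventuallyEq hu α hyd)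
  exact contDiffAt_alternating fun w => contDiffAt_alternating_apply
    (α := fun z => formInChart α z₀ (mapInChart m n u x₀ z₀ z))
    (W := fun i z => fderiv ℝ (mapInChart m n u x₀ z₀) z (w i)) (h1.comp y hû) fun i =>
    (hû.fderiv_right (m := ∞) le_rfl).clm_apply contDiffAt_const

/-- The pullback of a form of top degree is closed. -/
theorem extD_pullbackForm (hu : ContMDiff (𝓡 m) (𝓡 n) ∞ u) {α : DForm n N n}
    (hα : IsSmoothForm α) (x : M) : extD (pullbackForm (m := m) u α) x = 0 := by
  have hy := mem_chartDomain (m := m) (n := n) u x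
  have hû := (contDiffOn_mapInChart hu).contDiffAt ((isOpen_chartDomain hu).mem_nhds hy)
  have h1 : DifferentiableAt ℝ (formInChart α (u x)) (mapInChart m n u x (u x)
      (extChartAt (𝓡 m) x x)) :=
    ((hα _).contDiffAt ((isOpen_extChartAt_target _).mem_nhds
      ((extChartAt (𝓡 n) (u x)).map_source hy.2))).differentiableAt (by simp)
  have h2 : extDeriv (formInChart (pullbackForm (m := m) u α) x) (extChartAt (𝓡 m) x x) = 0 := by
    rw [(formInChart_pullbackForm_eventuallyEq hu α hy).extDeriv_eq,
      extDeriv_pullback (r := ∞) h1 hû (by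
        rw [minSmoothness_of_isRCLikeNormedField]; exact WithTop.coe_le_coe.2 le_top)]
    ext w
    refine (extDeriv (formInChart α (u x)) _).toAlternatingMap.map_linearDependent _ fun hli => ?_
    have := hli.fintype_card_le_finrank
    rw [finrank_euclideanSpace_fin, Fintype.card_fin] at this
    omega
  rw [extD, h2]
  rfl

end Smooth

section Integrability

variable {m k : ℕ}
  {M : Type*} [TopologicalSpace M] [ChartedSpace (EuclideanSpace ℝ (Fin m)) M]
  {N : Type*} [TopologicalSpace N] [ChartedSpace (EuclideanSpace ℝ (Fin (k + 1))) N]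
  [RiemannianBundle (fun x : M => TangentSpace (𝓡 m) x)]
  [RiemannianBundle (fun y : N => TangentSpace (𝓡 (k + 1)) y)]
  [IsManifold (𝓡 m) ∞ M] [IsManifold (𝓡 (k + 1)) ∞ N]
  [IsContMDiffRiemannianBundle (𝓡 m) ∞ (EuclideanSpace ℝ (Fin m))
      (fun x : M => TangentSpace (𝓡 m) x)]
  [IsContMDiffRiemannianBundle (𝓡 (k + 1)) ∞ (EuclideanSpace ℝ (Fin (k + 1)))
      (fun y : N => TangentSpace (𝓡 (k + 1)) y)]
  {u : M → N} {lam : M → ℝ}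
  (hu : IsHorizontallyConformalSubmersion (m := m) (n := k + 1) u lam)
  (hgrad : ∀ x, ∀ X ∈ horizontal m (k + 1) u x, mvfderiv (𝓡 m) (fun y => lam y ^ 2) x X = 0)
  {vol : DForm (k + 1) N (k + 1)}

/-- If the codifferential of `u^* vol` is closed, then the horizontal distribution is completely
integrable. -/
theorem isCompletelyIntegrable_of_closed (hvol : IsVolumeForm vol)
    (hmin : ∀ x₀, (chartModel hu hgrad x₀ (u x₀)).HasMinimalFibres) {β : DForm m M k}
    (hβ : IsSmoothForm β) (hcod : IsCodifferential (pullbackForm (m := m) u vol) β)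
    (hclosed : ∀ x, extD β x = 0) : IsCompletelyIntegrable (k + 1) (horizontal m (k + 1) u) := by
  intro x₀
  have hsub : (chartModel hu hgrad x₀ (u x₀)).Ω ⊆ (extChartAt (𝓡 m) x₀).target :=
    inter_subset_left
  have hbr : ∀ y (hy : y ∈ (chartModel hu hgrad x₀ (u x₀)).Ω) r s,
      ((chartModel hu hgrad x₀ (u x₀)).jet y hy).bracket r s = 0 := by
    intro y hy r s
    refine ConformalModel.bracket_eq_zero (S := chartModel hu hgrad x₀ (u x₀)) (hvol.1 (u x₀))
      (fun z hz => exists_orthonormal_frame hvol hz) (hmin x₀) (β := formInChart β x₀)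
      (((hβ x₀).differentiableOn (by simp)).mono hsub) (fun z hz => ?_) hy
      (extDeriv_formInChart_eq_zero hβ hclosed (hsub hy)) r s
    obtain ⟨e, he, h⟩ := hcod.formInChart_eq (isSmoothForm_pullbackForm hu.smooth hvol.1) (hsub hz)
    refine ⟨Fin m, inferInstance, e, he, fun W => ?_⟩
    rw [h]
    congr 1
    exact Finset.sum_congr rfl fun i _ => nablaForm_congr _
      (formInChart_pullbackForm_eventuallyEq hu.smooth vol hz) _ _
  have hy₀ := mem_chartDomain (m := m) (n := k + 1) u x₀
  obtain ⟨U, f, hU, h0, hf0, hf, hfL⟩ :=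
    ConformalModel.exists_integral (S := chartModel hu hgrad x₀ (u x₀)) hbr hy₀
  refine ⟨U, fun t => (extChartAt (𝓡 m) x₀).symm (f t), hU, h0, ?_, ?_, fun t ht => ?_⟩
  · exact (congrArg (extChartAt (𝓡 m) x₀).symm hf0).trans (extChartAt_to_inv x₀)
  · exact (contMDiffOn_extChartAt_symm x₀).comp hf.contMDiffOn fun t ht => hsub (hfL t ht).1
  · obtain ⟨hft, hD⟩ := hfL t ht
    have h1 : HasMFDerivAt (𝓡 (k + 1)) (𝓡 m) (fun t => (extChartAt (𝓡 m) x₀).symm (f t)) t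
        ((chartD x₀ (f t)) ∘L ((chartModel hu hgrad x₀ (u x₀)).L (f t))) :=
      ((contMDiffAt_symm (hsub hft)).mdifferentiableAt (by simp)).hasMFDerivAt.comp t
        hD.hasMFDerivAt
    rw [h1.mfderiv]
    constructor
    · intro r s hrs
      have h2 : (chartModel hu hgrad x₀ (u x₀)).L (f t) r =
        (chartModel hu hgrad x₀ (u x₀)).L (f t) s := chartD_injective (hsub hft) hrs
      exact (ConformalModel.fderiv_u_L hft r).symm.trans
        ((congrArg _ h2).trans (ConformalModel.fderiv_u_L hft s))
    · ext X
      constructor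
      · rintro ⟨r, rfl⟩
        exact chartModel_L_horizontal (hu := hu) (hgrad := hgrad) hft r
      · intro hX
        have h2 := chartD_chartDiff (hsub hft) X
        rw [← h2] at hX
        obtain ⟨r, hr⟩ := exists_chartModel_L (hu := hu) (hgrad := hgrad) hft hX
        refine ⟨r, ?_⟩
        rw [← h2, hr]
        rfl

/-- If the horizontal distribution is completely integrable, then `u^* vol` is co-closed. -/
theorem isCodifferential_zero_of_integrable (hvol : IsVolumeForm vol)
    (hmin : ∀ x₀, (chartModel hu hgrad x₀ (u x₀)).HasMinimalFibres)
    (hint : IsCompletelyIntegrable (k + 1) (horizontal m (k + 1) u)) :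
    IsCodifferential (pullbackForm (m := m) u vol) 0 := by
  refine isCodifferential_zero_of_chart (isSmoothForm_pullbackForm hu.smooth hvol.1)
    fun x₀ e he w => ?_
  have hy := mem_chartDomain (m := m) (n := k + 1) u x₀
  rw [Finset.sum_congr rfl fun i _ => nablaForm_congr _
      (formInChart_pullbackForm_eventuallyEq hu.smooth vol hy) (e i) _]
  refine ConformalModel.sum_nablaForm_pullback_eq_zero (S := chartModel hu hgrad x₀ (u x₀))
    (hvol.1 (u x₀)) (fun z hz => exists_orthonormal_frame hvol hz) (hmin x₀) hy ?_ he w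
  obtain ⟨U, j, hU, h0, hj0, hj, hjD⟩ := hint x₀
  have hsrc : ∀ᶠ t in 𝓝 (0 : ℰ (k + 1)), t ∈ U ∧ j t ∈ (extChartAt (𝓡 m) x₀).source ∧
      extChartAt (𝓡 m) x₀ (j t) ∈ chartDomain m (k + 1) u x₀ (u x₀) := by
    have hc : ContinuousAt j 0 := (hj.contMDiffAt (hU.mem_nhds h0)).continuousAt
    have h1 : ∀ᶠ x in 𝓝 (j 0), x ∈ (extChartAt (𝓡 m) x₀).source := by
      rw [hj0]; exact extChartAt_source_mem_nhds x₀
    have h2 : ContinuousAt (extChartAt (𝓡 m) x₀) (j 0) := by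
      rw [hj0]; exact continuousAt_extChartAt x₀
    have h3 : chartDomain m (k + 1) u x₀ (u x₀) ∈ 𝓝 (extChartAt (𝓡 m) x₀ (j 0)) := by
      rw [hj0]; exact (isOpen_chartDomain hu.smooth).mem_nhds hy
    filter_upwards [hU.mem_nhds h0, hc.eventually h1, hc.eventually (h2.eventually h3)]
      with t a b c using ⟨a, b, c⟩
  have hderiv : ∀ t ∈ U, j t ∈ (extChartAt (𝓡 m) x₀).source →
      ContDiffAt ℝ ∞ (fun t => extChartAt (𝓡 m) x₀ (j t)) t ∧
      ∀ s, fderiv ℝ (fun t => extChartAt (𝓡 m) x₀ (j t)) t s =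
        chartDiff x₀ (j t) (mfderiv (𝓡 (k + 1)) (𝓡 m) j t s) := by
    intro t ht hsrc
    have h1 := hj.contMDiffAt (hU.mem_nhds ht)
    have h2 : ContMDiffAt (𝓡 m) (𝓡 m) ∞ (extChartAt (𝓡 m) x₀) (j t) :=
      contMDiffAt_extChartAt' (by rwa [← extChartAt_source (𝓡 m)])
    refine ⟨(h2.comp t h1).contDiffAt, fun s => ?_⟩
    have h3 := (h2.mdifferentiableAt (by simp)).hasMFDerivAt.comp t
      (h1.mdifferentiableAt (by simp)).hasMFDerivAt
    have h4 : mfderiv (𝓡 (k + 1)) (𝓡 m) (fun t => extChartAt (𝓡 m) x₀ (j t)) t = _ := h3.mfderiv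
    rw [← mfderiv_eq_fderiv]
    exact congrArg (fun T : ℰ (k + 1) →L[ℝ] ℰ m => T s) h4
  have hlift : ∀ t ∈ U, j t ∈ (extChartAt (𝓡 m) x₀).source →
      extChartAt (𝓡 m) x₀ (j t) ∈ chartDomain m (k + 1) u x₀ (u x₀) →
      (∀ s, ∃ r, fderiv ℝ (fun t => extChartAt (𝓡 m) x₀ (j t)) t s =
        (chartModel hu hgrad x₀ (u x₀)).L (extChartAt (𝓡 m) x₀ (j t)) r) ∧
      (∀ r, ∃ s, fderiv ℝ (fun t => extChartAt (𝓡 m) x₀ (j t)) t s =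
        (chartModel hu hgrad x₀ (u x₀)).L (extChartAt (𝓡 m) x₀ (j t)) r) := by
    intro t ht hs hd
    have hrange := (hjD t ht).2
    have hinv := (extChartAt (𝓡 m) x₀).left_inv hs
    have key : ∀ x, x = j t → ∀ V : TangentSpace (𝓡 m) x,
        (V ∈ horizontal m (k + 1) u x ↔ ∃ s, mfderiv (𝓡 (k + 1)) (𝓡 m) j t s = V) := by
      rintro x rfl V
      rw [← hrange]
      rfl
    have hcd : ∀ V : TangentSpace (𝓡 m) (j t),
        chartD x₀ (extChartAt (𝓡 m) x₀ (j t)) (chartDiff x₀ (j t) V) = V := by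
      intro V
      have := chartD_chartDiff ((extChartAt (𝓡 m) x₀).map_source hs) V
      rwa [hinv] at this
    constructor
    · intro s
      rw [(hderiv t ht hs).2 s]
      refine exists_chartModel_L (hu := hu) (hgrad := hgrad) hd ?_
      rw [hcd]
      exact (key _ hinv _).2 ⟨s, rfl⟩
    · intro r
      obtain ⟨s, hs'⟩ := (key _ hinv _).1
        (chartModel_L_horizontal (hu := hu) (hgrad := hgrad) hd r)
      refine ⟨s, ?_⟩
      rw [(hderiv t ht hs).2 s]
      apply chartD_injective hd.1
      rw [hcd]
      exact hs'
  have hev := hsrc.self_of_nhds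
  have hy' : extChartAt (𝓡 m) x₀ (j 0) ∈ (chartModel hu hgrad x₀ (u x₀)).Ω := hev.2.2
  have key := ConformalModel.bracket_eq_zero_of_integral (S := chartModel hu hgrad x₀ (u x₀))
    (hderiv 0 h0 hev.2.1).1 hy' (by
      filter_upwards [hsrc] with t ht using (hlift t ht.1 ht.2.1 ht.2.2).1)
    (hlift 0 h0 hev.2.1 hev.2.2).2
  simpa only [hj0] using key

end Integrability

/-! ### Traces -/

section Trace

variable {E : Type*} [NormedAddCommGroup E] [NormedSpace ℝ E] [FiniteDimensional ℝ E]
  {κ : Type*} [Fintype κ]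

/-- The trace of the bilinear form `k` with respect to the inner product `A`, computed from a basis
and the dual basis. -/
noncomputable def traceForm (b : Module.Basis κ ℝ E) (A k : E →L[ℝ] E →L[ℝ] ℝ) : ℝ :=
  ∑ i, k (b i) (sharp A (LinearMap.toContinuousLinearMap (b.coord i)))

/-- The trace can be computed with any Parseval frame. -/
theorem traceForm_eq_sum (b : Module.Basis κ ℝ E) {A : E →L[ℝ] E →L[ℝ] ℝ}
    (hA : ∀ v, v ≠ 0 → 0 < A v v) (k : E →L[ℝ] E →L[ℝ] ℝ) {ι : Type*} [Fintype ι] {e : ι → E}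
    (he : IsParseval A e) : traceForm b A k = ∑ i, k (e i) (e i) := by
  have h1 : ∀ i, k (e i) (e i) = ∑ j, b.repr (e i) j * k (b j) (e i) := by
    intro i
    have h2 := congrArg (fun v => k v (e i)) (b.sum_repr (e i))
    simp only [map_sum, sum_apply, map_smul, smul_apply, smul_eq_mul] at h2
    exact h2.symm
  rw [Finset.sum_congr rfl fun i _ => h1 i, Finset.sum_comm]
  refine Finset.sum_congr rfl fun j _ => ?_
  conv_lhs => rw [← he (sharp A (LinearMap.toContinuousLinearMap (b.coord j)))]
  rw [map_sum]
  refine Finset.sum_congr rfl fun i _ => ?_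
  rw [map_smul, G_sharp hA]
  rfl

/-- The trace of an endomorphism, computed with a Parseval frame. -/
theorem sum_repr_eq_sum_parseval (b : Module.Basis κ ℝ E) {A : E →L[ℝ] E →L[ℝ] ℝ}
    (hs : ∀ v w, A v w = A w v) (T : E →L[ℝ] E) {ι : Type*} [Fintype ι] {e : ι → E}
    (he : IsParseval A e) : ∑ j, b.repr (T (b j)) j = ∑ i, A (e i) (T (e i)) := by
  have h1 : ∀ i, A (e i) (T (e i)) = ∑ j, b.repr (e i) j * A (e i) (T (b j)) := by
    intro i
    have h2 := congrArg (fun v => A (e i) (T v)) (b.sum_repr (e i))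
    simp only [map_sum, map_smul, smul_eq_mul] at h2
    exact h2.symm
  rw [Finset.sum_congr rfl fun i _ => h1 i, Finset.sum_comm]
  refine Finset.sum_congr rfl fun j _ => ?_
  have h2 := congrArg (b.coord j) (he (T (b j)))
  simp only [map_sum, map_smul, smul_eq_mul, Module.Basis.coord_apply] at h2
  rw [← h2]
  refine Finset.sum_congr rfl fun i _ => ?_
  rw [hs, mul_comm]

end Trace

namespace ConformalJet

variable {E F : Type*} [NormedAddCommGroup E] [NormedSpace ℝ E]
    [NormedAddCommGroup F] [NormedSpace ℝ F] {J : ConformalJet E F}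

/-- The energy of a horizontally conformal map. -/
theorem sum_h_Du {ι κ : Type*} [Fintype ι] [Fintype κ] [DecidableEq κ]
    {e : ι → E} (he : IsParseval J.G e) {f : Module.Basis κ ℝ F} (hf : J.IsOrthonormalFrame f) :
    ∑ i, J.h (J.Du (e i)) (J.Du (e i)) = Fintype.card κ * J.a := by
  have h1 := IsParseval.sum_eq J.G_symm he (isParseval_adapted he hf) (LinearMap.mk₂ ℝ
    (fun v w => J.h (J.Du v) (J.Du w)) (by intros; simp) (by intros; simp) (by intros; simp)
    (by intros; simp))
  simp only [LinearMap.mk₂_apply, Fintype.sum_sum_type, Sum.elim_inl, Sum.elim_inr, J.Du_P,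
    map_smul, J.lift, smul_apply, smul_eq_mul, hf _ _, if_true, mul_one,
    Real.mul_self_sqrt J.a_pos.le, map_zero, Finset.sum_const_zero, add_zero, Finset.sum_const,
    Finset.card_univ, nsmul_eq_mul] at h1
  exact h1

/-- The contribution of a horizontal vector to both sides of the Euler–Lagrange equation is the same,
because the dilation has no horizontal derivative. -/
theorem a_mul_horizontal (w f : F) :
    J.a * (J.DG (J.L w) (J.L f) (J.L f) + 2 * J.G (J.L f) (J.DL (J.L f) w)) = J.Dh w f f := by
  have h1 := J.d_adj (J.L w) f (J.L f)
  have h2 := J.d_lift (J.L w) f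
  rw [J.da_horiz, J.lift, J.lift, eq_neg_of_add_eq_zero_left h2, map_neg, ← J.adj] at h1
  have h3 := J.G_DL_symm f w f
  have h4 := J.G_symm (J.DL (J.L w) f) (J.L f)
  rw [h4] at h1
  rw [h3]
  linarith

/-- The Euler–Lagrange equation of a horizontally conformal submersion whose dilation is constant
along horizontal curves says that the fibres are minimal. -/
theorem sum_B_eq_zero_of_trace {ι κ : Type*} [Fintype ι] [Fintype κ] [DecidableEq κ]
    {e : ι → E} (he : IsParseval J.G e) {f : Module.Basis κ ℝ F} (hf : J.IsOrthonormalFrame f)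
    (H : ∀ w, ∑ i, J.Dh w (J.Du (e i)) (J.Du (e i)) =
      J.a * ∑ i, (J.DG (J.L w) (e i) (e i) + 2 * J.G (e i) (J.DL (e i) w))) :
    ∑ i, J.B (J.P (e i)) (J.P (e i)) = 0 := by
  refine J.h_ext fun w => ?_
  rw [J.h_symm, map_zero, zero_apply, map_sum]
  have h1 := IsParseval.sum_eq J.G_symm he (isParseval_adapted he hf) (LinearMap.mk₂ ℝ
    (fun v v' => J.Dh w (J.Du v) (J.Du v') -
      J.a * (J.DG (J.L w) v v' + 2 * J.G v (J.DL v' w)))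
    (by intros; simp; ring) (by intros; simp; ring) (by intros; simp; ring)
    (by intros; simp; ring))
  have hz : J.Dh w 0 0 = 0 := map_zero _
  simp only [LinearMap.mk₂_apply, Fintype.sum_sum_type, Sum.elim_inl, Sum.elim_inr, J.Du_P,
    map_smul, J.lift, smul_apply, smul_eq_mul, Finset.sum_sub_distrib, ← Finset.mul_sum, H,
    sub_self] at h1
  have h2 : ∀ i, √J.a * (√J.a * J.Dh w (f i) (f i)) = J.a * (√J.a * (√J.a *
      J.DG (J.L w) (J.L (f i)) (J.L (f i))) + 2 * (√J.a * (√J.a *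
      J.G (J.L (f i)) (J.DL (J.L (f i)) w)))) := by
    intro i
    rw [← a_mul_horizontal (J := J) w (f i)]
    ring
  have h3 : ∀ i, 2 * J.h w (J.B (J.P (e i)) (J.P (e i))) = J.a * (J.DG (J.L w) (J.P (e i))
      (J.P (e i)) + 2 * J.G (J.P (e i)) (J.DL (J.P (e i)) w)) := by
    intro i
    rw [J.h_B_vert_vert (J.Du_P (e i))]
    ring
  have h4 : ∑ i, 2 * J.h w (J.B (J.P (e i)) (J.P (e i))) = 0 := by
    rw [Finset.sum_congr rfl fun i _ => h3 i, ← Finset.mul_sum]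
    have h5 := Finset.sum_congr rfl fun i (_ : i ∈ (Finset.univ : Finset κ)) => h2 i
    rw [← Finset.mul_sum, ← Finset.mul_sum, ← Finset.mul_sum] at h5
    simp only [map_zero, Finset.sum_const_zero] at h1
    linarith
  rw [← Finset.mul_sum] at h4
  linarith

end ConformalJet

/-! ### Riemannian densities -/

section Density

variable {E : Type*} [NormedAddCommGroup E] [NormedSpace ℝ E] {ι : Type*} [Fintype ι]
  [DecidableEq ι]

theorem exists_isOrthonormalFor (b : Module.Basis ι ℝ E) {A : E →L[ℝ] E →L[ℝ] ℝ}
    (hs : ∀ v w, A v w = A w v) (hA : ∀ v, v ≠ 0 → 0 < A v v) :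
    ∃ e : Module.Basis ι ℝ E, IsOrthonormalFor A e := by
  have : FiniteDimensional ℝ E := b.finiteDimensional_of_finite
  let B : LinearMap.BilinForm ℝ E := LinearMap.mk₂ ℝ (fun v w => A v w) (by intros; simp)
    (by intros; simp) (by intros; simp) (by intros; simp)
  have hB : LinearMap.IsSymm B := ⟨fun v w => hs v w⟩
  obtain ⟨v, hv⟩ := LinearMap.BilinForm.exists_orthogonal_basis (B := B) hB
  have hpos : ∀ i, 0 < A (v i) (v i) := fun i => hA _ (v.ne_zero i)
  let v' := v.isUnitSMul (w := fun i => (√(A (v i) (v i)))⁻¹) fun i =>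
    (inv_ne_zero (Real.sqrt_pos.2 (hpos i)).ne').isUnit
  have hv' : IsOrthonormalFor A v' := by
    intro i j
    rw [Module.Basis.isUnitSMul_apply, Module.Basis.isUnitSMul_apply, map_smul, map_smul, smul_apply]
    split_ifs with h
    · subst h
      have h1 := Real.mul_self_sqrt (hpos i).le
      have h2 := (Real.sqrt_pos.2 (hpos i)).ne'
      rw [smul_eq_mul, smul_eq_mul]
      field_simp
      rw [sq, h1]
    · have h1 : A (v i) (v j) = 0 := hv h
      rw [h1, smul_zero, smul_zero]
  refine ⟨v'.reindex (v.indexEquiv b), fun i j => ?_⟩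
  rw [Module.Basis.reindex_apply, Module.Basis.reindex_apply, hv']
  simp

theorem IsOrthonormalFor.isParseval {A : E →L[ℝ] E →L[ℝ] ℝ} {e : Module.Basis ι ℝ E}
    (he : IsOrthonormalFor A e) : IsParseval A e := by
  intro v
  conv_rhs => rw [← e.sum_repr v]
  refine Finset.sum_congr rfl fun i _ => ?_
  have h1 := congrArg (fun w => A w (e i)) (e.sum_repr v)
  simp only [map_sum, sum_apply, map_smul, smul_apply, he _ _, smul_eq_mul, mul_ite, mul_one,
    mul_zero, Finset.sum_ite_eq', Finset.mem_univ, if_true] at h1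
  rw [h1]

/-- The Riemannian density of the inner product `A` with respect to the basis `b`. -/
noncomputable def density (b : Module.Basis ι ℝ E) (A : E →L[ℝ] E →L[ℝ] ℝ) : ℝ :=
  √(Matrix.det (Matrix.of fun i j => A (b i) (b j)))

theorem det_gram_pos (b : Module.Basis ι ℝ E) {A : E →L[ℝ] E →L[ℝ] ℝ}
    (hs : ∀ v w, A v w = A w v) (hA : ∀ v, v ≠ 0 → 0 < A v v) :
    0 < Matrix.det (Matrix.of fun i j => A (b i) (b j)) := by
  obtain ⟨e, he⟩ := exists_isOrthonormalFor b hs hA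
  rw [det_gram_eq he]
  have := (e.isUnit_det b).ne_zero
  positivity

theorem density_pos (b : Module.Basis ι ℝ E) {A : E →L[ℝ] E →L[ℝ] ℝ}
    (hs : ∀ v w, A v w = A w v) (hA : ∀ v, v ≠ 0 → 0 < A v v) : 0 < density b A :=
  Real.sqrt_pos.2 (det_gram_pos b hs hA)

theorem density_eq_abs_det (b : Module.Basis ι ℝ E) {A : E →L[ℝ] E →L[ℝ] ℝ}
    {e : Module.Basis ι ℝ E} (he : IsOrthonormalFor A e) : density b A = |e.det b| := by
  rw [density, det_gram_eq he, Real.sqrt_sq_eq_abs]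

/-- The transformation rule for densities. -/
theorem density_comp (b : Module.Basis ι ℝ E) {A A' : E →L[ℝ] E →L[ℝ] ℝ}
    (hs : ∀ v w, A v w = A w v) (hA : ∀ v, v ≠ 0 → 0 < A v v) (T : E →L[ℝ] E)
    (hT : ∀ v w, A' v w = A (T v) (T w)) : density b A' = |T.det| * density b A := by
  obtain ⟨e, he⟩ := exists_isOrthonormalFor b hs hA
  have h1 : (Matrix.of fun i j => A' (b i) (b j)) =
      Matrix.of fun i j => A ((⇑(T : E →ₗ[ℝ] E) ∘ b) i) ((⇑(T : E →ₗ[ℝ] E) ∘ b) j) := by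
    ext i j
    exact hT _ _
  rw [density_eq_abs_det b he, density, h1, det_gram_eq he, Real.sqrt_sq_eq_abs,
    Module.Basis.det_comp, abs_mul]

variable {V : Type*} [NormedAddCommGroup V] [NormedSpace ℝ V]

theorem contDiffAt_density (b : Module.Basis ι ℝ E) {n : WithTop ℕ∞} {G : V → E →L[ℝ] E →L[ℝ] ℝ}
    {y : V} (hs : ∀ v w, G y v w = G y w v) (hA : ∀ v, v ≠ 0 → 0 < G y v v)
    (hG : ContDiffAt ℝ n G y) : ContDiffAt ℝ n (fun z => density b (G z)) y := by
  refine ContDiffAt.sqrt ?_ (det_gram_pos b hs hA).ne'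
  simp only [Matrix.det_apply, Matrix.of_apply]
  refine ContDiffAt.sum fun σ _ => ContDiffAt.const_smul _ (contDiffAt_prod fun i _ => ?_)
  exact (hG.clm_apply contDiffAt_const).clm_apply contDiffAt_const

/-- The logarithmic derivative of the density is half the trace of the derivative of the metric. -/
theorem fderiv_density (b : Module.Basis ι ℝ E) {G : V → E →L[ℝ] E →L[ℝ] ℝ}
    {y : V} (hs : ∀ᶠ z in 𝓝 y, ∀ v w, G z v w = G z w v)
    (hA : ∀ᶠ z in 𝓝 y, ∀ v, v ≠ 0 → 0 < G z v v) (hG : DifferentiableAt ℝ G y)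
    {e : Module.Basis ι ℝ E} (he : IsOrthonormalFor (G y) e) (X : V) :
    fderiv ℝ (fun z => density b (G z)) y X =
      density b (G y) * (1 / 2 * ∑ i, fderiv ℝ G y X (e i) (e i)) := by
  have h1 := hasFDerivAt_det_of_eq_one (A := fun z => Matrix.of fun i j => G z (e i) (e j))
    (fun i j => fderiv_bilin_apply hG (e i) (e j)) (by
      ext i j; rw [Matrix.of_apply, he i j, Matrix.one_apply])
  have h2 := h1.sqrt (det_gram_pos e hs.self_of_nhds hA.self_of_nhds).ne'
  have h3 : (fun z => density b (G z)) =ᶠ[𝓝 y] fun z => |e.det b| * density e (G z) := by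
    filter_upwards [hs, hA] with z hz hz'
    obtain ⟨f, hf⟩ := exists_isOrthonormalFor b hz hz'
    rw [density_eq_abs_det b hf, density_eq_abs_det e hf, ← abs_mul, mul_comm,
      Module.Basis.det_mul_det]
  have h4 := (h2.const_mul |e.det b|).congr_of_eventuallyEq h3
  have h5 : (Matrix.of fun i j => G y (e i) (e j)).det = 1 := by
    rw [det_gram_eq he, e.det_self, one_pow]
  rw [h4.fderiv, h5, density_eq_abs_det b he, Real.sqrt_one]
  simp

end Density

/-! ### The Riemannian volume measure in a chart -/

section Volume

variable {m : ℕ} {M : Type*} [TopologicalSpace M] [ChartedSpace (EuclideanSpace ℝ (Fin m)) M]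

/-- The standard basis of Euclidean space. -/
noncomputable def stdBasis (m : ℕ) : Module.Basis (Fin m) ℝ (ℰ m) :=
  (EuclideanSpace.basisFun (Fin m) ℝ).toBasis

theorem stdBasis_apply (i : Fin m) : stdBasis m i = EuclideanSpace.single i (1 : ℝ) := by
  rw [stdBasis, OrthonormalBasis.coe_toBasis, EuclideanSpace.basisFun_apply]

theorem measurableSet_preimage_symm [MeasurableSpace M] [BorelSpace M] (x : M) {A : Set M}
    (hA : MeasurableSet A) :
    MeasurableSet ((extChartAt (𝓡 m) x).target ∩ (extChartAt (𝓡 m) x).symm ⁻¹' A) := by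
  have h1 := (continuousOn_iff_continuous_domRestrict.1
    (continuousOn_extChartAt_symm (I := 𝓡 m) x)).measurable hA
  have h2 := (isOpen_extChartAt_target (I := 𝓡 m) x).measurableSet.subtype_image h1
  convert h2 using 1
  ext y
  simp [and_comm]

theorem aemeasurable_symm [MeasurableSpace M] [BorelSpace M] (x : M) (f : ℰ m → ℝ≥0∞) :
    AEMeasurable (extChartAt (𝓡 m) x).symm
      ((((volume : Measure (ℰ m)).restrict (extChartAt (𝓡 m) x).target)).withDensity f) :=
  ((continuousOn_extChartAt_symm (I := 𝓡 m) x).aemeasurable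
    (isOpen_extChartAt_target (I := 𝓡 m) x).measurableSet).mono_ac
    (withDensity_absolutelyContinuous _ _)

variable [IsManifold (𝓡 m) ∞ M] [RiemannianBundle (fun x : M => TangentSpace (𝓡 m) x)]

theorem chartDensity_eq (x : M) (y : ℰ m) :
    chartDensity x y = density (stdBasis m) (metricInChart x y) := by
  simp only [density, stdBasis_apply]
  rfl

variable [MeasurableSpace M] [BorelSpace M]

theorem chartVolume_apply (x : M) {A : Set M} (hA : MeasurableSet A) :
    chartVolume (m := m) x A =
      ∫⁻ y in (extChartAt (𝓡 m) x).target ∩ (extChartAt (𝓡 m) x).symm ⁻¹' A,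
        ENNReal.ofReal (chartDensity x y) := by
  rw [chartVolume, Measure.map_apply_of_aemeasurable (aemeasurable_symm x _) hA,
    withDensity_apply', Measure.restrict_restrict'
      (isOpen_extChartAt_target (I := 𝓡 m) x).measurableSet, inter_comm]

/-- This is the change of variables formula for the transition map. As the statement is symmetric in
the two charts, their volume measures agree on the intersection of their domains. -/
theorem chartVolume_le {x x₀ : M} {A : Set M} (hA : MeasurableSet A)
    (hAs : A ⊆ (extChartAt (𝓡 m) x₀).source) :
    chartVolume (m := m) x A ≤ chartVolume (m := m) x₀ A := by
  rw [chartVolume_apply x hA, chartVolume_apply x₀ hA]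
  set s := (extChartAt (𝓡 m) x).target ∩ (extChartAt (𝓡 m) x).symm ⁻¹' A with hs
  have hsd : s ⊆ chartDomain m m (id : M → M) x x₀ := fun y hy => ⟨hy.1, hAs hy.2⟩
  have hsm : ContMDiff (𝓡 m) (𝓡 m) ∞ (id : M → M) := contMDiff_id
  set τ := mapInChart m m (id : M → M) x x₀ with hτ
  have hτs : ∀ y ∈ s, (extChartAt (𝓡 m) x₀).symm (τ y) = (extChartAt (𝓡 m) x).symm y :=
    fun y hy => (extChartAt (𝓡 m) x₀).left_inv (hAs hy.2)
  have hder : ∀ y ∈ s, HasFDerivWithinAt τ (fderiv ℝ τ y) s y := fun y hy =>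
    (((contDiffOn_mapInChart hsm).contDiffAt ((isOpen_chartDomain hsm).mem_nhds
      (hsd hy))).differentiableAt (by simp)).hasFDerivAt.hasFDerivWithinAt
  have hinj : InjOn τ s := fun y hy z hz h => by
    have h1 := hτs y hy
    rw [h, hτs z hz] at h1
    exact (extChartAt (𝓡 m) x).symm.injOn hy.1 hz.1 h1.symm
  have himg : τ '' s ⊆ (extChartAt (𝓡 m) x₀).target ∩ (extChartAt (𝓡 m) x₀).symm ⁻¹' A := by
    rintro _ ⟨y, hy, rfl⟩
    refine ⟨(extChartAt (𝓡 m) x₀).map_source (hAs hy.2), ?_⟩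
    rw [mem_preimage, hτs y hy]
    exact hy.2
  refine le_trans (le_of_eq ?_) (lintegral_mono_set himg)
  rw [lintegral_image_eq_lintegral_abs_det_fderiv_mul volume (measurableSet_preimage_symm x hA)
    hder hinj]
  refine setLIntegral_congr_fun (measurableSet_preimage_symm x hA) fun y hy => ?_
  have hty : τ y ∈ (extChartAt (𝓡 m) x₀).target :=
    (extChartAt (𝓡 m) x₀).map_source (hAs hy.2)
  rw [← ENNReal.ofReal_mul (abs_nonneg _), chartDensity_eq, chartDensity_eq,
    density_comp (stdBasis m) metricInChart_symm (metricInChart_pos hty) (fderiv ℝ τ y)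
      (A' := metricInChart x y) fun v w => ?_]
  rw [hτ, metricInChart_fderiv hsm (hsd hy), mfderiv_id, metricInChart_apply]
  rfl

/-- In the domain of a chart, the Riemannian volume is given by the Riemannian density. -/
theorem riemannianVolume_restrict_source (x₀ : M) :
    (riemannianVolume m M).restrict (extChartAt (𝓡 m) x₀).source =
      (chartVolume (m := m) x₀).restrict (extChartAt (𝓡 m) x₀).source := by
  have hms := (isOpen_extChartAt_source (I := 𝓡 m) x₀).measurableSet
  refine le_antisymm ?_ (Measure.restrict_mono le_rfl (le_iSup _ x₀))
  have h1 : riemannianVolume m M ≤ chartVolume (m := m) x₀ +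
      (riemannianVolume m M).restrict (extChartAt (𝓡 m) x₀).sourceᶜ := by
    refine iSup_le fun x => Measure.le_intro fun A hA _ => ?_
    rw [Measure.add_apply, Measure.restrict_apply hA, ← measure_inter_add_sdiff A hms]
    refine add_le_add ((chartVolume_le (hA.inter hms) inter_subset_right).trans
      (measure_mono inter_subset_left)) ?_
    exact Measure.le_iff'.1 (le_iSup (fun x : M => chartVolume (m := m) x) x) _
  refine Measure.le_intro fun A hA _ => ?_
  rw [Measure.restrict_apply hA, Measure.restrict_apply hA]
  refine (Measure.le_iff'.1 h1 _).trans ?_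
  rw [Measure.add_apply, Measure.restrict_apply (hA.inter hms), inter_assoc, inter_compl_self,
    inter_empty, measure_empty, add_zero]

variable [IsContMDiffRiemannianBundle (𝓡 m) ∞ (EuclideanSpace ℝ (Fin m))
      (fun x : M => TangentSpace (𝓡 m) x)] [T2Space M]

/-- The integral over a compact subset of the domain of a chart, in coordinates. -/
theorem setIntegral_riemannianVolume {x₀ : M} {K : Set (ℰ m)} (hK : IsCompact K)
    (hKs : K ⊆ (extChartAt (𝓡 m) x₀).target) {f : M → ℝ} {g : ℰ m → ℝ}
    (hfg : ∀ y ∈ K, f ((extChartAt (𝓡 m) x₀).symm y) = g y) (hg : ContinuousOn g K) :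
    ∫ x in (extChartAt (𝓡 m) x₀).symm '' K, f x ∂(riemannianVolume m M) =
      ∫ y in K, g y * density (stdBasis m) (metricInChart x₀ y) := by
  set φ := extChartAt (𝓡 m) x₀ with hφ
  have hKM : IsCompact (φ.symm '' K) :=
    hK.image_of_continuousOn ((continuousOn_extChartAt_symm x₀).mono hKs)
  have hsub : φ.symm '' K ⊆ φ.source := by
    rintro _ ⟨y, hy, rfl⟩
    exact φ.map_target (hKs hy)
  have hms := hKM.isClosed.measurableSet
  have hfc : ContinuousOn f (φ.symm '' K) := by
    have h1 : ContinuousOn (g ∘ φ) (φ.symm '' K) := by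
      refine hg.comp ((continuousOn_extChartAt x₀).mono hsub) ?_
      rintro _ ⟨y, hy, rfl⟩
      rwa [φ.right_inv (hKs hy)]
    refine h1.congr ?_
    rintro _ ⟨y, hy, rfl⟩
    rw [hfg y hy, Function.comp_apply, φ.right_inv (hKs hy)]
  have h1 : (riemannianVolume m M).restrict (φ.symm '' K) =
      (chartVolume (m := m) x₀).restrict (φ.symm '' K) := by
    rw [← Measure.restrict_restrict_of_subset hsub, riemannianVolume_restrict_source,
      Measure.restrict_restrict_of_subset hsub]
  have htm := (isOpen_extChartAt_target (I := 𝓡 m) x₀).measurableSet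
  have hpre : φ.symm ⁻¹' (φ.symm '' K) ∩ φ.target = K := by
    ext y
    constructor
    · rintro ⟨⟨z, hz, hzy⟩, hy⟩
      rwa [← φ.symm.injOn (hKs hz) hy hzy]
    · exact fun hy => ⟨mem_image_of_mem _ hy, hKs hy⟩
  have hae := aemeasurable_symm (m := m) x₀ fun y => ENNReal.ofReal (chartDensity x₀ y)
  rw [h1, chartVolume, Measure.restrict_map_of_aemeasurable hae hms]
  rw [integral_map (hae.mono_measure Measure.restrict_le_self)]
  · rw [restrict_withDensity', Measure.restrict_restrict' htm, hpre,
      integral_withDensity_eq_integral_toReal_smul₀]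
    · refine setIntegral_congr_fun hK.measurableSet fun y hy => ?_
      have hd : 0 ≤ density (stdBasis m) (metricInChart x₀ y) := Real.sqrt_nonneg _
      rw [chartDensity_eq, ENNReal.toReal_ofReal hd, smul_eq_mul, mul_comm, hfg y hy]
    · refine AEMeasurable.ennreal_ofReal (ContinuousOn.aemeasurable (fun y hy => ?_)
        hK.measurableSet)
      refine ContinuousWithinAt.congr ?_ (fun z _ => chartDensity_eq x₀ z) (chartDensity_eq x₀ y)
      exact (contDiffAt_density (stdBasis m) metricInChart_symm (metricInChart_pos (hKs hy))
        (contDiffAt_metricInChart (hKs hy))).continuousAt.continuousWithinAt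
    · exact ae_of_all _ fun _ => ENNReal.ofReal_lt_top
  · rw [← Measure.restrict_map_of_aemeasurable hae hms]
    exact hfc.aestronglyMeasurable hms

end Volume

/-! ### Integration on vector spaces -/

section Integration

variable {E : Type*} [NormedAddCommGroup E] [NormedSpace ℝ E]

/-- Differentiation under the integral sign, over a compact set. -/
theorem hasDerivAt_setIntegral [MeasurableSpace E] [BorelSpace E] {μ : Measure E}
    [IsFiniteMeasureOnCompacts μ] {K : Set E} (hK : IsCompact K) {Φ : ℝ × E → ℝ}
    (hΦ : ∀ y ∈ K, ContDiffAt ℝ 1 Φ (0, y)) :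
    HasDerivAt (fun s => ∫ y in K, Φ (s, y) ∂μ)
      (∫ y in K, deriv (fun s => Φ (s, y)) 0 ∂μ) 0 := by
  have hO : IsOpen {p | ContDiffAt ℝ 1 Φ p} := isOpen_iff_mem_nhds.2 fun p hp =>
    ContDiffAt.eventually hp (by simp)
  obtain ⟨u, v, hu, -, h0u, hKv, huv⟩ := generalized_tube_lemma (isCompact_singleton (x := (0 : ℝ)))
    hK hO (by rintro ⟨s, y⟩ ⟨hs, hy⟩; obtain rfl : s = 0 := hs; exact hΦ y hy)
  obtain ⟨ε, hε, hεu⟩ := Metric.nhds_basis_closedBall.mem_iff.1 (hu.mem_nhds (h0u rfl))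
  have hreg : ∀ s ∈ Metric.closedBall (0 : ℝ) ε, ∀ y ∈ K, ContDiffAt ℝ 1 Φ (s, y) :=
    fun s hs y hy => huv ⟨hεu hs, hKv hy⟩
  set D : ℝ × E → ℝ := fun p => fderiv ℝ Φ p (1, 0) with hD
  have hDc : ContinuousOn D (Metric.closedBall (0 : ℝ) ε ×ˢ K) := fun p hp =>
    (((hreg p.1 hp.1 p.2 hp.2).fderiv_right (m := 0) (by norm_num)).continuousAt.clm_apply
      continuousAt_const).continuousWithinAt
  obtain ⟨C, hC⟩ := ((isCompact_closedBall (0 : ℝ) ε).prod hK).exists_bound_of_continuousOn hDc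
  have hsl : ∀ s ∈ Metric.closedBall (0 : ℝ) ε, ContinuousOn (fun y => Φ (s, y)) K :=
    fun s hs y hy => ((hreg s hs y hy).continuousAt.comp
      (continuousAt_const.prodMk continuousAt_id)).continuousWithinAt
  have hder : ∀ s ∈ Metric.closedBall (0 : ℝ) ε, ∀ y ∈ K,
      HasDerivAt (fun s => Φ (s, y)) (D (s, y)) s := fun s hs y hy =>
    ((hreg s hs y hy).differentiableAt (by simp)).hasFDerivAt.comp_hasDerivAt s
      ((hasDerivAt_id s).prodMk (hasDerivAt_const s y))
  have h0 : (0 : ℝ) ∈ Metric.closedBall (0 : ℝ) ε := Metric.mem_closedBall_self hε.le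
  have hK' := hK.measurableSet
  have hD0 : ContinuousOn (fun y => D (0, y)) K :=
    hDc.comp (continuousOn_const.prodMk continuousOn_id) fun y hy => ⟨h0, hy⟩
  have key := hasDerivAt_integral_of_dominated_loc_of_deriv_le (μ := μ.restrict K)
    (F := fun s y => Φ (s, y)) (F' := fun s y => D (s, y)) (bound := fun _ => C)
    (Metric.closedBall_mem_nhds (0 : ℝ) hε)
    (by filter_upwards [Metric.closedBall_mem_nhds (0 : ℝ) hε] with s hs
        exact (hsl s hs).aestronglyMeasurable hK')
    ((hsl 0 h0).integrableOn_compact hK) (hD0.aestronglyMeasurable hK')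
    ((ae_restrict_iff' hK').2 (ae_of_all _ fun y hy s hs => hC (s, y) ⟨hs, hy⟩))
    (continuousOn_const.integrableOn_compact hK)
    ((ae_restrict_iff' hK').2 (ae_of_all _ fun y hy s hs => hder s hs y hy))
  have h3 : ∫ y in K, deriv (fun s => Φ (s, y)) 0 ∂μ = ∫ y in K, D (0, y) ∂μ :=
    setIntegral_congr_fun hK' fun y hy => (hder 0 h0 y hy).deriv
  rw [h3]
  exact key.2

/-- The divergence of a vector field. -/
noncomputable def divergence {ι : Type*} [Fintype ι] (b : Module.Basis ι ℝ E) (V : E → E) (y : E) :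
    ℝ := ∑ j, b.repr (fderiv ℝ V y (b j)) j

variable [FiniteDimensional ℝ E] [MeasurableSpace E] [BorelSpace E] {μ : Measure E}
  [μ.IsAddHaarMeasure]

/-- The divergence theorem for compactly supported vector fields. -/
theorem integral_divergence_eq_zero {ι : Type*} [Fintype ι] (b : Module.Basis ι ℝ E) {V : E → E}
    (hV : ContDiff ℝ 1 V) (hc : HasCompactSupport V) : ∫ y, divergence b V y ∂μ = 0 := by
  have hcomp : ∀ j, ∃ f : E → ℝ, ContDiff ℝ 1 f ∧ HasCompactSupport f ∧
      ∀ y v, fderiv ℝ f y v = b.repr (fderiv ℝ V y v) j := by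
    intro j
    refine ⟨fun y => LinearMap.toContinuousLinearMap (b.coord j) (V y),
      (LinearMap.toContinuousLinearMap (b.coord j)).contDiff.comp hV,
      hc.comp_left (map_zero _), fun y v => ?_⟩
    have h := (LinearMap.toContinuousLinearMap (b.coord j)).hasFDerivAt.comp y
      ((hV.differentiable (by simp)) y).hasFDerivAt
    exact congrArg (fun T : E →L[ℝ] ℝ => T v) h.fderiv
  choose f hf hfc hfd using hcomp
  have hint : ∀ j, Integrable (fun y => fderiv ℝ (f j) y (b j)) μ := fun j =>
    (((hf j).continuous_fderiv (by simp)).clm_apply continuous_const).integrable_of_hasCompactSupport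
      ((hfc j).fderiv_apply ℝ (b j))
  have h1 : ∀ j, ∫ y, fderiv ℝ (f j) y (b j) ∂μ = 0 := by
    intro j
    have h2 := integral_mul_fderiv_eq_neg_fderiv_mul_of_integrable (μ := μ) (𝕜 := ℝ) (f := fun _ => 1)
      (g := f j) (v := b j) (by simp) (by simpa using hint j)
      (by simpa using (hf j).continuous.integrable_of_hasCompactSupport (hfc j))
      (fun _ _ => differentiableAt_const _) (fun y _ => (hf j).differentiable (by simp) y)
    simpa using h2
  simp only [divergence, ← hfd]
  rw [integral_finsetSum _ fun j _ => hint j]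
  exact Finset.sum_eq_zero fun j _ => h1 j

/-- The divergence theorem for a compactly supported multiple of a vector field. -/
theorem integral_fderiv_add_mul_divergence {ι : Type*} [Fintype ι] (b : Module.Basis ι ℝ E)
    {Ω : Set E} (hΩ : IsOpen Ω) {V : E → E} (hV : ContDiffOn ℝ 1 V Ω) {η : E → ℝ}
    (hη : ContDiff ℝ ∞ η) (hc : HasCompactSupport η) (hs : tsupport η ⊆ Ω) :
    ∫ y, (fderiv ℝ η y (V y) + η y * divergence b V y) ∂μ = 0 := by
  have hV' : ∀ y ∈ tsupport η, ContDiffAt ℝ 1 V y := fun y hy =>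
    hV.contDiffAt (hΩ.mem_nhds (hs hy))
  have hη1 : ContDiff ℝ 1 η := hη.of_le (by norm_num)
  have hz : ∀ y ∉ tsupport η, (fun z => η z • V z) =ᶠ[𝓝 y] fun _ => 0 := fun y hy => by
    filter_upwards [notMem_tsupport_iff_eventuallyEq.1 hy] with z hz
    rw [hz, Pi.zero_apply, zero_smul]
  have h1 : ContDiff ℝ 1 fun y => η y • V y := contDiff_iff_contDiffAt.2 fun y => by
    by_cases hy : y ∈ tsupport η
    · exact hη1.contDiffAt.smul (hV' y hy)
    · exact contDiffAt_const.congr_of_eventuallyEq (hz y hy)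
  rw [← integral_divergence_eq_zero (μ := μ) b h1 hc.smul_right]
  refine integral_congr_ae (ae_of_all _ fun y => ?_)
  by_cases hy : y ∈ tsupport η
  · have h2 := ((hη1.differentiable (by simp)) y).hasFDerivAt.smul
      ((hV' y hy).differentiableAt (by simp)).hasFDerivAt
    have h3 : ∀ v, fderiv ℝ (fun y => η y • V y) y v =
        η y • fderiv ℝ V y v + fderiv ℝ η y v • V y := fun v =>
      congrArg (fun T : E →L[ℝ] E => T v) h2.fderiv
    have h4 := congrArg (fderiv ℝ η y) (b.sum_repr (V y))
    simp only [map_sum, map_smul, smul_eq_mul] at h4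
    simp only [divergence, h3, map_add, map_smul, Finsupp.add_apply, Finsupp.smul_apply,
      smul_eq_mul, Finset.sum_add_distrib, ← Finset.mul_sum]
    rw [← h4, add_comm]
    exact congrArg _ (Finset.sum_congr rfl fun j _ => mul_comm _ _)
  · have h2 := notMem_tsupport_iff_eventuallyEq.1 hy
    simp only [divergence, (hz y hy).fderiv_eq, h2.fderiv_eq, h2.self_of_nhds]
    simp

/-- The fundamental lemma of the calculus of variations. -/
theorem eq_zero_of_integral_mul_eq_zero {Ω : Set E} (hΩ : IsOpen Ω) {g : E → ℝ}
    (hg : ContinuousOn g Ω)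
    (h : ∀ η : E → ℝ, ContDiff ℝ ∞ η → HasCompactSupport η → tsupport η ⊆ Ω →
      ∫ y, η y * g y ∂μ = 0) {y : E} (hy : y ∈ Ω) : g y = 0 := by
  have h1 := hΩ.ae_eq_zero_of_integral_contDiff_smul_eq_zero (μ := μ)
    (hg.locallyIntegrableOn hΩ.measurableSet) h
  exact Measure.eqOn_open_of_ae_eq (μ := μ) ((ae_restrict_iff' hΩ.measurableSet).2 h1) hΩ hg
    continuousOn_const hy

end Integration

/-! ### The first variation of the energy -/

section TraceSmooth

variable {E F V : Type*} [NormedAddCommGroup E] [NormedSpace ℝ E] [FiniteDimensional ℝ E]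
  [NormedAddCommGroup F] [NormedSpace ℝ F] [NormedAddCommGroup V] [NormedSpace ℝ V]
  {ι : Type*} [Fintype ι]

theorem contDiffAt_traceForm (b : Module.Basis ι ℝ E) {n : WithTop ℕ∞} {A : V → E →L[ℝ] E →L[ℝ] ℝ}
    {k : V → F →L[ℝ] F →L[ℝ] ℝ} {T : V → E →L[ℝ] F} {p : V}
    (hpos : ∀ v, v ≠ 0 → 0 < A p v v) (hA : ContDiffAt ℝ n A p) (hk : ContDiffAt ℝ n k p)
    (hT : ContDiffAt ℝ n T p) :
    ContDiffAt ℝ n (fun q => traceForm b (A q) ((k q).bilinearComp (T q) (T q))) p := by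
  refine ContDiffAt.sum fun i _ => ?_
  exact (hk.clm_apply (hT.clm_apply contDiffAt_const)).clm_apply
    (hT.clm_apply ((contDiffAt_sharp hpos hA).clm_apply contDiffAt_const))

end TraceSmooth

namespace ConformalModel

variable {E F : Type*} [NormedAddCommGroup E] [NormedSpace ℝ E] [FiniteDimensional ℝ E]
  [NormedAddCommGroup F] [NormedSpace ℝ F] [FiniteDimensional ℝ F] {S : ConformalModel E F}
  {ι κ : Type*} [Fintype ι] {b : Module.Basis ι ℝ E} {η : E → ℝ} {w : F} {y : E} {s : ℝ}

/-- The energy density at `y` of the map `z ↦ u z + (s * η z) • w`. -/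
noncomputable def variedEnergy (S : ConformalModel E F) (b : Module.Basis ι ℝ E) (η : E → ℝ) (w : F)
    (p : ℝ × E) : ℝ :=
  1 / 2 * traceForm b (S.G p.2) ((S.h (S.u p.2 + (p.1 * η p.2) • w)).bilinearComp
    (fderiv ℝ S.u p.2 + p.1 • (fderiv ℝ η p.2).smulRight w)
    (fderiv ℝ S.u p.2 + p.1 • (fderiv ℝ η p.2).smulRight w))

/-- The trace of the Lie derivative of the metric of the target in the constant direction `w`. -/
noncomputable def traceDh (S : ConformalModel E F) (b : Module.Basis ι ℝ E) (w : F) (y : E) : ℝ :=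
  traceForm b (S.G y) ((fderiv ℝ S.h (S.u y) w).bilinearComp (fderiv ℝ S.u y) (fderiv ℝ S.u y))

theorem contDiffAt_variedEnergy (hη : ContDiff ℝ ∞ η) (hy : y ∈ S.Ω)
    (hs : S.u y + (s * η y) • w ∈ S.Ω') : ContDiffAt ℝ ∞ (S.variedEnergy b η w) (s, y) := by
  have h2 : ContDiffAt ℝ ∞ (Prod.snd : ℝ × E → E) (s, y) := contDiffAt_snd
  have h1 : ContDiffAt ℝ ∞ (Prod.fst : ℝ × E → ℝ) (s, y) := contDiffAt_fst
  have hη' : ContDiffAt ℝ ∞ (fun p : ℝ × E => η p.2) (s, y) := hη.contDiffAt.comp (s, y) h2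
  have hDη : ContDiffAt ℝ ∞ (fun p : ℝ × E => fderiv ℝ η p.2) (s, y) :=
    ContDiffAt.comp (s, y) (hη.contDiffAt.fderiv_right le_rfl) h2
  have hc : ContDiffAt ℝ ∞ (fun p : ℝ × E => S.u p.2 + (p.1 * η p.2) • w) (s, y) :=
    (ContDiffAt.comp (s, y) (contDiffAt_u hy) h2).add ((h1.mul hη').smul contDiffAt_const)
  have hh : ContDiffAt ℝ ∞ S.h (S.u y + (s * η y) • w) :=
    S.h_smooth.contDiffAt (S.isOpen'.mem_nhds hs)
  exact contDiffAt_const.mul (contDiffAt_traceForm b (S.G_pos y hy)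
    (ContDiffAt.comp (s, y) (contDiffAt_G hy) h2) (ContDiffAt.comp (s, y) hh hc)
    ((ContDiffAt.comp (s, y) (contDiffAt_fderiv_u hy) h2).add
      (h1.smul (hDη.smulRight contDiffAt_const))))

theorem variedEnergy_eq_sum (hy : y ∈ S.Ω) {ι' : Type*} [Fintype ι'] {e : ι' → E}
    (he : IsParseval (S.G y) e) : S.variedEnergy b η w (s, y) =
      1 / 2 * ∑ i, S.h (S.u y + (s * η y) • w) (fderiv ℝ S.u y (e i) + (s * fderiv ℝ η y (e i)) • w)
        (fderiv ℝ S.u y (e i) + (s * fderiv ℝ η y (e i)) • w) := by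
  rw [variedEnergy, traceForm_eq_sum b (S.G_pos y hy) _ he]
  simp only [ContinuousLinearMap.bilinearComp_apply, add_apply, smul_apply,
    ContinuousLinearMap.smulRight_apply, smul_smul]

/-- The energy density of a horizontally conformal map is `n * λ ^ 2 / 2`. -/
theorem variedEnergy_zero [Fintype κ] (c : Module.Basis κ ℝ F) (hy : y ∈ S.Ω) :
    S.variedEnergy b η w (0, y) = 1 / 2 * (Fintype.card κ * S.a y) := by
  classical
  obtain ⟨e, he⟩ := exists_isOrthonormalFor b (S.G_symm y hy) (S.G_pos y hy)
  obtain ⟨f, hf⟩ := exists_isOrthonormalFor c (S.h_symm _ (S.mapsTo hy)) (S.h_pos _ (S.mapsTo hy))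
  have h1 : ∑ i, S.h (S.u y) (fderiv ℝ S.u y (e i)) (fderiv ℝ S.u y (e i)) =
      Fintype.card κ * S.a y := ConformalJet.sum_h_Du (J := S.jet y hy) he.isParseval hf
  rw [variedEnergy_eq_sum hy he.isParseval, ← h1]
  simp only [zero_mul, zero_smul, add_zero]

theorem traceDh_eq_sum (hy : y ∈ S.Ω) {ι' : Type*} [Fintype ι'] {e : ι' → E}
    (he : IsParseval (S.G y) e) : S.traceDh b w y =
      ∑ i, fderiv ℝ S.h (S.u y) w (fderiv ℝ S.u y (e i)) (fderiv ℝ S.u y (e i)) :=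
  traceForm_eq_sum b (S.G_pos y hy) _ he

/-- The first variation of the energy density. -/
theorem hasDerivAt_variedEnergy (hy : y ∈ S.Ω) :
    HasDerivAt (fun s => S.variedEnergy b η w (s, y))
      (1 / 2 * η y * S.traceDh b w y + S.a y * fderiv ℝ η y (S.L y w)) 0 := by
  classical
  obtain ⟨e, he⟩ := exists_isOrthonormalFor b (S.G_symm y hy) (S.G_pos y hy)
  have hc : HasDerivAt (fun s : ℝ => S.u y + (s * η y) • w) (η y • w) 0 := by
    simpa using (((hasDerivAt_id (0 : ℝ)).mul_const (η y)).smul_const w).const_add (S.u y)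
  have hT : ∀ i, HasDerivAt (fun s : ℝ => fderiv ℝ S.u y (e i) + (s * fderiv ℝ η y (e i)) • w)
      (fderiv ℝ η y (e i) • w) 0 := fun i => by
    simpa using (((hasDerivAt_id (0 : ℝ)).mul_const (fderiv ℝ η y (e i))).smul_const w).const_add
      (fderiv ℝ S.u y (e i))
  have hh : HasFDerivAt S.h (fderiv ℝ S.h (S.u y))
      ((fun s : ℝ => S.u y + (s * η y) • w) 0) := by
    simp only [zero_mul, zero_smul, add_zero]
    exact ((contDiffAt_h hy).differentiableAt (by simp)).hasFDerivAt
  have hk : HasDerivAt (fun s : ℝ => S.h (S.u y + (s * η y) • w))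
      (fderiv ℝ S.h (S.u y) (η y • w)) 0 :=
    HasFDerivAt.comp_hasDerivAt (l := S.h) (f := fun s : ℝ => S.u y + (s * η y) • w) (0 : ℝ) hh hc
  have h1 := (HasDerivAt.fun_sum fun i (_ : i ∈ Finset.univ) =>
    (hk.clm_apply (hT i)).clm_apply (hT i)).const_mul (1 / 2 : ℝ)
  refine (h1.congr_of_eventuallyEq (Eventually.of_forall fun s =>
    variedEnergy_eq_sum hy he.isParseval)).congr_deriv ?_
  have h2 : S.a y * fderiv ℝ η y (S.L y w) =
      ∑ i, fderiv ℝ η y (e i) * S.h (S.u y) w (fderiv ℝ S.u y (e i)) := by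
    have h3 := congrArg (fderiv ℝ η y) (he.isParseval (S.L y w))
    simp only [map_sum, map_smul, smul_eq_mul] at h3
    rw [← h3, Finset.mul_sum]
    refine Finset.sum_congr rfl fun i _ => ?_
    rw [← adj hy]
    ring
  rw [h2, traceDh_eq_sum hy he.isParseval, Finset.mul_sum, Finset.mul_sum, ← Finset.sum_add_distrib]
  refine Finset.sum_congr rfl fun i _ => ?_
  simp only [zero_mul, zero_smul, add_zero, ContinuousLinearMap.map_smul, smul_apply, add_apply,
    smul_eq_mul]
  rw [S.h_symm _ (S.mapsTo hy) (fderiv ℝ S.u y (e i)) w]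
  ring

/-- The first variation of the `Fe`-energy. -/
theorem hasDerivAt_energy [Fintype κ] [DecidableEq ι] [MeasurableSpace E] [BorelSpace E] {μ : Measure E}
    [IsFiniteMeasureOnCompacts μ] {Fe : ℝ → ℝ} (hF : IsEnergyFunction Fe)
    (c : Module.Basis κ ℝ F) (hκ : 0 < Fintype.card κ) (hη : ContDiff ℝ ∞ η) {K : Set E}
    (hK : IsCompact K) (hKΩ : K ⊆ S.Ω) :
    HasDerivAt (fun s => ∫ y in K, Fe (S.variedEnergy b η w (s, y)) * density b (S.G y) ∂μ)
      (∫ y in K, deriv Fe (1 / 2 * (Fintype.card κ * S.a y)) *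
        (1 / 2 * η y * S.traceDh b w y + S.a y * fderiv ℝ η y (S.L y w)) *
          density b (S.G y) ∂μ) 0 := by
  have hpos : ∀ y ∈ S.Ω, 0 < 1 / 2 * (Fintype.card κ * S.a y) := fun y hy => by
    have := S.a_pos y hy
    have : (0 : ℝ) < Fintype.card κ := Nat.cast_pos.2 hκ
    positivity
  have hFc : ∀ y ∈ S.Ω, ContDiffAt ℝ 2 Fe (S.variedEnergy b η w (0, y)) := fun y hy => by
    rw [variedEnergy_zero c hy]
    exact hF.contDiffOn.contDiffAt (isOpen_Ioi.mem_nhds (hpos y hy))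
  have h1 := hasDerivAt_setIntegral (μ := μ) hK
    (Φ := fun p => Fe (S.variedEnergy b η w p) * density b (S.G p.2)) fun y hyK => by
      have hy := hKΩ hyK
      have hE := contDiffAt_variedEnergy (b := b) (w := w) (s := 0) hη hy (by
        rw [zero_mul, zero_smul, add_zero]; exact S.mapsTo hy)
      have hD : ContDiffAt ℝ ∞ (fun p : ℝ × E => density b (S.G p.2)) (0, y) :=
        ContDiffAt.comp (g := fun z => density b (S.G z)) (0, y) (contDiffAt_density b (S.G_symm y hy) (S.G_pos y hy)
          (contDiffAt_G hy)) contDiffAt_snd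
      exact (((hFc y hy).of_le (by norm_num)).comp (0, y) (hE.of_le (by norm_num))).mul
        (hD.of_le (by norm_num))
  refine h1.congr_deriv (setIntegral_congr_fun hK.measurableSet fun y hyK => ?_)
  have hy := hKΩ hyK
  have h2 := (((hFc y hy).differentiableAt (by simp)).hasDerivAt.comp (0 : ℝ)
    (hasDerivAt_variedEnergy (b := b) (η := η) (w := w) hy)).mul_const (density b (S.G y))
  rw [variedEnergy_zero c hy] at h2
  exact h2.deriv

/-- Stationary models have minimal fibres. -/
theorem hasMinimalFibres_of_stationary {ι : Type} [Fintype ι] [DecidableEq ι]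
    {b : Module.Basis ι ℝ E} [Fintype κ] [MeasurableSpace E] [BorelSpace E]
    {μ : Measure E} [μ.IsAddHaarMeasure] {Fe : ℝ → ℝ} (hF : IsEnergyFunction Fe)
    (c : Module.Basis κ ℝ F) (hκ : 0 < Fintype.card κ)
    (hst : ∀ (η : E → ℝ) (w : F), ContDiff ℝ ∞ η → HasCompactSupport η → tsupport η ⊆ S.Ω →
      ∫ y in tsupport η, deriv Fe (1 / 2 * (Fintype.card κ * S.a y)) *
        (1 / 2 * η y * S.traceDh b w y + S.a y * fderiv ℝ η y (S.L y w)) *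
          density b (S.G y) ∂μ = 0) : S.HasMinimalFibres := by
  classical
  intro y hy
  obtain ⟨e, he⟩ := exists_isOrthonormalFor b (S.G_symm y hy) (S.G_pos y hy)
  obtain ⟨f, hf⟩ := exists_isOrthonormalFor c (S.h_symm _ (S.mapsTo hy)) (S.h_pos _ (S.mapsTo hy))
  refine ⟨ι, inferInstance, e, he.isParseval,
    ConformalJet.sum_B_eq_zero_of_trace (J := S.jet y hy) he.isParseval hf fun w => ?_⟩
  have hcard : (0 : ℝ) < Fintype.card κ := Nat.cast_pos.2 hκ
  have hpos : ∀ t : ℝ, 0 < t → 0 < 1 / 2 * (Fintype.card κ * t) := fun t ht => by positivity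
  set ψ : ℝ → ℝ := fun t => deriv Fe (1 / 2 * (Fintype.card κ * t)) with hψ
  set ρ : E → ℝ := fun z => density b (S.G z) with hρ
  have hψc : ∀ z ∈ S.Ω, ContDiffAt ℝ 1 ψ (S.a z) := fun z hz => by
    have h1 : ContDiffOn ℝ 1 (deriv Fe) (Ioi 0) :=
      hF.contDiffOn.deriv_of_isOpen isOpen_Ioi (by norm_num)
    exact (h1.contDiffAt (isOpen_Ioi.mem_nhds (hpos _ (S.a_pos z hz)))).comp (S.a z)
      (contDiffAt_const.mul (contDiffAt_const.mul contDiffAt_id))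
  have hac : ∀ z ∈ S.Ω, ContDiffAt ℝ 1 S.a z := fun z hz => (contDiffAt_a hz).of_le (by norm_num)
  have hρc : ∀ z ∈ S.Ω, ContDiffAt ℝ 1 ρ z := fun z hz =>
    (contDiffAt_density b (S.G_symm z hz) (S.G_pos z hz) (contDiffAt_G hz)).of_le (by norm_num)
  have hLc : ∀ z ∈ S.Ω, ContDiffAt ℝ 1 (fun z => S.L z w) z := fun z hz =>
    (contDiffAt_L hz).of_le (by norm_num) |>.clm_apply contDiffAt_const
  have htc : ∀ z ∈ S.Ω, ContDiffAt ℝ 1 (S.traceDh b w) z := fun z hz => by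
    have h1 : ContDiffAt ℝ ∞ (fun z => fderiv ℝ S.h (S.u z) w) z :=
      (((contDiffAt_h hz).fderiv_right le_rfl).comp z (contDiffAt_u hz)).clm_apply contDiffAt_const
    exact (contDiffAt_traceForm b (S.G_pos z hz) (contDiffAt_G hz) h1
      (contDiffAt_fderiv_u hz)).of_le (by norm_num)
  -- the factor of `ρ` is a function of the dilation, so it is constant in horizontal directions
  set τ : E → ℝ := fun z => ψ (S.a z) * S.a z with hτ
  have hτc : ∀ z ∈ S.Ω, ContDiffAt ℝ 1 τ z := fun z hz =>
    ((hψc z hz).comp z (hac z hz)).mul (hac z hz)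
  set V : E → E := fun z => (τ z * ρ z) • S.L z w with hV
  have hVc : ∀ z ∈ S.Ω, ContDiffAt ℝ 1 V z := fun z hz =>
    ((hτc z hz).mul (hρc z hz)).smul (hLc z hz)
  have hVon : ContDiffOn ℝ 1 V S.Ω := fun z hz => (hVc z hz).contDiffWithinAt
  have hdc : ContinuousOn (divergence b V) S.Ω := fun z hz => by
    refine ContinuousAt.continuousWithinAt (tendsto_finsetSum _ fun j _ => ?_)
    have h1 := (((hVc z hz).fderiv_right (m := 0) (by norm_num)).continuousAt).clm_apply
      (continuousAt_const (y := b j))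
    exact ((LinearMap.toContinuousLinearMap (b.coord j)).continuous.continuousAt).comp h1
  have hqc : ContinuousOn (fun z => 1 / 2 * ψ (S.a z) * S.traceDh b w z * ρ z) S.Ω := fun z hz =>
    (((((contDiffAt_const.mul ((hψc z hz).comp z (hac z hz))).mul (htc z hz)).mul
      (hρc z hz)).continuousAt)).continuousWithinAt
  have key : 1 / 2 * ψ (S.a y) * S.traceDh b w y * ρ y - divergence b V y = 0 := by
    refine eq_zero_of_integral_mul_eq_zero (μ := μ) S.isOpen
      (g := fun z => 1 / 2 * ψ (S.a z) * S.traceDh b w z * ρ z - divergence b V z)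
      (hqc.sub hdc) (fun η hη hηc hηs => ?_) hy
    have h1 := integral_fderiv_add_mul_divergence (μ := μ) b S.isOpen hVon hη hηc hηs
    have h2 := hst η w hη hηc hηs
    have hz : ∀ z ∉ tsupport η, η z = 0 := fun z hz => image_eq_zero_of_notMem_tsupport hz
    have hz' : ∀ z ∉ tsupport η, fderiv ℝ η z = 0 := fun z hz => by
      rw [(notMem_tsupport_iff_eventuallyEq.1 hz).fderiv_eq]
      exact fderiv_const_apply 0
    rw [← setIntegral_eq_integral_of_forall_compl_eq_zero (s := tsupport η) fun z hzη => by
      rw [hz z hzη, hz' z hzη]; simp] at h1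
    rw [← setIntegral_eq_integral_of_forall_compl_eq_zero (s := tsupport η) fun z hzη => by
      rw [hz z hzη, zero_mul]]
    have hi1 : IntegrableOn (fun z => η z * (1 / 2 * ψ (S.a z) * S.traceDh b w z * ρ z -
        divergence b V z)) (tsupport η) μ :=
      (hη.continuous.continuousOn.mul ((hqc.sub hdc).mono hηs)).integrableOn_compact hηc
    have hi2 : IntegrableOn (fun z => fderiv ℝ η z (V z) + η z * divergence b V z)
        (tsupport η) μ :=
      (((hη.continuous_fderiv (by simp)).continuousOn.clm_apply (hVon.continuousOn.mono hηs)).add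
        (hη.continuous.continuousOn.mul (hdc.mono hηs))).integrableOn_compact hηc
    have h3 := integral_add hi1 hi2
    rw [h1, add_zero] at h3
    rw [← h3, ← h2]
    refine setIntegral_congr_fun hηc.measurableSet fun z _ => ?_
    simp only [hV, hτ, map_smul, smul_eq_mul, hψ, hρ]
    ring
  have hdiv : divergence b V y = τ y * ρ y * (∑ i, S.G y (e i) (fderiv ℝ S.L y (e i) w) +
      1 / 2 * ∑ i, fderiv ℝ S.G y (S.L y w) (e i) (e i)) := by
    have hψd := ((hψc y hy).differentiableAt (by simp)).hasDerivAt
    have had := ((hac y hy).differentiableAt (by simp)).hasFDerivAt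
    have hτd := ((hτc y hy).differentiableAt (by simp)).hasFDerivAt
    have hρd := ((hρc y hy).differentiableAt (by simp)).hasFDerivAt
    have hLd := ((contDiffAt_L hy).differentiableAt (by simp)).hasFDerivAt.clm_apply
      (hasFDerivAt_const w y)
    have hτL : fderiv ℝ τ y (S.L y w) = 0 := by
      have h1 : HasFDerivAt τ _ y := (hψd.comp_hasFDerivAt y had).mul had
      rw [h1.fderiv]
      simp [fderiv_a_L hy]
    have h1 : HasFDerivAt (fun z => τ z * ρ z) (τ y • fderiv ℝ ρ y + ρ y • fderiv ℝ τ y) y :=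
      hτd.mul hρd
    have h2 : HasFDerivAt V _ y := h1.smul hLd
    have h3 : ∀ X, fderiv ℝ V y X = (τ y * ρ y) • fderiv ℝ S.L y X w +
        fderiv ℝ (fun z => τ z * ρ z) y X • S.L y w := fun X => by
      rw [h2.fderiv, h1.fderiv]
      simp
    have h5 : fderiv ℝ (fun z => τ z * ρ z) y (S.L y w) = τ y * fderiv ℝ ρ y (S.L y w) := by
      rw [h1.fderiv]
      simp [hτL]
    have h7 : fderiv ℝ ρ y (S.L y w) = ρ y * (1 / 2 * ∑ i, fderiv ℝ S.G y (S.L y w) (e i) (e i)) := by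
      refine fderiv_density b ?_ ?_ ((contDiffAt_G hy).differentiableAt (by simp)) he _
      · filter_upwards [S.isOpen.mem_nhds hy] with z hz using S.G_symm z hz
      · filter_upwards [S.isOpen.mem_nhds hy] with z hz using S.G_pos z hz
    have h8 := sum_repr_eq_sum_parseval b (S.G_symm y hy) ((fderiv ℝ S.L y).flip w) he.isParseval
    have h9 := congrArg (fderiv ℝ (fun z => τ z * ρ z) y) (b.sum_repr (S.L y w))
    simp only [map_sum, map_smul, smul_eq_mul] at h9
    simp only [ContinuousLinearMap.flip_apply] at h8
    simp only [divergence, h3, map_add, map_smul, Finsupp.add_apply, Finsupp.smul_apply,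
      smul_eq_mul, Finset.sum_add_distrib, ← Finset.mul_sum]
    rw [h8, Finset.sum_congr rfl fun j _ => mul_comm _ _, h9, h5, h7]
    ring
  rw [hdiv, traceDh_eq_sum hy he.isParseval] at key
  have hψ0 : 0 < ψ (S.a y) := hF.deriv_pos _ (hpos _ (S.a_pos y hy))
  have hρ0 : 0 < ρ y := density_pos b (S.G_symm y hy) (S.G_pos y hy)
  have h10 : (1 / 2 * ψ (S.a y) * ρ y) * (∑ i, fderiv ℝ S.h (S.u y) w (fderiv ℝ S.u y (e i))
      (fderiv ℝ S.u y (e i)) - S.a y * ∑ i, (fderiv ℝ S.G y (S.L y w) (e i) (e i) +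
        2 * S.G y (e i) (fderiv ℝ S.L y (e i) w))) = 0 := by
    rw [Finset.sum_add_distrib, ← Finset.mul_sum, ← key]
    simp only [hτ]
    ring
  exact sub_eq_zero.1 ((mul_eq_zero.1 h10).resolve_left (by positivity))

end ConformalModel

/-! ### Variations supported in a chart -/

namespace ConformalModel

variable {E F : Type*} [NormedAddCommGroup E] [NormedSpace ℝ E]
  [NormedAddCommGroup F] [NormedSpace ℝ F] {S : ConformalModel E F} {η : E → ℝ}

/-- Small variations supported in a compact set stay in the domain of the target. -/
theorem exists_variation_mem (hη : Continuous η) (hc : HasCompactSupport η)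
    (hs : tsupport η ⊆ S.Ω) (w : F) :
    ∃ ε > 0, ∀ s : ℝ, |s| ≤ ε → ∀ y ∈ S.Ω, S.u y + (s * η y) • w ∈ S.Ω' := by
  have hcont : ContinuousOn (fun p : ℝ × E => S.u p.2 + (p.1 * η p.2) • w) (univ ×ˢ S.Ω) :=
    (S.u_smooth.continuousOn.comp continuousOn_snd fun p hp => hp.2).add
      ((continuous_fst.mul (hη.comp continuous_snd)).smul continuous_const).continuousOn
  have hO := hcont.isOpen_inter_preimage (isOpen_univ.prod S.isOpen) S.isOpen'
  obtain ⟨v, v', hv, -, h0v, hKv, hvv⟩ := generalized_tube_lemma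
    (isCompact_singleton (x := (0 : ℝ))) hc hO (by
      rintro ⟨s, y⟩ ⟨hs0, hy⟩
      obtain rfl : s = 0 := hs0
      refine ⟨⟨mem_univ _, hs hy⟩, ?_⟩
      simpa using S.mapsTo (hs hy))
  obtain ⟨ε, hε, hεv⟩ := Metric.nhds_basis_closedBall.mem_iff.1 (hv.mem_nhds (h0v rfl))
  refine ⟨ε, hε, fun s hsε y hy => ?_⟩
  by_cases hyη : y ∈ tsupport η
  · have hmem : (s, y) ∈ v ×ˢ v' := ⟨hεv (mem_closedBall_zero_iff.2 hsε), hKv hyη⟩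
    exact (hvv hmem).2
  · rw [image_eq_zero_of_notMem_tsupport hyη, mul_zero, zero_smul, add_zero]
    exact S.mapsTo hy

end ConformalModel

section Variation

variable {m n : ℕ}
  {M : Type*} [TopologicalSpace M] [ChartedSpace (EuclideanSpace ℝ (Fin m)) M]
  {N : Type*} [TopologicalSpace N] [ChartedSpace (EuclideanSpace ℝ (Fin n)) N]
  {u : M → N} {x₀ : M} {z₀ : N} {y : ℰ m}

open Classical in
/-- The variation of `u` which, read in charts, is `û + (σ t * η) • w`. -/
noncomputable def chartVariation (u : M → N) (x₀ : M) (z₀ : N) (σ : ℝ → ℝ) (η : ℰ m → ℝ) (w : ℰ n)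
    (p : ℝ × M) : N :=
  if p.2 ∈ (extChartAt (𝓡 m) x₀).source ∩ u ⁻¹' (extChartAt (𝓡 n) z₀).source then
    (extChartAt (𝓡 n) z₀).symm
      (extChartAt (𝓡 n) z₀ (u p.2) + (σ p.1 * η (extChartAt (𝓡 m) x₀ p.2)) • w)
  else u p.2

variable {σ : ℝ → ℝ} {η : ℰ m → ℝ} {w : ℰ n}

theorem chartVariation_of_mul_eq_zero {p : ℝ × M}
    (h : p.2 ∈ (extChartAt (𝓡 m) x₀).source → σ p.1 * η (extChartAt (𝓡 m) x₀ p.2) = 0) :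
    chartVariation u x₀ z₀ σ η w p = u p.2 := by
  rw [chartVariation]
  split_ifs with hp
  · rw [h hp.1, zero_smul, add_zero, (extChartAt (𝓡 n) z₀).left_inv hp.2]
  · rfl

theorem chartVariation_of_notMem {p : ℝ × M}
    (hp : p.2 ∉ (extChartAt (𝓡 m) x₀).symm '' tsupport η) :
    chartVariation u x₀ z₀ σ η w p = u p.2 := by
  refine chartVariation_of_mul_eq_zero fun hps => ?_
  rw [image_eq_zero_of_notMem_tsupport fun h => hp ⟨_, h, (extChartAt (𝓡 m) x₀).left_inv hps⟩,
    mul_zero]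

theorem chartVariation_symm (hy : y ∈ chartDomain m n u x₀ z₀) (t : ℝ) :
    chartVariation u x₀ z₀ σ η w (t, (extChartAt (𝓡 m) x₀).symm y) =
      (extChartAt (𝓡 n) z₀).symm (mapInChart m n u x₀ z₀ y + (σ t * η y) • w) := by
  rw [chartVariation, if_pos ⟨(extChartAt (𝓡 m) x₀).map_target hy.1, hy.2⟩]
  simp only
  rw [(extChartAt (𝓡 m) x₀).right_inv hy.1]
  rfl

theorem mapInChart_chartVariation (hy : y ∈ chartDomain m n u x₀ z₀) {t : ℝ}
    (ht : mapInChart m n u x₀ z₀ y + (σ t * η y) • w ∈ (extChartAt (𝓡 n) z₀).target) :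
    mapInChart m n (fun x => chartVariation u x₀ z₀ σ η w (t, x)) x₀ z₀ y =
      mapInChart m n u x₀ z₀ y + (σ t * η y) • w := by
  rw [mapInChart, chartVariation_symm hy, (extChartAt (𝓡 n) z₀).right_inv ht]

variable [IsManifold (𝓡 m) ∞ M] [IsManifold (𝓡 n) ∞ N]

/-- The variation is smooth because near a point outside the image of the support of `η` it is equal
to `u`; the image of the support is closed as `M` is Hausdorff. -/
theorem contMDiff_chartVariation [T2Space M] (hu : ContMDiff (𝓡 m) (𝓡 n) ∞ u)
    (hσ : ContDiff ℝ ∞ σ) (hη : ContDiff ℝ ∞ η) (hc : HasCompactSupport η)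
    (hs : tsupport η ⊆ chartDomain m n u x₀ z₀)
    (ht : ∀ t, ∀ y ∈ chartDomain m n u x₀ z₀,
      mapInChart m n u x₀ z₀ y + (σ t * η y) • w ∈ (extChartAt (𝓡 n) z₀).target) :
    ContMDiff (𝓘(ℝ, ℝ).prod (𝓡 m)) (𝓡 n) ∞ (chartVariation u x₀ z₀ σ η w) := by
  intro p
  have hst : tsupport η ⊆ (extChartAt (𝓡 m) x₀).target := hs.trans inter_subset_left
  have hK : IsCompact ((extChartAt (𝓡 m) x₀).symm '' tsupport η) :=
    hc.isCompact.image_of_continuousOn ((continuousOn_extChartAt_symm x₀).mono hst)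
  have hsnd : ContMDiffAt (𝓘(ℝ, ℝ).prod (𝓡 m)) (𝓡 m) ∞ (Prod.snd : ℝ × M → M) p :=
    contMDiffAt_snd
  have hfst : ContMDiffAt (𝓘(ℝ, ℝ).prod (𝓡 m)) 𝓘(ℝ, ℝ) ∞ (Prod.fst : ℝ × M → ℝ) p :=
    contMDiffAt_fst
  by_cases hp : p.2 ∈ (extChartAt (𝓡 m) x₀).source ∩ u ⁻¹' (extChartAt (𝓡 n) z₀).source
  · have hopen : IsOpen ((extChartAt (𝓡 m) x₀).source ∩ u ⁻¹' (extChartAt (𝓡 n) z₀).source) :=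
      (isOpen_extChartAt_source x₀).inter ((isOpen_extChartAt_source z₀).preimage hu.continuous)
    have h1 : ContMDiffAt (𝓡 m) (𝓡 m) ∞ (extChartAt (𝓡 m) x₀) p.2 :=
      contMDiffAt_extChartAt' (by rw [← extChartAt_source (𝓡 m)]; exact hp.1)
    have h2 : ContMDiffAt (𝓡 n) (𝓡 n) ∞ (extChartAt (𝓡 n) z₀) (u p.2) :=
      contMDiffAt_extChartAt' (by rw [← extChartAt_source (𝓡 n)]; exact hp.2)
    have h3 : ContMDiffAt (𝓘(ℝ, ℝ).prod (𝓡 m)) (𝓡 n) ∞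
        (fun p : ℝ × M => extChartAt (𝓡 n) z₀ (u p.2)) p :=
      ContMDiffAt.comp p h2 ((hu p.2).comp p hsnd)
    have h4 : ContMDiffAt (𝓘(ℝ, ℝ).prod (𝓡 m)) 𝓘(ℝ, ℝ) ∞
        (fun p : ℝ × M => η (extChartAt (𝓡 m) x₀ p.2)) p :=
      ContMDiffAt.comp p hη.contMDiff.contMDiffAt (ContMDiffAt.comp p h1 hsnd)
    have h5 : ContMDiffAt (𝓘(ℝ, ℝ).prod (𝓡 m)) 𝓘(ℝ, ℝ) ∞ (fun p : ℝ × M => σ p.1) p :=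
      ContMDiffAt.comp p hσ.contMDiff.contMDiffAt hfst
    have h6 : ContMDiffAt (𝓘(ℝ, ℝ).prod (𝓡 m)) (𝓡 n) ∞ (fun p : ℝ × M =>
        extChartAt (𝓡 n) z₀ (u p.2) + (σ p.1 * η (extChartAt (𝓡 m) x₀ p.2)) • w) p :=
      h3.add (ContMDiffAt.smul (h5.mul h4) contMDiffAt_const)
    have h7 := ht p.1 (extChartAt (𝓡 m) x₀ p.2) ⟨(extChartAt (𝓡 m) x₀).map_source hp.1, by
      rw [mem_preimage, (extChartAt (𝓡 m) x₀).left_inv hp.1]; exact hp.2⟩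
    rw [mapInChart, (extChartAt (𝓡 m) x₀).left_inv hp.1] at h7
    refine ContMDiffAt.congr_of_eventuallyEq (ContMDiffAt.comp p (contMDiffAt_symm h7) h6) ?_
    filter_upwards [(hopen.preimage continuous_snd).mem_nhds hp] with q hq
    exact if_pos hq
  · have hpK : p.2 ∉ (extChartAt (𝓡 m) x₀).symm '' tsupport η := by
      rintro ⟨y, hy, hyp⟩
      exact hp ⟨hyp ▸ (extChartAt (𝓡 m) x₀).map_target (hst hy), hyp ▸ (hs hy).2⟩
    refine ContMDiffAt.congr_of_eventuallyEq ((hu p.2).comp p hsnd) ?_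
    filter_upwards [(hK.isClosed.isOpen_compl.preimage continuous_snd).mem_nhds hpK] with q hq
    exact chartVariation_of_notMem hq

variable [RiemannianBundle (fun x : M => TangentSpace (𝓡 m) x)]
  [RiemannianBundle (fun y : N => TangentSpace (𝓡 n) y)]

/-- The energy density in charts. -/
theorem energyDensity_symm (hu : ContMDiff (𝓡 m) (𝓡 n) ∞ u) {ι : Type*} [Fintype ι]
    (b : Module.Basis ι ℝ (ℰ m)) (hy : y ∈ chartDomain m n u x₀ z₀) :
    energyDensity m n u ((extChartAt (𝓡 m) x₀).symm y) = 1 / 2 * traceForm b (metricInChart x₀ y)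
      ((metricInChart z₀ (mapInChart m n u x₀ z₀ y)).bilinearComp
        (fderiv ℝ (mapInChart m n u x₀ z₀) y) (fderiv ℝ (mapInChart m n u x₀ z₀) y)) := by
  set e := fun i => chartDiff x₀ ((extChartAt (𝓡 m) x₀).symm y)
    (stdOrthonormalBasis ℝ (TangentSpace (𝓡 m) ((extChartAt (𝓡 m) x₀).symm y)) i) with he
  have he' : ∀ i, chartD x₀ y (e i) =
      stdOrthonormalBasis ℝ (TangentSpace (𝓡 m) ((extChartAt (𝓡 m) x₀).symm y)) i :=
    fun i => chartD_chartDiff hy.1 _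
  rw [energyDensity, traceForm_eq_sum b (metricInChart_pos hy.1) _
    (isParseval_orthonormalBasis hy.1 _ he')]
  congr 1
  refine Finset.sum_congr rfl fun i _ => ?_
  rw [ContinuousLinearMap.bilinearComp_apply, metricInChart_fderiv hu hy, he',
    real_inner_self_eq_norm_sq]

variable {lam : M → ℝ} [IsContMDiffRiemannianBundle (𝓡 m) ∞ (EuclideanSpace ℝ (Fin m))
      (fun x : M => TangentSpace (𝓡 m) x)]
  [IsContMDiffRiemannianBundle (𝓡 n) ∞ (EuclideanSpace ℝ (Fin n))
      (fun y : N => TangentSpace (𝓡 n) y)]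
  {hu : IsHorizontallyConformalSubmersion (m := m) (n := n) u lam}
  {hgrad : ∀ x, ∀ X ∈ horizontal m n u x, mvfderiv (𝓡 m) (fun y => lam y ^ 2) x X = 0}

/-- The energy density of the variation of `u` in a chart is the energy density of the variation of
the local model. -/
theorem energyDensity_chartVariation [T2Space M]
    (hσ : ContDiff ℝ ∞ σ) (hη : ContDiff ℝ ∞ η) (hc : HasCompactSupport η)
    (hs : tsupport η ⊆ chartDomain m n u x₀ z₀)
    (ht : ∀ t, ∀ y ∈ chartDomain m n u x₀ z₀,
      mapInChart m n u x₀ z₀ y + (σ t * η y) • w ∈ (extChartAt (𝓡 n) z₀).target)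
    {ι : Type*} [Fintype ι] (b : Module.Basis ι ℝ (ℰ m))
    (hy : y ∈ chartDomain m n u x₀ z₀) (t : ℝ) :
    energyDensity m n (fun x => chartVariation u x₀ z₀ σ η w (t, x))
      ((extChartAt (𝓡 m) x₀).symm y) =
      (chartModel hu hgrad x₀ z₀).variedEnergy b η w (σ t, y) := by
  have hU : ContMDiff (𝓡 m) (𝓡 n) ∞ (fun x => chartVariation u x₀ z₀ σ η w (t, x)) :=
    (contMDiff_chartVariation hu.smooth hσ hη hc hs ht).comp
      (contMDiff_const.prodMk contMDiff_id)
  have hyU : y ∈ chartDomain m n (fun x => chartVariation u x₀ z₀ σ η w (t, x)) x₀ z₀ := by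
    refine ⟨hy.1, ?_⟩
    simp only [mem_preimage]
    rw [chartVariation_symm hy]
    exact (extChartAt (𝓡 n) z₀).map_target (ht t y hy)
  have h1 : mapInChart m n (fun x => chartVariation u x₀ z₀ σ η w (t, x)) x₀ z₀ =ᶠ[𝓝 y]
      fun z => mapInChart m n u x₀ z₀ z + (σ t * η z) • w := by
    filter_upwards [(isOpen_chartDomain hu.smooth).mem_nhds hy] with z hz
    exact mapInChart_chartVariation hz (ht t z hz)
  have h2 : fderiv ℝ (mapInChart m n (fun x => chartVariation u x₀ z₀ σ η w (t, x)) x₀ z₀) y =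
      fderiv ℝ (mapInChart m n u x₀ z₀) y + σ t • (fderiv ℝ η y).smulRight w := by
    have h3 := (((contDiffOn_mapInChart hu.smooth).contDiffAt
      ((isOpen_chartDomain hu.smooth).mem_nhds hy)).differentiableAt (by simp)).hasFDerivAt.add
      ((((hη.differentiable (by simp)) y).hasFDerivAt.const_mul (σ t)).smul_const w)
    rw [h1.fderiv_eq]
    refine h3.fderiv.trans ?_
    ext v
    simp [mul_assoc]
  rw [energyDensity_symm hU b hyU, h2, h1.self_of_nhds]
  rfl

/-- A horizontally conformal `F`-harmonic map whose dilation is constant along horizontal curves has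
minimal fibres. -/
theorem hasMinimalFibres_of_isFHarmonic [T2Space M] [MeasurableSpace M] [BorelSpace M]
    (hn : 1 ≤ n) {F : ℝ → ℝ} (hF : IsEnergyFunction F)
    (hharm : IsFHarmonic (m := m) (n := n) F u) :
    (chartModel hu hgrad x₀ z₀).HasMinimalFibres := by
  refine ConformalModel.hasMinimalFibres_of_stationary (μ := volume) (b := stdBasis m) hF
    (stdBasis n) (by rw [Fintype.card_fin]; omega) fun η w hη hc hs => ?_
  obtain ⟨ε, hε, hmem⟩ := ConformalModel.exists_variation_mem hη.continuous hc hs w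
  -- any smooth function with values in `[-ε, ε]`, vanishing at `0` with nonzero derivative there,
  -- would do
  set σ : ℝ → ℝ := fun t => ε * Real.sin t with hσdef
  have hσ : ContDiff ℝ ∞ σ := contDiff_const.mul Real.contDiff_sin
  have ht : ∀ t, ∀ y ∈ chartDomain m n u x₀ z₀,
      mapInChart m n u x₀ z₀ y + (σ t * η y) • w ∈ (extChartAt (𝓡 n) z₀).target :=
    fun t y hy => hmem (σ t) (by
      rw [hσdef, abs_mul, abs_of_pos hε]
      exact mul_le_of_le_one_right hε.le (Real.abs_sin_le_one t)) y hy
  have hst : tsupport η ⊆ (extChartAt (𝓡 m) x₀).target :=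
    Subset.trans hs inter_subset_left
  have hK : IsCompact ((extChartAt (𝓡 m) x₀).symm '' tsupport η) :=
    hc.isCompact.image_of_continuousOn ((continuousOn_extChartAt_symm x₀).mono hst)
  have h1 := hharm.2 (chartVariation u x₀ z₀ σ η w) ((extChartAt (𝓡 m) x₀).symm '' tsupport η)
    (contMDiff_chartVariation hu.smooth hσ hη hc hs ht)
    (fun x => chartVariation_of_mul_eq_zero fun _ => by simp [hσdef]) hK
    (fun t x hx => chartVariation_of_notMem hx)
  have hE : ∀ t, ∀ y ∈ tsupport η, energyDensity m n (fun x => chartVariation u x₀ z₀ σ η w (t, x))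
      ((extChartAt (𝓡 m) x₀).symm y) =
      (chartModel hu hgrad x₀ z₀).variedEnergy (stdBasis m) η w (σ t, y) :=
    fun t y hy => energyDensity_chartVariation hσ hη hc hs ht (stdBasis m) (hs hy) t
  have h2 : ∀ t, ∫ x in (extChartAt (𝓡 m) x₀).symm '' tsupport η,
      F (energyDensity m n (fun z => chartVariation u x₀ z₀ σ η w (t, z)) x)
        ∂(riemannianVolume m M) = ∫ y in tsupport η,
      F ((chartModel hu hgrad x₀ z₀).variedEnergy (stdBasis m) η w (σ t, y)) *
        density (stdBasis m) ((chartModel hu hgrad x₀ z₀).G y) := by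
    intro t
    refine setIntegral_riemannianVolume hc hst (fun y hy => congrArg F (hE t y hy)) ?_
    refine hF.continuousOn.comp (fun y hy => ?_) fun y hy => ?_
    · have h3 := ConformalModel.contDiffAt_variedEnergy (S := chartModel hu hgrad x₀ z₀)
        (b := stdBasis m) hη (hs hy) (ht t y (hs hy))
      exact (h3.continuousAt.comp (f := fun z => (σ t, z))
        (continuousAt_const.prodMk continuousAt_id)).continuousWithinAt
    · rw [mem_Ici, ← hE t y hy, energyDensity]
      positivity
  simp only [h2] at h1
  have h3 := ConformalModel.hasDerivAt_energy (S := chartModel hu hgrad x₀ z₀) (b := stdBasis m)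
    (μ := volume) (w := w) hF (stdBasis n) (by rw [Fintype.card_fin]; omega) hη hc hs
  have hσ0 : HasDerivAt σ ε 0 := by
    simpa using (Real.hasDerivAt_sin 0).const_mul ε
  have hσz : σ 0 = 0 := by simp [hσdef]
  rw [← hσz] at h3
  have h4 := (h3.comp (0 : ℝ) hσ0).unique h1
  exact (mul_eq_zero.1 h4).resolve_right hε.ne'

end Variation

/-! ### Harmonic forms -/

section ZeroForm

variable {m : ℕ} {M : Type*} [TopologicalSpace M] [ChartedSpace (EuclideanSpace ℝ (Fin m)) M]

theorem isSmoothForm_zero {p : ℕ} : IsSmoothForm (0 : DForm m M p) := fun x => by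
  have h : formInChart (0 : DForm m M p) x = fun _ => 0 := rfl
  rw [h]
  exact contDiffOn_const

theorem extD_zero {p : ℕ} (x : M) : extD (0 : DForm m M p) x = 0 := by
  have h : formInChart (0 : DForm m M p) x = fun _ => 0 := rfl
  have h2 : extDeriv (fun _ : EuclideanSpace ℝ (Fin m) =>
      (0 : EuclideanSpace ℝ (Fin m) [⋀^Fin p]→L[ℝ] ℝ)) (extChartAt (𝓡 m) x x) = 0 := by
    rw [extDeriv, fderiv_fun_const, Pi.zero_apply]
    exact map_zero (ContinuousAlternatingMap.alternatizeUncurryFinCLM ℝ (EuclideanSpace ℝ (Fin m)) ℝ)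
  rw [extD, h, h2]
  rfl

variable [IsManifold (𝓡 m) ∞ M] [RiemannianBundle (fun x : M => TangentSpace (𝓡 m) x)]

theorem covDerivForm_zero {p : ℕ} (X : VField m M) (W : Fin p → VField m M) (x : M) :
    covDerivForm (0 : DForm m M p) X W x = 0 := by
  have h : mvfderiv (𝓡 m) (fun _ : M => (0 : ℝ)) x = 0 := mvfderiv_const 0
  have h2 : mvfderiv (𝓡 m) (fun y : M => (0 : DForm m M p) y (fun j => W j y)) x (X x) = 0 :=
    congrArg (fun T : TangentSpace (𝓡 m) x →L[ℝ] ℝ => T (X x)) h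
  rw [covDerivForm, h2]
  simp

/-- The codifferential of the zero form is unique: each tangent vector extends to a local field, so
the defining relation is not vacuous. -/
theorem isCodifferential_zero_iff {p : ℕ} {γ : DForm m M p} :
    IsCodifferential (0 : DForm m M (p + 1)) γ ↔ γ = 0 := by
  constructor
  · intro h
    funext x
    ext w
    have hdim : Module.finrank ℝ (TangentSpace (𝓡 m) x) = m :=
      finrank_euclideanSpace_fin (𝕜 := ℝ) (n := m)
    let b := (stdOrthonormalBasis ℝ (TangentSpace (𝓡 m) x)).reindex (finCongr hdim)
    have key := h x b (fun i => FiberBundle.extend (EuclideanSpace ℝ (Fin m)) (b i))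
      (fun j => FiberBundle.extend (EuclideanSpace ℝ (Fin m)) (w j))
      (fun i => smoothFieldAt_extend _) (fun i => FiberBundle.extend_apply_self _ _)
      (fun j => smoothFieldAt_extend _)
    simp only [covDerivForm_zero, FiberBundle.extend_apply_self, Finset.sum_const_zero,
      neg_zero] at key
    exact key
  · rintro rfl x b E W - - -
    simp only [covDerivForm_zero, Finset.sum_const_zero, neg_zero]
    rfl

end ZeroForm

/-- If `grad (lam ^ 2) / (2 * lam ^ 2)` is normal to the horizontal distribution, then the dilation
is constant along horizontal curves. -/
theorem mvfderiv_eq_zero_of_horizontal {m n : ℕ}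
    {M : Type*} [TopologicalSpace M] [ChartedSpace (EuclideanSpace ℝ (Fin m)) M]
    {N : Type*} [TopologicalSpace N] [ChartedSpace (EuclideanSpace ℝ (Fin n)) N]
    [RiemannianBundle (fun x : M => TangentSpace (𝓡 m) x)]
    {u : M → N} {lam : M → ℝ} {x : M} (hpos : 0 < lam x)
    (h : (1 / (2 * lam x ^ 2)) • grad (m := m) (fun y => lam y ^ 2) x ∈ (horizontal m n u x)ᗮ)
    {X : TangentSpace (𝓡 m) x} (hX : X ∈ horizontal m n u x) :
    mvfderiv (𝓡 m) (fun y => lam y ^ 2) x X = 0 := by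
  have h1 := Submodule.inner_left_of_mem_orthogonal hX h
  rw [real_inner_smul_left, inner_grad] at h1
  exact (mul_eq_zero.1 h1).resolve_left (by positivity)

end FHarmonic

theorem theorem3 (m n : ℕ) (hn : 1 ≤ n) (hmn : n < m)
    {M : Type*} [TopologicalSpace M] [ChartedSpace (EuclideanSpace ℝ (Fin m)) M]
    [IsManifold (𝓡 m) ∞ M] [T2Space M] [SecondCountableTopology M]
    [MeasurableSpace M] [BorelSpace M]
    [RiemannianBundle (fun x : M => TangentSpace (𝓡 m) x)]
    [IsContMDiffRiemannianBundle (𝓡 m) ∞ (EuclideanSpace ℝ (Fin m))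
      (fun x : M => TangentSpace (𝓡 m) x)]
    {N : Type*} [TopologicalSpace N] [ChartedSpace (EuclideanSpace ℝ (Fin n)) N]
    [IsManifold (𝓡 n) ∞ N] [T2Space N] [SecondCountableTopology N]
    [RiemannianBundle (fun y : N => TangentSpace (𝓡 n) y)]
    [IsContMDiffRiemannianBundle (𝓡 n) ∞ (EuclideanSpace ℝ (Fin n))
      (fun y : N => TangentSpace (𝓡 n) y)]
    (volN : FHarmonic.DForm n N n) (hvolN : FHarmonic.IsVolumeForm volN)
    (F : ℝ → ℝ) (hF : FHarmonic.IsEnergyFunction F)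
    (hzeros : ∀ t : ℝ, 0 < t →
      ((n : ℝ) - 2) * deriv F t - 2 * t * deriv (deriv F) t = 0 →
      ∀ᶠ s in 𝓝[≠] t, ((n : ℝ) - 2) * deriv F s - 2 * s * deriv (deriv F) s ≠ 0)
    (u : M → N) (lam : M → ℝ)
    (hu : FHarmonic.IsHorizontallyConformalSubmersion (m := m) (n := n) u lam)
    (hharm : FHarmonic.IsFHarmonic (m := m) (n := n) F u)
    (hmean : FHarmonic.IsMeanCurvatureVector n (FHarmonic.horizontal m n u)
      (fun x => (1 / (2 * lam x ^ 2)) • FHarmonic.grad (m := m) (fun y => lam y ^ 2) x)) :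
    (FHarmonic.IsHarmonicForm (FHarmonic.pullbackForm (m := m) u volN) ↔
      FHarmonic.IsCompletelyIntegrable n (FHarmonic.horizontal m n u)) ∧
    (((∀ x, FHarmonic.extD (FHarmonic.pullbackForm (m := m) u volN) x = 0) ∧
        FHarmonic.IsCoclosed (FHarmonic.pullbackForm (m := m) u volN)) ↔
      FHarmonic.IsCompletelyIntegrable n (FHarmonic.horizontal m n u)) := by

  have hgrad : ∀ x, ∀ X ∈ FHarmonic.horizontal m n u x,
      mvfderiv (𝓡 m) (fun y => lam y ^ 2) x X = 0 := fun x X hX =>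
    FHarmonic.mvfderiv_eq_zero_of_horizontal (hu.dilation_pos x) (hmean x).1 hX
  have hmin : ∀ x₀, (FHarmonic.chartModel hu hgrad x₀ (u x₀)).HasMinimalFibres :=
    fun x₀ => FHarmonic.hasMinimalFibres_of_isFHarmonic hn hF hharm
  have hsm := FHarmonic.isSmoothForm_pullbackForm hu.smooth hvolN.1
  have hd : FHarmonic.extD (FHarmonic.pullbackForm (m := m) u volN) = 0 :=
    funext (FHarmonic.extD_pullbackForm hu.smooth hvolN.1)
  obtain ⟨k, rfl⟩ : ∃ k, n = k + 1 := ⟨n - 1, by omega⟩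
  refine ⟨⟨?_, fun hint => ⟨hsm, 0, 0, FHarmonic.isSmoothForm_zero,
      FHarmonic.isCodifferential_zero_of_integrable hu hgrad hvolN hmin hint, ?_, fun x => ?_⟩⟩,
    ⟨fun h => FHarmonic.isCompletelyIntegrable_of_closed hu hgrad hvolN hmin
      FHarmonic.isSmoothForm_zero h.2 FHarmonic.extD_zero,
    fun hint => ⟨FHarmonic.extD_pullbackForm hu.smooth hvolN.1,
      FHarmonic.isCodifferential_zero_of_integrable hu hgrad hvolN hmin hint⟩⟩⟩
  · rintro ⟨-, β, γ, hβ, hcod, hγ, hsum⟩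
    rw [hd, FHarmonic.isCodifferential_zero_iff] at hγ
    refine FHarmonic.isCompletelyIntegrable_of_closed hu hgrad hvolN hmin hβ hcod fun x => ?_
    have h := hsum x
    rwa [hγ, Pi.zero_apply, add_zero] at h
  · rw [hd, FHarmonic.isCodifferential_zero_iff]
  · rw [FHarmonic.extD_zero, zero_add]
    rfl
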